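/- **The language.** Fix a set of type constants $\alpha$ and a set of term constants $c$, each $c$ declared with a type $!A_c$. Types are $A,B::=\alpha\mid A\multimap B\mid A\otimes B\mid 1\mid\,!A$; write $!^nA$ for $n$ bangs. Subtyping $<:$ is generated, under the side condition $m=0\vee n\ge 1$, by $!^n\alpha<:\,!^m\alpha$; $!^n1<:\,!^m1$; $!^n(A'\multimap B)<:\,!^m(A\multimap B')$ if $A<:A'$ and $B<:B'$; $!^n(A\otimes B)<:\,!^m(A'\otimes B')$ if $A<:A'$ and $B<:B'$. Indexed terms, up to $\alpha$-equivalence, are $$M,N::=x^A\mid c^A\mid *^n\mid\lambda^nx^A.M\mid MN\mid\langle M,N\rangle^n\mid \mathrm{let}\,\langle x^A,y^B\rangle^n=M\,\mathrm{in}\,N\mid \mathrm{let}\,*=M\,\mathrm{in}\,N .$$ A zero index is omitted; $\mathrm{let}\,x^A=N\,\mathrm{in}\,M$ abbreviates $(\lambda^0x^A.M)N$ and $\lambda{*}.M$ abbreviates $\lambda^0x^{1}.\mathrm{let}\,*=x^1\,\mathrm{in}\,M$. Values $V,W$ are $x^A$, $c^A$, $*^n$, $\lambda^nx^A.M$, $\langle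 V,W\rangle^n$, and $\mathrm{let}\,x^A=V\,\mathrm{in}\,W$, $\mathrm{let}\,\langle x^A,y^B\rangle^n=V\,\mathrm{in}\,W$, $\mathrm{let}\,*=V\,\mathrm{in}\,W$. In the typing rules $!\Delta$ is a context all of whose types are of the form $!A$, and it is the only part of a context that is shared by two premises or left unused: - $!\Delta,x{:}A\vdash x^B:B$ if $A<:B$; $\ !\Delta\vdash c^B:B$ if $!A_c<:B$; $\ !\Delta\vdash *^n:\,!^n1$; - $\Delta\vdash\lambda^0x^A.M:A\multimap B$ if $\Delta,x{:}A\vdash M:B$; $\ !\Delta\vdash\lambda^{n+1}x^A.M:\,!^{n+1}(A\multimap B)$ if $!\Delta,x{:}A\vdash M:B$; - if $!\Delta,\Gamma_1\vdash M:T$ and $!\Delta,\Gamma_2,\Xi\vdash N:T'$, then in context $!\Delta,\Gamma_1,\Gamma_2$: $MN:B$ (for $T=A\multimap B$, $T'=A$, $\Xi=\emptyset$); $\langle M,N\rangle^n:\,!^n(A\otimes B)$ (for $T=\,!^nA$, $T'=\,!^nB$, $\Xi=\emptyset$); $\mathrm{let}\,*=M\,\mathrm{in}\,N:T'$ (for $T=1$,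 $\Xi=\emptyset$); $\mathrm{let}\,\langle x^A,y^B\rangle^n=M\,\mathrm{in}\,N:T'$ (for $T=\,!^n(A\otimes B)$, $\Xi=x{:}\,!^nA,\,y{:}\,!^nB$). A judgment is valid if derivable. For $M$ of type $A$ and $A<:A'$, $\langle M:A<:A'\rangle$ denotes the canonical re-indexing of $M$ at type $A'$ (same underlying untyped term). $M[V/x]$ is capture-avoiding substitution replacing each free $x^{A'}$ by $V$ re-indexed at $A'$. **Axiomatic equivalence.** $\approx_{ax}$ is the reflexive, symmetric, transitive and congruence closure on valid judgments (both sides valid in the same context at the same type) of the following axioms, where $-$ is any of $x^A$, $*$, $\langle x^A,y^B\rangle^n$ and bound variables are not captured: - $\mathrm{let}\,x=V\,\mathrm{in}\,M\approx M[V/x]$; $\ \mathrm{let}\,\langle x,y\rangle^n=\langle V,W\rangle^n\,\mathrm{in}\,M\approx M[V/x,W/y]$; $\ \mathrm{let}\,*=*\,\mathrm{in}\,M\approx M$; - $\lambda^nx^A.\langle V:\,!^n(A\multimap B)<:A\multimap B\rangle x^A\approx V$; $\ \mathrm{let}\,x^A=N\,\mathrm{in}\,x^A\approx N$; $\ \mathrm{let}\,\langle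 x^A,y^B\rangle^n=N\,\mathrm{in}\,\langle x^{!^nA},y^{!^nB}\rangle^n\approx N$; $\ \mathrm{let}\,*=\langle N:\,!^n1<:1\rangle\,\mathrm{in}\,*^n\approx N$; - $\mathrm{let}\,-_1=(\mathrm{let}\,-_2=M\,\mathrm{in}\,N)\,\mathrm{in}\,P\approx\mathrm{let}\,-_2=M\,\mathrm{in}\,\mathrm{let}\,-_1=N\,\mathrm{in}\,P$; $\ \mathrm{let}\,-_1=V\,\mathrm{in}\,\mathrm{let}\,-_2=W\,\mathrm{in}\,M\approx\mathrm{let}\,-_2=W\,\mathrm{in}\,\mathrm{let}\,-_1=V\,\mathrm{in}\,M$; - $\mathrm{let}\,x^{A\multimap B}=M\,\mathrm{in}\,\mathrm{let}\,y^A=N\,\mathrm{in}\,x^{A\multimap B}y^A\approx MN$; $\ \mathrm{let}\,x^A=M\,\mathrm{in}\,\mathrm{let}\,y^B=N\,\mathrm{in}\,\langle x^A,y^B\rangle^n\approx\langle M,N\rangle^n$; $\ \mathrm{let}\,x^D=V\,\mathrm{in}\,\lambda^ny^A.M\approx\lambda^ny^A.\mathrm{let}\,x^D=V\,\mathrm{in}\,M$;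 - $\langle M:\,!^n(A\multimap D)<:B\multimap D'\rangle\langle N:C<:B\rangle\approx\langle\,\langle M:\,!^n(A\multimap D)<:A\multimap D\rangle\langle N:C<:A\rangle:D<:D'\rangle$; $\ \mathrm{let}\,\langle x^{A'},y^{B'}\rangle^{n'}=\langle M:\,!^n(A\otimes B)<:\,!^{n'}(A'\otimes B')\rangle\,\mathrm{in}\,N\approx\mathrm{let}\,\langle x^A,y^B\rangle^n=M\,\mathrm{in}\,N$; $\ \mathrm{let}\,x^{A'}=\langle M:A<:A'\rangle\,\mathrm{in}\,N\approx\mathrm{let}\,x^A=M\,\mathrm{in}\,N$; $\ \mathrm{let}\,*=\langle M:\,!^m1<:\,!^n1\rangle\,\mathrm{in}\,N\approx\mathrm{let}\,*=M\,\mathrm{in}\,N$. **The syntactic category $\mathcal C_\lambda$.** Objects are types; arrows $A\to B$ are valid judgments $x{:}A\vdash V:B$ with $V$ a value, up to $\approx_{ax}$; the composite of $x{:}A\vdash V:B$ and $y{:}B\vdash W:C$ is $x{:}A\vdash\mathrm{let}\,y=V\,\mathrm{in}\,W:C$ and the identity is $x{:}A\vdash x:A$. It carries (annotations omitted; each inverse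 of a structure map is the evident term) - $\otimes$, $1$, with $V\otimes W=\mathrm{let}\,\langle x,y\rangle=z\,\mathrm{in}\,\langle V,W\rangle$ and the evident associativity, unit and symmetry maps; - the comonad $LA=\,!A$, where $LV$ is the canonical promotion $x{:}\,!A\vdash V':\,!B$ of $V$, with $\varepsilon=x^A$, $\delta=x^{!!A}$, $d_{A,B}=\mathrm{let}\,\langle x,y\rangle=z\,\mathrm{in}\,\langle x,y\rangle^1$, inverse $\mathrm{let}\,\langle x,y\rangle^1=z\,\mathrm{in}\,\langle x,y\rangle$, $d_1=\mathrm{let}\,*=z\,\mathrm{in}\,*^1$, and comonoid maps $\langle x,x\rangle$ and $*$ on $!A$; - the strong monad $TA=1\multimap A$ with $\eta=\lambda{*}.x$, $\mu=\lambda{*}.(x*)*$, $V^*=\lambda{*}.\mathrm{let}\,x=y*\,\mathrm{in}\,V*$ and strength $\mathrm{let}\,\langle x,y\rangle=z\,\mathrm{in}\,\lambda{*}.\langle x,y*\rangle$; - the Kleisli exponential $A\multimap B$, with $V\multimap W=\lambda x.\mathrm{let}\,y=zV\,\mathrm{in}\,W$, $\Phi(V)=\lambda{*}.\mathrm{let}\,\langle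 x,y\rangle=t\,\mathrm{in}\,Vy$ and $\Phi^{-1}(V)=\lambda y.\mathrm{let}\,t=\langle x,y\rangle\,\mathrm{in}\,V*$. **Denotations.** Let $\Theta$ be the identity interpretation: $\Theta(\alpha)=\alpha$ and $\Theta(c)=(z{:}1\vdash\mathrm{let}\,*=z\,\mathrm{in}\,c:\,!A_c)$, so $[\![A]\!]=A$. A context denotes the tensor product of its types, and $I_{A,B}$ is the canonical arrow of $A<:B$ built from $\varepsilon,\delta$ by $L,\otimes,\multimap$. By recursion on typing derivations, every term has a computational denotation $[\![\Gamma\vdash M:A]\!]^c:\Gamma\to TA$ and every value a value denotation $[\![\Gamma\vdash V:A]\!]^v:\Gamma\to A$, in the usual call-by-value way (contexts $!\Delta$ are copied and discarded by the comonoid maps): - value denotations: $[\![x]\!]^v$ is the projection followed by $I_{A,B}$; $[\![c]\!]^v$ discards $!\Delta$ and applies $\Theta(c);I_{!A_c,B}$; $[\![*^n]\!]^v$ discards $!\Delta$ and applies $d_1;I_{!1,!^n1}$; $[\![\lambda^0x.M]\!]^v=\Phi^{-1}[\![M]\!]^c$; $[\![\lambda^{n+1}x.M]\!]^v$ is the canonical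 $!\Delta\to L(!\Delta)$ followed by $L(\Phi^{-1}[\![M]\!]^c);I$; $[\![\langle V,W\rangle^n]\!]^v$ is $[\![V]\!]^v\otimes[\![W]\!]^v$ followed by $d$ for $L^n$; $[\![\mathrm{let}\,{-}=V\,\mathrm{in}\,W]\!]^v$ feeds $[\![V]\!]^v$ into $[\![W]\!]^v$, after the inverse of $d$ for $L^n$ when $-$ is a pair; - computational denotations: $[\![U]\!]^c=[\![U]\!]^v;\eta$ for $U$ a variable, constant, $*^n$ or abstraction; with $\Psi_1:TA\otimes TB\to T(A\otimes B)$ the map evaluating the left component first, $[\![MN]\!]^c$ is $[\![M]\!]^c\otimes[\![N]\!]^c$ followed by $\Psi_1$ and $\Phi(\mathrm{id})^*$, and $[\![\langle M,N\rangle^n]\!]^c$ is the same pair followed by $\Psi_1$ and $T$ of $d$ for $L^n$; $[\![\mathrm{let}\,*=M\,\mathrm{in}\,N]\!]^c$ and $[\![\mathrm{let}\,\langle x,y\rangle^n=M\,\mathrm{in}\,N]\!]^c$ feed $[\![M]\!]^c$ through the strength into $([\![N]\!]^c)^*$ (after $T$ of the inverse of $d$ for $L^n$ in the second case). **Theorem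 (completeness).** Let $A,B$ be types. 1. For every valid judgment $x{:}A\vdash M:B$, and whichever typing derivation is used to compute its denotation, $$[\![x{:}A\vdash M:B]\!]^c_\Theta\ \approx_{ax}\ (x{:}A\vdash\lambda{*}.M:1\multimap B).$$ 2. For every valid judgment $x{:}A\vdash V:B$ with $V$ a value, and whichever typing derivation is used, $$[\![x{:}A\vdash V:B]\!]^v_\Theta\ \approx_{ax}\ (x{:}A\vdash V:B).$$ -/

import Mathlib

universe u v w w'

set_option linter.checkUnivs false

namespace LinLam

/-! ### Types, subtyping, terms, typing derivations -/

/-- Types `A, B ::= α | A ⊸ B | A ⊗ B | 1 | !A` over a set of type constants. -/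
inductive Ty (At : Type u) : Type u
  | atom (a : At)
  | lolli (A B : Ty At)
  | tensor (A B : Ty At)
  | one
  | bang (A : Ty At)

/-- `!ⁿA`. -/
def Ty.bangs {At : Type u} : ℕ → Ty At → Ty At
  | 0, A => A
  | n + 1, A => .bang (Ty.bangs n A)

/-- The number of leading `!` of a type. -/
def Ty.nb {At : Type u} : Ty At → ℕ
  | .bang A => A.nb + 1
  | _ => 0

/-- The type without its leading `!`s. -/
def Ty.core {At : Type u} : Ty At → Ty At
  | .bang A => A.core
  | A => A

/-- The domain of a function type (junk on the other types). -/
def Ty.dom {At : Type u} : Ty At → Ty At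
  | .lolli A _ => A
  | A => A

/-- The codomain of a function type (junk on the other types). -/
def Ty.cod {At : Type u} : Ty At → Ty At
  | .lolli _ B => B
  | A => A

/-- Remove (at most) `n` leading `!`s. -/
def Ty.unbangs {At : Type u} : ℕ → Ty At → Ty At
  | n + 1, .bang A => Ty.unbangs n A
  | _, A => A

/-- Derivations of the subtyping relation `A <: B`. -/
inductive Sub {At : Type u} : Ty At → Ty At → Type u
  | atom (n m : ℕ) (h : m = 0 ∨ 1 ≤ n) (a : At) :
      Sub (Ty.bangs n (.atom a)) (Ty.bangs m (.atom a))
  | one (n m : ℕ) (h : m = 0 ∨ 1 ≤ n) : Sub (Ty.bangs n .one) (Ty.bangs m .one)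
  | lolli (n m : ℕ) (h : m = 0 ∨ 1 ≤ n) {A A' B B' : Ty At} (s : Sub A A') (t : Sub B B') :
      Sub (Ty.bangs n (.lolli A' B)) (Ty.bangs m (.lolli A B'))
  | tensor (n m : ℕ) (h : m = 0 ∨ 1 ≤ n) {A A' B B' : Ty At} (s : Sub A A') (t : Sub B B') :
      Sub (Ty.bangs n (.tensor A B)) (Ty.bangs m (.tensor A' B'))

/-- The type constants and the term constants of the language; the constant `c` is declared
with the type `!(S.ty c)`. -/
structure Signature where
  Atom : Type u
  Const : Type v
  ty : Const → Ty Atom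

/-- Indexed terms, up to `α`-equivalence: variables are de Bruijn indices.
`lam n A M` is `λⁿ x^A. M` and binds index `0` in `M`;
`letpair n A B M N` is `let ⟨x^A, y^B⟩ⁿ = M in N` and binds `y` as index `0`, `x` as index `1`
in `N`; `letunit M N` is `let * = M in N`. -/
inductive Term (S : Signature.{u, v}) : Type (max u v)
  | var (i : ℕ) (A : Ty S.Atom)
  | const (c : S.Const) (A : Ty S.Atom)
  | unit (n : ℕ)
  | lam (n : ℕ) (A : Ty S.Atom) (M : Term S)
  | app (M N : Term S)
  | pair (n : ℕ) (M N : Term S)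
  | letpair (n : ℕ) (A B : Ty S.Atom) (M N : Term S)
  | letunit (M N : Term S)

/-- `let x^A = N in M`, an abbreviation of `(λ⁰ x^A. M) N`. -/
abbrev Term.letIn {S : Signature.{u, v}} (A : Ty S.Atom) (N M : Term S) : Term S :=
  .app (.lam 0 A M) N

/-- Core values and (extended) values. -/
inductive IsValue {S : Signature.{u, v}} : Term S → Prop
  | var (i : ℕ) (A : Ty S.Atom) : IsValue (.var i A)
  | const (c : S.Const) (A : Ty S.Atom) : IsValue (.const c A)
  | unit (n : ℕ) : IsValue (.unit n)
  | lam (n : ℕ) (A : Ty S.Atom) (M : Term S) : IsValue (.lam n A M)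
  | pair (n : ℕ) {V W : Term S} (hV : IsValue V) (hW : IsValue W) : IsValue (.pair n V W)
  | letIn (A : Ty S.Atom) {V W : Term S} (hV : IsValue V) (hW : IsValue W) :
      IsValue (.letIn A V W)
  | letpair (n : ℕ) (A B : Ty S.Atom) {V W : Term S} (hV : IsValue V) (hW : IsValue W) :
      IsValue (.letpair n A B V W)
  | letunit {V W : Term S} (hV : IsValue V) (hW : IsValue W) : IsValue (.letunit V W)

/-- Lift a renaming under one binder. -/
def liftRen (r : ℕ → ℕ) : ℕ → ℕ
  | 0 => 0
  | i + 1 => r i + 1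

/-- Lift a renaming under `k` binders. -/
def liftRenN (k : ℕ) (r : ℕ → ℕ) : ℕ → ℕ :=
  liftRen^[k] r

/-- Renaming of the free variables. -/
def Term.rename {S : Signature.{u, v}} (r : ℕ → ℕ) : Term S → Term S
  | .var i A => .var (r i) A
  | .const c A => .const c A
  | .unit n => .unit n
  | .lam n A M => .lam n A (M.rename (liftRen r))
  | .app M N => .app (M.rename r) (N.rename r)
  | .pair n M N => .pair n (M.rename r) (N.rename r)
  | .letpair n A B M N => .letpair n A B (M.rename r) (N.rename (liftRen (liftRen r)))
  | .letunit M N => .letunit (M.rename r) (N.rename r)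

/-- Weakening by `k` new innermost variables. -/
abbrev Term.shift {S : Signature.{u, v}} (k : ℕ) (M : Term S) : Term S :=
  M.rename (fun i => i + k)

/-- `λ⁰*⁰. M`, an abbreviation of `λ⁰ x^1. let * = x^1 in M`. -/
def Term.lamU {S : Signature.{u, v}} (M : Term S) : Term S :=
  .lam 0 .one (.letunit (.var 0 .one) (M.shift 1))

/-- A typing context: the `i`-th entry is `some A` if the variable `i` is declared with type `A`,
and `none` if the variable `i` is not declared. -/
abbrev Ctx (At : Type u) := List (Option (Ty At))

/-- The context is of the form `!Δ`. -/
inductive AllBang {At : Type u} : Ctx At → Type u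
  | nil : AllBang []
  | skip {Γ : Ctx At} (b : AllBang Γ) : AllBang (none :: Γ)
  | cons {Γ : Ctx At} (A : Ty At) (b : AllBang Γ) : AllBang (some (.bang A) :: Γ)

/-- The context is of the form `!Δ, i : A`. -/
inductive Pick {At : Type u} : Ctx At → ℕ → Ty At → Type u
  | here {Γ : Ctx At} {A : Ty At} (b : AllBang Γ) : Pick (some A :: Γ) 0 A
  | skip {Γ : Ctx At} {i : ℕ} {A : Ty At} (p : Pick Γ i A) : Pick (none :: Γ) (i + 1) A
  | weak {Γ : Ctx At} {i : ℕ} {A : Ty At} (B : Ty At) (p : Pick Γ i A) :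
      Pick (some (.bang B) :: Γ) (i + 1) A

/-- `Split Γ Γ₁' Γ₂'`: there are `!Δ`, `Γ₁`, `Γ₂` with `Γ = !Δ, Γ₁, Γ₂`, `Γ₁' = !Δ, Γ₁` and
`Γ₂' = !Δ, Γ₂`. -/
inductive Split {At : Type u} : Ctx At → Ctx At → Ctx At → Type u
  | nil : Split [] [] []
  | skip {Γ Γ₁ Γ₂ : Ctx At} (s : Split Γ Γ₁ Γ₂) : Split (none :: Γ) (none :: Γ₁) (none :: Γ₂)
  | left {Γ Γ₁ Γ₂ : Ctx At} (A : Ty At) (s : Split Γ Γ₁ Γ₂) :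
      Split (some A :: Γ) (some A :: Γ₁) (none :: Γ₂)
  | right {Γ Γ₁ Γ₂ : Ctx At} (A : Ty At) (s : Split Γ Γ₁ Γ₂) :
      Split (some A :: Γ) (none :: Γ₁) (some A :: Γ₂)
  | both {Γ Γ₁ Γ₂ : Ctx At} (A : Ty At) (s : Split Γ Γ₁ Γ₂) :
      Split (some (.bang A) :: Γ) (some (.bang A) :: Γ₁) (some (.bang A) :: Γ₂)

/-- Typing derivations of `Γ ⊢ M : A`. -/
inductive Deriv {S : Signature.{u, v}} : Ctx S.Atom → Term S → Ty S.Atom → Type (max u v)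
  | ax1 {Γ : Ctx S.Atom} {i : ℕ} {A B : Ty S.Atom} (p : Pick Γ i A) (s : Sub A B) :
      Deriv Γ (.var i B) B
  | ax2 {Γ : Ctx S.Atom} {B : Ty S.Atom} (c : S.Const) (b : AllBang Γ)
      (s : Sub (.bang (S.ty c)) B) : Deriv Γ (.const c B) B
  | app {Γ Γ₁ Γ₂ : Ctx S.Atom} {M N : Term S} {A B : Ty S.Atom} (sp : Split Γ Γ₁ Γ₂)
      (d : Deriv Γ₁ M (.lolli A B)) (e : Deriv Γ₂ N A) : Deriv Γ (.app M N) B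
  | lam1 {Γ : Ctx S.Atom} {M : Term S} {A B : Ty S.Atom} (d : Deriv (some A :: Γ) M B) :
      Deriv Γ (.lam 0 A M) (.lolli A B)
  | lam2 {Γ : Ctx S.Atom} (n : ℕ) {M : Term S} {A B : Ty S.Atom} (b : AllBang Γ)
      (d : Deriv (some A :: Γ) M B) :
      Deriv Γ (.lam (n + 1) A M) (Ty.bangs (n + 1) (.lolli A B))
  | oneI {Γ : Ctx S.Atom} (n : ℕ) (b : AllBang Γ) : Deriv Γ (.unit n) (Ty.bangs n .one)
  | tensorI {Γ Γ₁ Γ₂ : Ctx S.Atom} (n : ℕ) {M N : Term S} {A B : Ty S.Atom}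
      (sp : Split Γ Γ₁ Γ₂) (d : Deriv Γ₁ M (Ty.bangs n A)) (e : Deriv Γ₂ N (Ty.bangs n B)) :
      Deriv Γ (.pair n M N) (Ty.bangs n (.tensor A B))
  | oneE {Γ Γ₁ Γ₂ : Ctx S.Atom} {M N : Term S} {A : Ty S.Atom} (sp : Split Γ Γ₁ Γ₂)
      (d : Deriv Γ₁ M .one) (e : Deriv Γ₂ N A) : Deriv Γ (.letunit M N) A
  | tensorE {Γ Γ₁ Γ₂ : Ctx S.Atom} (n : ℕ) {M N : Term S} {A₁ A₂ C : Ty S.Atom}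
      (sp : Split Γ Γ₁ Γ₂) (d : Deriv Γ₁ M (Ty.bangs n (.tensor A₁ A₂)))
      (e : Deriv (some (Ty.bangs n A₂) :: some (Ty.bangs n A₁) :: Γ₂) N C) :
      Deriv Γ (.letpair n A₁ A₂ M N) C

/-- `Γ ⊢ M : A` is a valid typing judgment. -/
def Valid {S : Signature.{u, v}} (Γ : Ctx S.Atom) (M : Term S) (A : Ty S.Atom) : Prop :=
  Nonempty (Deriv Γ M A)

/-! ### Type casting, substitution, promotion -/

/-- The type of a (well-typed) indexed term; it is determined by the annotations. -/
def Term.infer {S : Signature.{u, v}} : Term S → Ty S.Atom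
  | .var _ A => A
  | .const _ A => A
  | .unit n => Ty.bangs n .one
  | .lam n A M => Ty.bangs n (.lolli A M.infer)
  | .app M _ => M.infer.cod
  | .pair n M N => Ty.bangs n (.tensor (Ty.unbangs n M.infer) (Ty.unbangs n N.infer))
  | .letpair _ _ _ _ N => N.infer
  | .letunit _ N => N.infer

/-- The canonical indexation `⟨M : A <: T⟩` of the erasure of `M` at a supertype `T` of the type
of `M`. Casting the types of the context (to subtypes) leaves an indexed term unchanged. -/
def Term.castTo {S : Signature.{u, v}} : Term S → Ty S.Atom → Term S
  | .var i _, T => .var i T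
  | .const c _, T => .const c T
  | .unit _, T => .unit T.nb
  | .lam n A M, T =>
      match T.core with
      | .lolli C D => .lam T.nb C (M.castTo D)
      | _ => .lam n A M
  | .app M N, T => .app (M.castTo (.lolli M.infer.dom T)) N
  | .pair n M N, T =>
      match T.core with
      | .tensor C D =>
          .pair T.nb (M.castTo (Ty.bangs T.nb C)) (N.castTo (Ty.bangs T.nb D))
      | _ => .pair n M N
  | .letpair n A B M N, T => .letpair n A B M (N.castTo T)
  | .letunit M N, T => .letunit M (N.castTo T)

/-- A substitution maps each annotated variable `i^A` to a term. -/
abbrev Subst (S : Signature.{u, v}) := ℕ → Ty S.Atom → Term S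

/-- Lift a substitution under one binder. -/
def liftSubst {S : Signature.{u, v}} (f : Subst S) : Subst S
  | 0, A => .var 0 A
  | i + 1, A => (f i A).shift 1

/-- Simultaneous capture-avoiding substitution. -/
def Term.subst {S : Signature.{u, v}} (f : Subst S) : Term S → Term S
  | .var i A => f i A
  | .const c A => .const c A
  | .unit n => .unit n
  | .lam n A M => .lam n A (M.subst (liftSubst f))
  | .app M N => .app (M.subst f) (N.subst f)
  | .pair n M N => .pair n (M.subst f) (N.subst f)
  | .letpair n A B M N => .letpair n A B (M.subst f) (N.subst (liftSubst (liftSubst f)))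
  | .letunit M N => .letunit (M.subst f) (N.subst f)

/-- `M[V/x]`, where `x` is the variable `0`: each free instance `x^A` is replaced by `V` cast
to the type `A`. -/
def Term.inst {S : Signature.{u, v}} (M V : Term S) : Term S :=
  M.subst fun i A =>
    match i with
    | 0 => V.castTo A
    | i + 1 => .var i A

/-- `M[V/x, W/y]`, where `y` is the variable `0` and `x` the variable `1`. -/
def Term.inst₂ {S : Signature.{u, v}} (M V W : Term S) : Term S :=
  M.subst fun i A =>
    match i with
    | 0 => W.castTo A
    | 1 => V.castTo A
    | i + 2 => .var i A

/-- The canonical indexation `V'` of the erasure of a value `V` such that `!Δ ⊢ V' : !A`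
if `Δ ⊢ V : A` (junk on terms that are not values). -/
def Term.promote {S : Signature.{u, v}} : Term S → Term S
  | .var i A => .var i (.bang A)
  | .const c A => .const c (.bang A)
  | .unit n => .unit (n + 1)
  | .lam n A M => .lam (n + 1) A M
  | .pair n V W => .pair (n + 1) V.promote W.promote
  | .app (.lam 0 A W) V => .app (.lam 0 (.bang A) W.promote) V.promote
  | .app M N => .app M N
  | .letpair n A B V W => .letpair (n + 1) A B V.promote W.promote
  | .letunit V W => .letunit V W.promote

/-! ### Axiomatic equivalence -/

/-- The placeholder `−` in `let − = M in N`: a variable `x^A`, the unit `*`, or a pair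
`⟨x^A, y^B⟩ⁿ`. -/
inductive Pat (At : Type u) : Type u
  | var (A : Ty At)
  | unit
  | pair (n : ℕ) (A B : Ty At)

/-- The number of variables bound by a placeholder. -/
def Pat.arity {At : Type u} : Pat At → ℕ
  | .var _ => 1
  | .unit => 0
  | .pair _ _ _ => 2

/-- `let p = M in N`. -/
def Term.letP {S : Signature.{u, v}} (p : Pat S.Atom) (M N : Term S) : Term S :=
  match p with
  | .var A => .letIn A M N
  | .unit => .letunit M N
  | .pair n A B => .letpair n A B M N

/-- Exchange the block of the `a` innermost variables with the next block of `b` variables. -/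
def swapRen (a b : ℕ) (i : ℕ) : ℕ :=
  if i < a then i + b else if i < a + b then i - a else i

/-- The axioms whose ingredients are all determined by the well-typedness of their two sides. -/
inductive Axm {S : Signature.{u, v}} : Term S → Term S → Prop
  | beta_lam (A : Ty S.Atom) {V M : Term S} (hV : IsValue V) :
      Axm (.letIn A V M) (M.inst V)
  | beta_tensor (n : ℕ) (A B : Ty S.Atom) {V W M : Term S} (hV : IsValue V) (hW : IsValue W) :
      Axm (.letpair n A B (.pair n V W) M) (M.inst₂ V W)
  | beta_one (M : Term S) : Axm (.letunit (.unit 0) M) M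
  | eta_lam (n : ℕ) (A B : Ty S.Atom) {V : Term S} (hV : IsValue V)
      (hT : V.infer = Ty.bangs n (.lolli A B)) :
      Axm (.lam n A (.app ((V.castTo (.lolli A B)).shift 1) (.var 0 A))) V
  | let_var (A : Ty S.Atom) (N : Term S) : Axm (.letIn A N (.var 0 A)) N
  | eta_tensor (n : ℕ) (A B : Ty S.Atom) (N : Term S) :
      Axm (.letpair n A B N
        (.pair n (.var 1 (Ty.bangs n A)) (.var 0 (Ty.bangs n B)))) N
  -- the scrutinee of `let *` has type `1`, so `N : !ⁿ1` is cast to `1` there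
  | eta_one (n : ℕ) (N : Term S) (hT : N.infer = Ty.bangs n .one) :
      Axm (.letunit (N.castTo .one) (.unit n)) N
  | let_let (p q : Pat S.Atom) (M N P : Term S) :
      Axm (.letP p (.letP q M N) P)
        (.letP q M (.letP p N (P.rename (liftRenN p.arity (fun i => i + q.arity)))))
  | let_comm (p q : Pat S.Atom) {V W : Term S} (M : Term S) (hV : IsValue V) (hW : IsValue W) :
      Axm (.letP p V (.letP q (W.shift p.arity) M))
        (.letP q W (.letP p (V.shift q.arity) (M.rename (swapRen q.arity p.arity))))
  | let_app (A B : Ty S.Atom) (M N : Term S) :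
      Axm (.letIn (.lolli A B) M
        (.letIn A (N.shift 1) (.app (.var 1 (.lolli A B)) (.var 0 A)))) (.app M N)
  | let_lam (n : ℕ) (A D : Ty S.Atom) {V : Term S} (M : Term S) (hV : IsValue V) :
      Axm (.letIn D V (.lam n A M))
        (.lam n A (.letIn D (V.shift 1) (M.rename (swapRen 1 1))))
  | let_tensor (n : ℕ) (A B : Ty S.Atom) (M N : Term S) :
      Axm (.letIn A M (.letIn B (N.shift 1) (.pair n (.var 1 A) (.var 0 B)))) (.pair n M N)
  | cast_pair (n n' : ℕ) (A A' B B' : Ty S.Atom) (M N : Term S)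
      (s : Sub (Ty.bangs n (.tensor A B)) (Ty.bangs n' (.tensor A' B'))) :
      Axm (.letpair n' A' B' (M.castTo (Ty.bangs n' (.tensor A' B'))) N)
        (.letpair n A B M N)
  | cast_let (A A' : Ty S.Atom) (M N : Term S) (s : Sub A A') :
      Axm (.letIn A' (M.castTo A') N) (.letIn A M N)
  | cast_letunit (m n : ℕ) (M N : Term S) (hT : M.infer = Ty.bangs m .one)
      (s : Sub (At := S.Atom) (Ty.bangs m .one) (Ty.bangs n .one)) :
      Axm (.letunit (M.castTo (Ty.bangs n .one)) N) (.letunit M N)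
  | cast_app (n : ℕ) (A B C D D' : Ty S.Atom) (M N : Term S) (Γ₁ Γ₂ : Ctx S.Atom)
      (hM : Valid Γ₁ M (Ty.bangs n (.lolli A D))) (hN : Valid Γ₂ N C)
      (s : Sub (Ty.bangs n (.lolli A D)) (.lolli B D')) (t : Sub C B) :
      Axm (.app (M.castTo (.lolli B D')) (N.castTo B))
        ((Term.app (M.castTo (.lolli A D)) (N.castTo A)).castTo D')

/-- `Γ ⊢ M ≈ax M' : A`: the reflexive, symmetric, transitive and congruence closure, on valid
typing judgments, of the axioms. -/
inductive Eqax {S : Signature.{u, v}} : Ctx S.Atom → Term S → Term S → Ty S.Atom → Prop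
  | ax {Γ : Ctx S.Atom} {M M' : Term S} {A : Ty S.Atom} (h : Axm M M')
      (hM : Valid Γ M A) (hM' : Valid Γ M' A) : Eqax Γ M M' A
  | refl {Γ : Ctx S.Atom} {M : Term S} {A : Ty S.Atom} (hM : Valid Γ M A) : Eqax Γ M M A
  | symm {Γ : Ctx S.Atom} {M M' : Term S} {A : Ty S.Atom} (h : Eqax Γ M M' A) : Eqax Γ M' M A
  | trans {Γ : Ctx S.Atom} {M M' M'' : Term S} {A : Ty S.Atom} (h : Eqax Γ M M' A)
      (h' : Eqax Γ M' M'' A) : Eqax Γ M M'' A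
  | app {Γ Γ₁ Γ₂ : Ctx S.Atom} {M M' N N' : Term S} {A B : Ty S.Atom} (sp : Split Γ Γ₁ Γ₂)
      (h : Eqax Γ₁ M M' (.lolli A B)) (h' : Eqax Γ₂ N N' A) :
      Eqax Γ (.app M N) (.app M' N') B
  | lam1 {Γ : Ctx S.Atom} {M M' : Term S} {A B : Ty S.Atom}
      (h : Eqax (some A :: Γ) M M' B) : Eqax Γ (.lam 0 A M) (.lam 0 A M') (.lolli A B)
  | lam2 {Γ : Ctx S.Atom} (n : ℕ) {M M' : Term S} {A B : Ty S.Atom} (b : AllBang Γ)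
      (h : Eqax (some A :: Γ) M M' B) :
      Eqax Γ (.lam (n + 1) A M) (.lam (n + 1) A M') (Ty.bangs (n + 1) (.lolli A B))
  | pair {Γ Γ₁ Γ₂ : Ctx S.Atom} (n : ℕ) {M M' N N' : Term S} {A B : Ty S.Atom}
      (sp : Split Γ Γ₁ Γ₂) (h : Eqax Γ₁ M M' (Ty.bangs n A))
      (h' : Eqax Γ₂ N N' (Ty.bangs n B)) :
      Eqax Γ (.pair n M N) (.pair n M' N') (Ty.bangs n (.tensor A B))
  | letunit {Γ Γ₁ Γ₂ : Ctx S.Atom} {M M' N N' : Term S} {A : Ty S.Atom} (sp : Split Γ Γ₁ Γ₂)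
      (h : Eqax Γ₁ M M' .one) (h' : Eqax Γ₂ N N' A) :
      Eqax Γ (.letunit M N) (.letunit M' N') A
  | letpair {Γ Γ₁ Γ₂ : Ctx S.Atom} (n : ℕ) {M M' N N' : Term S} {A₁ A₂ C : Ty S.Atom}
      (sp : Split Γ Γ₁ Γ₂) (h : Eqax Γ₁ M M' (Ty.bangs n (.tensor A₁ A₂)))
      (h' : Eqax (some (Ty.bangs n A₂) :: some (Ty.bangs n A₁) :: Γ₂) N N' C) :
      Eqax Γ (.letpair n A₁ A₂ M N) (.letpair n A₁ A₂ M' N') C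

/-! ### The interpretation of the language -/

/-- The objects, arrows and operations of a linear category for duplication. The interpretation
of the language is built from these operations. -/
structure DupOps where
  Obj : Type w
  Hom : Obj → Obj → Type w'
  id : ∀ A, Hom A A
  /-- composition in diagrammatic order -/
  comp : ∀ {A B C}, Hom A B → Hom B C → Hom A C
  tensor : Obj → Obj → Obj
  tensorHom : ∀ {A B C D}, Hom A B → Hom C D → Hom (tensor A C) (tensor B D)
  one : Obj
  assoc : ∀ A B C, Hom (tensor A (tensor B C)) (tensor (tensor A B) C)
  assocInv : ∀ A B C, Hom (tensor (tensor A B) C) (tensor A (tensor B C))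
  leftUnit : ∀ A, Hom (tensor one A) A
  leftUnitInv : ∀ A, Hom A (tensor one A)
  rightUnit : ∀ A, Hom (tensor A one) A
  rightUnitInv : ∀ A, Hom A (tensor A one)
  swap : ∀ A B, Hom (tensor A B) (tensor B A)
  /-- the comonad `L` -/
  L : Obj → Obj
  Lmap : ∀ {A B}, Hom A B → Hom (L A) (L B)
  counit : ∀ A, Hom (L A) A
  comult : ∀ A, Hom (L A) (L (L A))
  /-- the monoidal structure `d` of `L`, and its inverse -/
  d : ∀ A B, Hom (tensor (L A) (L B)) (L (tensor A B))
  dInv : ∀ A B, Hom (L (tensor A B)) (tensor (L A) (L B))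
  dOne : Hom one (L one)
  dOneInv : Hom (L one) one
  /-- the comonoid structure on `L A` -/
  dup : ∀ A, Hom (L A) (tensor (L A) (L A))
  discard : ∀ A, Hom (L A) one
  /-- the strong monad `T`, with `star f = T f ; μ` -/
  T : Obj → Obj
  unit : ∀ A, Hom A (T A)
  mult : ∀ A, Hom (T (T A)) (T A)
  star : ∀ {A B}, Hom A (T B) → Hom (T A) (T B)
  strength : ∀ A B, Hom (tensor A (T B)) (T (tensor A B))
  /-- the Kleisli exponential -/
  lolli : Obj → Obj → Obj
  lolliHom : ∀ {A B C D}, Hom A B → Hom C D → Hom (lolli B C) (lolli A D)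
  Phi : ∀ {A B C}, Hom A (lolli B C) → Hom (tensor A B) (T C)
  PhiInv : ∀ {A B C}, Hom (tensor A B) (T C) → Hom A (lolli B C)

namespace DupOps

variable (C : DupOps.{w, w'})

/-- `T f`, for an arrow `f`. -/
def Tmap {A B : C.Obj} (f : C.Hom A B) : C.Hom (C.T A) (C.T B) :=
  C.star (C.comp f (C.unit B))

/-- `Ψ₁ : TA ⊗ TB → T(A ⊗ B)`, which evaluates the first component first. -/
def Psi (A B : C.Obj) : C.Hom (C.tensor (C.T A) (C.T B)) (C.T (C.tensor A B)) :=
  C.comp (C.swap (C.T A) (C.T B))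
    (C.comp (C.strength (C.T B) A)
      (C.star (C.comp (C.swap (C.T B) A) (C.strength A B))))

/-- `(A ⊸ B) ⊗ A → TB`. -/
def ev (A B : C.Obj) : C.Hom (C.tensor (C.lolli A B) A) (C.T B) :=
  C.Phi (C.id (C.lolli A B))

/-- `(X ⊗ Y) ⊗ Z → (X ⊗ Z) ⊗ Y`. -/
def swapRight (X Y Z : C.Obj) :
    C.Hom (C.tensor (C.tensor X Y) Z) (C.tensor (C.tensor X Z) Y) :=
  C.comp (C.assocInv X Y Z)
    (C.comp (C.tensorHom (C.id X) (C.swap Y Z)) (C.assoc X Z Y))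

/-- The interpretation of types, given the interpretation of the type constants. -/
def ty {At : Type u} (th : At → C.Obj) : Ty At → C.Obj
  | .atom a => th a
  | .lolli A B => C.lolli (ty th A) (ty th B)
  | .tensor A B => C.tensor (ty th A) (ty th B)
  | .one => C.one
  | .bang A => C.L (ty th A)

/-- The interpretation of contexts, as left-nested tensor products. -/
def ctx {At : Type u} (th : At → C.Obj) : Ctx At → C.Obj
  | [] => C.one
  | none :: Γ => ctx th Γ
  | some A :: Γ => C.tensor (ctx th Γ) (C.ty th A)

/-- An interpretation of the language with signature `S`. -/
structure Interp (S : Signature.{u, v}) where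
  atom : S.Atom → C.Obj
  const : ∀ c : S.Const, C.Hom C.one (C.ty atom (.bang (S.ty c)))

section
variable {C} {At : Type u} (th : At → C.Obj)

/-- The canonical arrow `!ⁿ⁺¹X → !X`. -/
def bangDown (X : Ty At) : ∀ n : ℕ, C.Hom (C.ty th (Ty.bangs (n + 1) X)) (C.ty th (.bang X))
  | 0 => C.id _
  | n + 1 => C.comp (C.counit _) (bangDown X n)

/-- The canonical arrow `!X → !ᵐ⁺¹X`. -/
def bangUp (X : Ty At) : ∀ m : ℕ, C.Hom (C.ty th (.bang X)) (C.ty th (Ty.bangs (m + 1) X))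
  | 0 => C.id _
  | m + 1 => C.comp (bangUp X m) (C.comult _)

/-- The canonical arrow `!ⁿX → !ᵐX`, where `m = 0` or `n ≥ 1`. -/
def bangMap (X : Ty At) : ∀ n m : ℕ, (m = 0 ∨ 1 ≤ n) →
    C.Hom (C.ty th (Ty.bangs n X)) (C.ty th (Ty.bangs m X))
  | 0, 0, _ => C.id _
  | n + 1, 0, _ => C.comp (bangDown th X n) (C.counit _)
  | n + 1, m + 1, _ => C.comp (bangDown th X n) (bangUp th X m)
  | 0, m + 1, h => absurd h (by omega)

/-- `Lⁿ` on arrows. -/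
def LmapN {A B : Ty At} (f : C.Hom (C.ty th A) (C.ty th B)) :
    ∀ n : ℕ, C.Hom (C.ty th (Ty.bangs n A)) (C.ty th (Ty.bangs n B))
  | 0 => f
  | n + 1 => C.Lmap (LmapN f n)

/-- `d` for `Lⁿ`. -/
def dN (A B : Ty At) : ∀ n : ℕ,
    C.Hom (C.tensor (C.ty th (Ty.bangs n A)) (C.ty th (Ty.bangs n B)))
      (C.ty th (Ty.bangs n (.tensor A B)))
  | 0 => C.id _
  | n + 1 => C.comp (C.d _ _) (C.Lmap (dN A B n))

/-- The inverse of `d` for `Lⁿ`. -/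
def dInvN (A B : Ty At) : ∀ n : ℕ,
    C.Hom (C.ty th (Ty.bangs n (.tensor A B)))
      (C.tensor (C.ty th (Ty.bangs n A)) (C.ty th (Ty.bangs n B)))
  | 0 => C.id _
  | n + 1 => C.comp (C.Lmap (dInvN A B n)) (C.dInv _ _)

/-- The canonical arrow `I_{A,B}` of a subtyping `A <: B`. -/
def sub {A B : Ty At} : Sub A B → C.Hom (C.ty th A) (C.ty th B)
  | .atom n m h a => bangMap th (.atom a) n m h
  | .one n m h => bangMap th .one n m h
  | .lolli (A := A) (A' := A') (B := B) (B' := B') n m h s t =>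
      C.comp (bangMap th (.lolli A' B) n m h)
        (LmapN th (A := .lolli A' B) (B := .lolli A B') (C.lolliHom (sub s) (sub t)) m)
  | .tensor (A := A) (A' := A') (B := B) (B' := B') n m h s t =>
      C.comp (bangMap th (.tensor A B) n m h)
        (LmapN th (A := .tensor A B) (B := .tensor A' B') (C.tensorHom (sub s) (sub t)) m)

/-- Discard a context `!Δ`. -/
def discardCtx : ∀ {Γ : Ctx At}, AllBang Γ → C.Hom (C.ctx th Γ) C.one
  | _, .nil => C.id _
  | _, .skip b => (discardCtx b :)
  | _, .cons A b => C.comp (C.tensorHom (discardCtx b) (C.discard (C.ty th A))) (C.leftUnit C.one)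

/-- The canonical arrow `⟦!Δ⟧ → L⟦!Δ⟧`. -/
def promoteCtx : ∀ {Γ : Ctx At}, AllBang Γ → C.Hom (C.ctx th Γ) (C.L (C.ctx th Γ))
  | _, .nil => C.dOne
  | _, .skip b => (promoteCtx b :)
  | _, .cons A b => C.comp (C.tensorHom (promoteCtx b) (C.comult (C.ty th A))) (C.d _ _)

/-- The projection `⟦!Δ, x : A⟧ → ⟦A⟧`. -/
def pick {A : Ty At} : ∀ {Γ : Ctx At} {i : ℕ}, Pick Γ i A → C.Hom (C.ctx th Γ) (C.ty th A)
  | _, _, .here b => C.comp (C.tensorHom (discardCtx th b) (C.id _)) (C.leftUnit _)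
  | _, _, .skip p => (pick p :)
  | _, _, .weak B p => C.comp (C.tensorHom (pick p) (C.discard (C.ty th B))) (C.rightUnit _)

/-- The arrow `⟦!Δ, Γ₁, Γ₂⟧ → ⟦!Δ, Γ₁⟧ ⊗ ⟦!Δ, Γ₂⟧`. -/
def split : ∀ {Γ Γ₁ Γ₂ : Ctx At},
    Split Γ Γ₁ Γ₂ → C.Hom (C.ctx th Γ) (C.tensor (C.ctx th Γ₁) (C.ctx th Γ₂))
  | _, _, _, .nil => C.leftUnitInv C.one
  | _, _, _, .skip s => (split s :)
  | _, _, _, .left A s => C.comp (C.tensorHom (split s) (C.id (C.ty th A))) (C.swapRight _ _ _)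
  | _, _, _, .right A s => C.comp (C.tensorHom (split s) (C.id (C.ty th A))) (C.assocInv _ _ _)
  | _, _, _, .both A s =>
      C.comp (C.tensorHom (split s) (C.dup (C.ty th A)))
        (C.comp (C.assoc _ _ _)
          (C.comp (C.tensorHom (C.swapRight _ _ _) (C.id _)) (C.assocInv _ _ _)))

/-- `⟦Γ⟧ → ⟦Γ₂⟧ ⊗ X`, from a splitting of `Γ` into `Γ₁`, `Γ₂` and an arrow `⟦Γ₁⟧ → X`. -/
def feed {Γ Γ₁ Γ₂ : Ctx At} {X : C.Obj} (sp : Split Γ Γ₁ Γ₂) (f : C.Hom (C.ctx th Γ₁) X) :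
    C.Hom (C.ctx th Γ) (C.tensor (C.ctx th Γ₂) X) :=
  C.comp (split th sp) (C.comp (C.swap _ _) (C.tensorHom (C.id _) f))

/-- `⟦Γ⟧ ⊗ ⟦!ⁿ(A ⊗ B)⟧ → ⟦Γ, x : !ⁿA, y : !ⁿB⟧`. -/
def unpair (n : ℕ) (A B : Ty At) (Γ : Ctx At) :
    C.Hom (C.tensor (C.ctx th Γ) (C.ty th (Ty.bangs n (.tensor A B))))
      (C.ctx th (some (Ty.bangs n B) :: some (Ty.bangs n A) :: Γ)) :=
  C.comp (C.tensorHom (C.id _) (dInvN th A B n)) (C.assoc _ _ _)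

end

section
variable {C} {S : Signature.{u, v}} (Θ : C.Interp S)

/-- The value interpretation of a variable. -/
def varV {Γ : Ctx S.Atom} {i : ℕ} {A B : Ty S.Atom} (p : Pick Γ i A) (s : Sub A B) :
    C.Hom (C.ctx Θ.atom Γ) (C.ty Θ.atom B) :=
  C.comp (pick Θ.atom p) (sub Θ.atom s)

/-- The value interpretation of a constant. -/
def constV {Γ : Ctx S.Atom} {B : Ty S.Atom} (c : S.Const) (b : AllBang Γ)
    (s : Sub (.bang (S.ty c)) B) : C.Hom (C.ctx Θ.atom Γ) (C.ty Θ.atom B) :=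
  C.comp (discardCtx Θ.atom b) (C.comp (Θ.const c) (sub Θ.atom s))

/-- The value interpretation of `*ⁿ`. -/
def oneV {Γ : Ctx S.Atom} (n : ℕ) (b : AllBang Γ) :
    C.Hom (C.ctx Θ.atom Γ) (C.ty Θ.atom (Ty.bangs n .one)) :=
  C.comp (discardCtx Θ.atom b) (C.comp C.dOne (bangMap Θ.atom .one 1 n (.inr le_rfl)))

/-- The value interpretation of `λ⁰ x^A. M`, from the computational one of `M`. -/
def lam1V {Γ : Ctx S.Atom} {A B : Ty S.Atom}
    (f : C.Hom (C.ctx Θ.atom (some A :: Γ)) (C.T (C.ty Θ.atom B))) :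
    C.Hom (C.ctx Θ.atom Γ) (C.ty Θ.atom (.lolli A B)) :=
  C.PhiInv f

/-- The value interpretation of `λⁿ⁺¹ x^A. M`, from the computational one of `M`. -/
def lam2V {Γ : Ctx S.Atom} (n : ℕ) {A B : Ty S.Atom} (b : AllBang Γ)
    (f : C.Hom (C.ctx Θ.atom (some A :: Γ)) (C.T (C.ty Θ.atom B))) :
    C.Hom (C.ctx Θ.atom Γ) (C.ty Θ.atom (Ty.bangs (n + 1) (.lolli A B))) :=
  C.comp (promoteCtx Θ.atom b)
    (C.comp (C.Lmap (C.PhiInv f)) (bangMap Θ.atom (.lolli A B) 1 (n + 1) (.inr le_rfl)))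

/-- The computational interpretation of a typing derivation. -/
def denC {Γ : Ctx S.Atom} {M : Term S} {A : Ty S.Atom} :
    Deriv Γ M A → C.Hom (C.ctx Θ.atom Γ) (C.T (C.ty Θ.atom A))
  | .ax1 p s => C.comp (varV Θ p s) (C.unit _)
  | .ax2 c b s => C.comp (constV Θ c b s) (C.unit _)
  | .oneI n b => C.comp (oneV Θ n b) (C.unit _)
  | .lam1 d => C.comp (lam1V Θ (denC d)) (C.unit _)
  | .lam2 n b d => C.comp (lam2V Θ n b (denC d)) (C.unit _)
  | .app sp d e =>
      C.comp (split Θ.atom sp)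
        (C.comp (C.tensorHom (denC d) (denC e)) (C.comp (C.Psi _ _) (C.star (C.ev _ _))))
  | .tensorI (A := A) (B := B) n sp d e =>
      C.comp (split Θ.atom sp)
        (C.comp (C.tensorHom (denC d) (denC e))
          (C.comp (C.Psi _ _) (C.Tmap (dN Θ.atom A B n))))
  | .oneE sp d e =>
      C.comp (feed Θ.atom sp (denC d))
        (C.comp (C.strength _ _) (C.star (C.comp (C.rightUnit _) (denC e))))
  | .tensorE (A₁ := A₁) (A₂ := A₂) n sp d e =>
      C.comp (feed Θ.atom sp (denC d))
        (C.comp (C.strength _ _)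
          (C.comp (C.Tmap (unpair Θ.atom n A₁ A₂ _)) (C.star (denC e))))

/-- The value interpretation of a typing derivation of a value. -/
def denV : ∀ (V : Term S) {Γ : Ctx S.Atom} {A : Ty S.Atom}, IsValue V → Deriv Γ V A →
    C.Hom (C.ctx Θ.atom Γ) (C.ty Θ.atom A)
  | .var _ _, _, _, _, .ax1 p s => varV Θ p s
  | .const _ _, _, _, _, .ax2 c b s => constV Θ c b s
  | .unit n, _, _, _, .oneI _ b => oneV Θ n b
  | .lam 0 _ _, _, _, _, .lam1 d => lam1V Θ (denC Θ d)
  | .lam (n + 1) _ _, _, _, _, .lam2 _ b d => lam2V Θ n b (denC Θ d)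
  | .pair n V W, _, _, h, .tensorI _ sp d e =>
      C.comp (split Θ.atom sp)
        (C.comp
          (C.tensorHom (denV V (by cases h; assumption) d) (denV W (by cases h; assumption) e))
          (dN Θ.atom _ _ n))
  | .app (.lam 0 _ W) V, _, _, h, .app sp (.lam1 e) d =>
      C.comp (split Θ.atom sp)
        (C.comp (C.tensorHom (C.id _) (denV V (by cases h; assumption) d))
          (denV W (by cases h; assumption) e))
  | .letunit V W, _, _, h, .oneE sp d e =>
      C.comp (feed Θ.atom sp (denV V (by cases h; assumption) d))
        (C.comp (C.rightUnit _) (denV W (by cases h; assumption) e))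
  | .letpair n _ _ V W, _, _, h, .tensorE _ sp d e =>
      C.comp (feed Θ.atom sp (denV V (by cases h; assumption) d))
        (C.comp (unpair Θ.atom n _ _ _) (denV W (by cases h; assumption) e))
  | .app (.lam (_ + 1) _ _) _, _, _, h, _ => absurd h (by rintro ⟨⟩)
  | .app (.var _ _) _, _, _, h, _ => absurd h (by rintro ⟨⟩)
  | .app (.const _ _) _, _, _, h, _ => absurd h (by rintro ⟨⟩)
  | .app (.unit _) _, _, _, h, _ => absurd h (by rintro ⟨⟩)
  | .app (.app _ _) _, _, _, h, _ => absurd h (by rintro ⟨⟩)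
  | .app (.pair _ _ _) _, _, _, h, _ => absurd h (by rintro ⟨⟩)
  | .app (.letpair _ _ _ _ _) _, _, _, h, _ => absurd h (by rintro ⟨⟩)
  | .app (.letunit _ _) _, _, _, h, _ => absurd h (by rintro ⟨⟩)

end

end DupOps

/-! ### Facts on typing needed to define the category of values -/

theorem Ty.nb_bangs {At : Type u} (n : ℕ) (A : Ty At) : (Ty.bangs n A).nb = n + A.nb := by
  induction n with
  | zero => simp [Ty.bangs]
  | succ n ih => simp only [Ty.bangs, Ty.nb, ih]; omega

theorem Ty.core_bangs {At : Type u} (n : ℕ) (A : Ty At) : (Ty.bangs n A).core = A.core := by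
  induction n with
  | zero => rfl
  | succ n ih => simpa only [Ty.bangs, Ty.core] using ih

theorem Ty.bangs_core {At : Type u} (A : Ty At) : Ty.bangs A.nb A.core = A := by
  induction A with
  | bang A ih => simp only [Ty.nb, Ty.core, Ty.bangs, ih]
  | _ => rfl

theorem Sub.inv {At : Type u} {X Y : Ty At} (s : Sub X Y) :
    (Y.nb = 0 ∨ 1 ≤ X.nb) ∧
      ((∃ a, X.core = .atom a ∧ Y.core = .atom a) ∨ (X.core = .one ∧ Y.core = .one) ∨
        (∃ A A' B B', X.core = .lolli A' B ∧ Y.core = .lolli A B' ∧ Nonempty (Sub A A') ∧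
          Nonempty (Sub B B')) ∨
        (∃ A A' B B', X.core = .tensor A B ∧ Y.core = .tensor A' B' ∧ Nonempty (Sub A A') ∧
          Nonempty (Sub B B'))) := by
  cases s with
  | atom n m h a => exact ⟨by simpa [Ty.nb_bangs, Ty.nb] using h, by simp [Ty.core_bangs, Ty.core]⟩
  | one n m h => exact ⟨by simpa [Ty.nb_bangs, Ty.nb] using h, by simp [Ty.core_bangs, Ty.core]⟩
  | lolli n m h s t =>
      refine ⟨by simpa [Ty.nb_bangs, Ty.nb] using h, .inr (.inr (.inl ⟨_, _, _, _, ?_, ?_, ⟨s⟩, ⟨t⟩⟩))⟩ <;>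
        rw [Ty.core_bangs] <;> rfl
  | tensor n m h s t =>
      refine ⟨by simpa [Ty.nb_bangs, Ty.nb] using h, .inr (.inr (.inr ⟨_, _, _, _, ?_, ?_, ⟨s⟩, ⟨t⟩⟩))⟩ <;>
        rw [Ty.core_bangs] <;> rfl

theorem Sub.of_inv {At : Type u} {X Y : Ty At} (hn : Y.nb = 0 ∨ 1 ≤ X.nb)
    (h : (∃ a, X.core = .atom a ∧ Y.core = .atom a) ∨ (X.core = .one ∧ Y.core = .one) ∨
        (∃ A A' B B', X.core = .lolli A' B ∧ Y.core = .lolli A B' ∧ Nonempty (Sub A A') ∧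
          Nonempty (Sub B B')) ∨
        (∃ A A' B B', X.core = .tensor A B ∧ Y.core = .tensor A' B' ∧ Nonempty (Sub A A') ∧
          Nonempty (Sub B B'))) : Nonempty (Sub X Y) := by
  rw [← Ty.bangs_core X, ← Ty.bangs_core Y]
  rcases h with ⟨a, h, h'⟩ | ⟨h, h'⟩ | ⟨A, A', B, B', h, h', ⟨s⟩, ⟨t⟩⟩ | ⟨A, A', B, B', h, h', ⟨s⟩, ⟨t⟩⟩ <;>
    rw [h, h']
  · exact ⟨.atom _ _ hn a⟩
  · exact ⟨.one _ _ hn⟩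
  · exact ⟨.lolli _ _ hn s t⟩
  · exact ⟨.tensor _ _ hn s t⟩

theorem Sub.bang_of {At : Type u} {X Y : Ty At} (s : Sub X Y) :
    Nonempty (Sub (.bang X) (.bang Y)) :=
  Sub.of_inv (by simp [Ty.nb]) s.inv.2

theorem Sub.bang_left {At : Type u} {X Y : Ty At} (s : Sub X Y) :
    Nonempty (Sub (.bang X) Y) :=
  Sub.of_inv (by simp [Ty.nb]) s.inv.2

theorem Sub.bang_right {At : Type u} {X Y : Ty At} (s : Sub (.bang X) Y) :
    Nonempty (Sub (.bang X) (.bang Y)) :=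
  Sub.of_inv (by simp [Ty.nb]) s.inv.2

theorem Sub.refl {At : Type u} (A : Ty At) : Nonempty (Sub A A) := by
  induction A with
  | atom a => exact ⟨.atom 0 0 (.inl rfl) a⟩
  | lolli A B ihA ihB => exact ⟨.lolli 0 0 (.inl rfl) ihA.some ihB.some⟩
  | tensor A B ihA ihB => exact ⟨.tensor 0 0 (.inl rfl) ihA.some ihB.some⟩
  | one => exact ⟨.one 0 0 (.inl rfl)⟩
  | bang A ih => exact ih.some.bang_of

theorem Sub.trans_aux {At : Type u} {X Y : Ty At} (s : Sub X Y) :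
    (∀ Z, Sub Y Z → Nonempty (Sub X Z)) ∧ (∀ Z, Sub Z X → Nonempty (Sub Z Y)) := by
  induction s with
  | atom n m h a =>
      constructor <;> intro Z t <;> obtain ⟨h1, h2⟩ := t.inv <;>
        simp only [Ty.nb_bangs, Ty.nb, Ty.core_bangs, Ty.core] at h1 h2 <;>
        refine Sub.of_inv ?_ ?_ <;> simp only [Ty.nb_bangs, Ty.nb, Ty.core_bangs, Ty.core]
      · omega
      · exact h2
      · omega
      · exact h2
  | one n m h =>
      constructor <;> intro Z t <;> obtain ⟨h1, h2⟩ := t.inv <;>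
        simp only [Ty.nb_bangs, Ty.nb, Ty.core_bangs, Ty.core] at h1 h2 <;>
        refine Sub.of_inv ?_ ?_ <;> simp only [Ty.nb_bangs, Ty.nb, Ty.core_bangs, Ty.core]
      · omega
      · exact h2
      · omega
      · exact h2
  | lolli n m h s t ihs iht =>
      constructor
      · intro Z r
        obtain ⟨h1, h2⟩ := r.inv
        simp only [Ty.nb_bangs, Ty.nb, Ty.core_bangs, Ty.core] at h1 h2
        simp only [reduceCtorEq, false_and, exists_false, false_or, or_false, Ty.lolli.injEq] at h2
        obtain ⟨P, P', Q, Q', ⟨rfl, rfl⟩, hz, ⟨s'⟩, ⟨t'⟩⟩ := h2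
        refine Sub.of_inv ?_ (.inr (.inr (.inl ⟨_, _, _, _, ?_, hz, ihs.2 _ s', iht.1 _ t'⟩)))
        · simp only [Ty.nb_bangs, Ty.nb]; omega
        · rw [Ty.core_bangs]; rfl
      · intro Z r
        obtain ⟨h1, h2⟩ := r.inv
        simp only [Ty.nb_bangs, Ty.nb, Ty.core_bangs, Ty.core] at h1 h2
        simp only [reduceCtorEq, and_false, false_and, exists_false, false_or, or_false,
          Ty.lolli.injEq] at h2
        obtain ⟨P, P', Q, Q', hz, ⟨rfl, rfl⟩, ⟨s'⟩, ⟨t'⟩⟩ := h2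
        refine Sub.of_inv ?_ (.inr (.inr (.inl ⟨_, _, _, _, hz, ?_, ihs.1 _ s', iht.2 _ t'⟩)))
        · simp only [Ty.nb_bangs, Ty.nb]; omega
        · rw [Ty.core_bangs]; rfl
  | tensor n m h s t ihs iht =>
      constructor
      · intro Z r
        obtain ⟨h1, h2⟩ := r.inv
        simp only [Ty.nb_bangs, Ty.nb, Ty.core_bangs, Ty.core] at h1 h2
        simp only [reduceCtorEq, false_and, exists_false, false_or, Ty.tensor.injEq] at h2
        obtain ⟨P, P', Q, Q', ⟨rfl, rfl⟩, hz, ⟨s'⟩, ⟨t'⟩⟩ := h2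
        refine Sub.of_inv ?_ (.inr (.inr (.inr ⟨_, _, _, _, ?_, hz, ihs.1 _ s', iht.1 _ t'⟩)))
        · simp only [Ty.nb_bangs, Ty.nb]; omega
        · rw [Ty.core_bangs]; rfl
      · intro Z r
        obtain ⟨h1, h2⟩ := r.inv
        simp only [Ty.nb_bangs, Ty.nb, Ty.core_bangs, Ty.core] at h1 h2
        simp only [reduceCtorEq, and_false, false_and, exists_false, false_or,
          Ty.tensor.injEq] at h2
        obtain ⟨P, P', Q, Q', hz, ⟨rfl, rfl⟩, ⟨s'⟩, ⟨t'⟩⟩ := h2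
        refine Sub.of_inv ?_ (.inr (.inr (.inr ⟨_, _, _, _, hz, ?_, ihs.2 _ s', iht.2 _ t'⟩)))
        · simp only [Ty.nb_bangs, Ty.nb]; omega
        · rw [Ty.core_bangs]; rfl

theorem Sub.trans {At : Type u} {X Y Z : Ty At} (s : Sub X Y) (t : Sub Y Z) :
    Nonempty (Sub X Z) :=
  s.trans_aux.1 _ t

theorem Sub.eq_bang {At : Type u} {X Y : Ty At} (s : Sub X (.bang Y)) : ∃ X', X = .bang X' := by
  have h := s.inv.1
  cases X with
  | bang X => exact ⟨X, rfl⟩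
  | _ => simp [Ty.nb] at h

/-- Pointwise subtyping of contexts. -/
inductive CtxSub {At : Type u} : Ctx At → Ctx At → Type u
  | nil : CtxSub [] []
  | skip {Γ Γ' : Ctx At} (s : CtxSub Γ Γ') : CtxSub (none :: Γ) (none :: Γ')
  | cons {Γ Γ' : Ctx At} {A A' : Ty At} (h : Sub A A') (s : CtxSub Γ Γ') :
      CtxSub (some A :: Γ) (some A' :: Γ')

theorem CtxSub.allBang {At : Type u} {Γ Γ' : Ctx At} (s : CtxSub Γ Γ') :
    AllBang Γ' → Nonempty (AllBang Γ) := by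
  induction s with
  | nil => exact fun b => ⟨b⟩
  | skip s ih => rintro (_ | b); exact ⟨.skip (ih b).some⟩
  | cons h s ih =>
      intro b
      cases b with
      | cons A b => obtain ⟨_, rfl⟩ := h.eq_bang; exact ⟨.cons _ (ih b).some⟩

theorem CtxSub.pick {At : Type u} {Γ Γ' : Ctx At} (s : CtxSub Γ Γ') :
    ∀ {i : ℕ} {A : Ty At}, Pick Γ' i A → ∃ A', Nonempty (Pick Γ i A') ∧ Nonempty (Sub A' A) := by
  induction s with
  | nil => intro i A p; cases p
  | skip s ih =>
      intro i A p
      cases p with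
      | skip p => obtain ⟨A', ⟨q⟩, t⟩ := ih p; exact ⟨A', ⟨.skip q⟩, t⟩
  | cons h s ih =>
      intro i A p
      cases p with
      | here b => exact ⟨_, ⟨.here (s.allBang b).some⟩, ⟨h⟩⟩
      | weak B p =>
          obtain ⟨A', ⟨q⟩, t⟩ := ih p
          obtain ⟨_, rfl⟩ := h.eq_bang
          exact ⟨A', ⟨.weak _ q⟩, t⟩

theorem CtxSub.split {At : Type u} {Γ Γ' : Ctx At} (s : CtxSub Γ Γ') :
    ∀ {Γ₁' Γ₂' : Ctx At}, Split Γ' Γ₁' Γ₂' → ∃ Γ₁ Γ₂, Nonempty (Split Γ Γ₁ Γ₂) ∧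
      Nonempty (CtxSub Γ₁ Γ₁') ∧ Nonempty (CtxSub Γ₂ Γ₂') := by
  induction s with
  | nil => intro _ _ p; cases p; exact ⟨_, _, ⟨.nil⟩, ⟨.nil⟩, ⟨.nil⟩⟩
  | skip s ih =>
      intro _ _ p
      cases p with
      | skip p =>
          obtain ⟨_, _, ⟨a⟩, ⟨b⟩, ⟨c⟩⟩ := ih p
          exact ⟨_, _, ⟨.skip a⟩, ⟨.skip b⟩, ⟨.skip c⟩⟩
  | cons h s ih =>
      intro _ _ p
      cases p with
      | left A p =>
          obtain ⟨_, _, ⟨a⟩, ⟨b⟩, ⟨c⟩⟩ := ih p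
          exact ⟨_, _, ⟨.left _ a⟩, ⟨.cons h b⟩, ⟨.skip c⟩⟩
      | right A p =>
          obtain ⟨_, _, ⟨a⟩, ⟨b⟩, ⟨c⟩⟩ := ih p
          exact ⟨_, _, ⟨.right _ a⟩, ⟨.skip b⟩, ⟨.cons h c⟩⟩
      | both A p =>
          obtain ⟨_, _, ⟨a⟩, ⟨b⟩, ⟨c⟩⟩ := ih p
          obtain ⟨_, rfl⟩ := h.eq_bang
          exact ⟨_, _, ⟨.both _ a⟩, ⟨.cons h b⟩, ⟨.cons h c⟩⟩

theorem Valid.ctxSub {S : Signature.{u, v}} {Γ' : Ctx S.Atom} {M : Term S} {A : Ty S.Atom}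
    (d : Deriv Γ' M A) : ∀ {Γ : Ctx S.Atom}, CtxSub Γ Γ' → Valid Γ M A := by
  induction d with
  | ax1 p s =>
      intro Γ c
      obtain ⟨_, ⟨q⟩, ⟨t⟩⟩ := c.pick p
      exact ⟨.ax1 q (t.trans s).some⟩
  | ax2 k b s => intro Γ c; exact ⟨.ax2 k (c.allBang b).some s⟩
  | app sp d e ihd ihe =>
      intro Γ c
      obtain ⟨_, _, ⟨sp'⟩, ⟨c₁⟩, ⟨c₂⟩⟩ := c.split sp
      exact ⟨.app sp' (ihd c₁).some (ihe c₂).some⟩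
  | lam1 d ih => intro Γ c; exact ⟨.lam1 (ih (.cons (Sub.refl _).some c)).some⟩
  | lam2 n b d ih =>
      intro Γ c; exact ⟨.lam2 n (c.allBang b).some (ih (.cons (Sub.refl _).some c)).some⟩
  | oneI n b => intro Γ c; exact ⟨.oneI n (c.allBang b).some⟩
  | tensorI n sp d e ihd ihe =>
      intro Γ c
      obtain ⟨_, _, ⟨sp'⟩, ⟨c₁⟩, ⟨c₂⟩⟩ := c.split sp
      exact ⟨.tensorI n sp' (ihd c₁).some (ihe c₂).some⟩
  | oneE sp d e ihd ihe =>
      intro Γ c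
      obtain ⟨_, _, ⟨sp'⟩, ⟨c₁⟩, ⟨c₂⟩⟩ := c.split sp
      exact ⟨.oneE sp' (ihd c₁).some (ihe c₂).some⟩
  | tensorE n sp d e ihd ihe =>
      intro Γ c
      obtain ⟨_, _, ⟨sp'⟩, ⟨c₁⟩, ⟨c₂⟩⟩ := c.split sp
      exact ⟨.tensorE n sp' (ihd c₁).some
        (ihe (.cons (Sub.refl _).some (.cons (Sub.refl _).some c₂))).some⟩

/-- `!Δ`. -/
def Ctx.bang {At : Type u} (Γ : Ctx At) : Ctx At :=
  Γ.map (Option.map Ty.bang)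

theorem Ctx.allBang_bang {At : Type u} (Γ : Ctx At) : Nonempty (AllBang (Ctx.bang Γ)) := by
  induction Γ with
  | nil => exact ⟨.nil⟩
  | cons a Γ ih =>
      cases a with
      | none => exact ⟨.skip ih.some⟩
      | some A => exact ⟨.cons A ih.some⟩

theorem Ctx.bang_sub {At : Type u} (Γ : Ctx At) : Nonempty (CtxSub (Ctx.bang Γ) Γ) := by
  induction Γ with
  | nil => exact ⟨.nil⟩
  | cons a Γ ih =>
      cases a with
      | none => exact ⟨.skip ih.some⟩
      | some A => exact ⟨.cons (Sub.refl A).some.bang_left.some ih.some⟩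

theorem Pick.bang {At : Type u} {Γ : Ctx At} {i : ℕ} {A : Ty At} (p : Pick Γ i A) :
    Nonempty (Pick (Ctx.bang Γ) i (.bang A)) := by
  induction p with
  | here b => exact ⟨.here (Ctx.allBang_bang _).some⟩
  | skip p ih => exact ⟨.skip ih.some⟩
  | weak B p ih => exact ⟨.weak _ ih.some⟩

theorem Split.bang {At : Type u} {Γ Γ₁ Γ₂ : Ctx At} (s : Split Γ Γ₁ Γ₂) :
    Nonempty (Split (Ctx.bang Γ) (Ctx.bang Γ₁) (Ctx.bang Γ₂)) := by
  induction s with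
  | nil => exact ⟨.nil⟩
  | skip s ih => exact ⟨.skip ih.some⟩
  | left A s ih => exact ⟨.left _ ih.some⟩
  | right A s ih => exact ⟨.right _ ih.some⟩
  | both A s ih => exact ⟨.both _ ih.some⟩

theorem Valid.promote {S : Signature.{u, v}} {V : Term S} (hV : IsValue V) :
    ∀ {Γ : Ctx S.Atom} {A : Ty S.Atom}, Deriv Γ V A → Valid (Ctx.bang Γ) V.promote (.bang A) := by
  induction hV with
  | var i A => rintro Γ _ (⟨p, s⟩); exact ⟨.ax1 p.bang.some s.bang_of.some⟩
  | const c A =>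
      rintro Γ _ (_ | ⟨_, b, s⟩); exact ⟨.ax2 c (Ctx.allBang_bang _).some s.bang_right.some⟩
  | unit n => intro Γ A d; cases d; exact ⟨.oneI (n + 1) (Ctx.allBang_bang _).some⟩
  | lam n A M =>
      intro Γ B d
      have b := (Ctx.allBang_bang Γ).some
      cases d with
      | lam1 d =>
          exact ⟨.lam2 0 b (Valid.ctxSub d (.cons (Sub.refl _).some (Ctx.bang_sub Γ).some)).some⟩
      | lam2 n b' d =>
          exact ⟨.lam2 (n + 1) b
            (Valid.ctxSub d (.cons (Sub.refl _).some (Ctx.bang_sub Γ).some)).some⟩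
  | pair n hV hW ihV ihW =>
      intro Γ B d
      cases d with
      | tensorI _ sp d e => exact ⟨.tensorI (n + 1) sp.bang.some (ihV d).some (ihW e).some⟩
  | letIn A hV hW ihV ihW =>
      intro Γ B d
      cases d with
      | app sp d e =>
          cases d with
          | lam1 d => exact ⟨.app sp.bang.some (.lam1 (ihW d).some) (ihV e).some⟩
  | letpair n A B hV hW ihV ihW =>
      intro Γ C d
      cases d with
      | tensorE _ sp d e => exact ⟨.tensorE (n + 1) sp.bang.some (ihV d).some (ihW e).some⟩
  | letunit hV hW ihV ihW =>
      intro Γ C d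
      cases d with
      | oneE sp d e =>
          exact ⟨.oneE sp.bang.some (Valid.ctxSub d (Ctx.bang_sub _).some).some (ihW e).some⟩

theorem IsValue.promote {S : Signature.{u, v}} {V : Term S} (hV : IsValue V) :
    IsValue V.promote := by
  induction hV with
  | var i A => exact .var _ _
  | const c A => exact .const _ _
  | unit n => exact .unit _
  | lam n A M => exact .lam _ _ _
  | pair n hV hW ihV ihW => exact .pair _ ihV ihW
  | letIn A hV hW ihV ihW => exact .letIn _ ihV ihW
  | letpair n A B hV hW ihV ihW => exact .letpair _ _ _ ihV ihW
  | letunit hV hW ihV ihW => exact .letunit hV ihW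

theorem IsValue.rename {S : Signature.{u, v}} {V : Term S} (hV : IsValue V) :
    ∀ r : ℕ → ℕ, IsValue (V.rename r) := by
  induction hV with
  | var i A => exact fun _ => .var _ _
  | const c A => exact fun _ => .const _ _
  | unit n => exact fun _ => .unit _
  | lam n A M => exact fun _ => .lam _ _ _
  | pair n hV hW ihV ihW => exact fun r => .pair _ (ihV r) (ihW r)
  | letIn A hV hW ihV ihW => exact fun r => .letIn _ (ihV r) (ihW _)
  | letpair n A B hV hW ihV ihW => exact fun r => .letpair _ _ _ (ihV r) (ihW _)
  | letunit hV hW ihV ihW => exact fun r => .letunit (ihV r) (ihW r)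

/-- `Thin Γ Γ'`: the context `Γ'` is `Γ` with undeclared variables inserted. -/
inductive Thin {At : Type u} : Ctx At → Ctx At → Type u
  | nil : Thin [] []
  | keep (a : Option (Ty At)) {Γ Γ' : Ctx At} (t : Thin Γ Γ') : Thin (a :: Γ) (a :: Γ')
  | drop {Γ Γ' : Ctx At} (t : Thin Γ Γ') : Thin Γ (none :: Γ')

/-- The renaming underlying a thinning. -/
def Thin.ren {At : Type u} : ∀ {Γ Γ' : Ctx At}, Thin Γ Γ' → ℕ → ℕ
  | _, _, .nil => fun i => i
  | _, _, .keep _ t => liftRen t.ren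
  | _, _, .drop t => fun i => t.ren i + 1

theorem Thin.allBang {At : Type u} {Γ Γ' : Ctx At} (t : Thin Γ Γ') :
    AllBang Γ → Nonempty (AllBang Γ') := by
  induction t with
  | nil => exact fun b => ⟨b⟩
  | keep a t ih =>
      intro b
      cases b with
      | skip b => exact ⟨.skip (ih b).some⟩
      | cons A b => exact ⟨.cons A (ih b).some⟩
  | drop t ih => exact fun b => ⟨.skip (ih b).some⟩

theorem Thin.pick {At : Type u} {Γ Γ' : Ctx At} (t : Thin Γ Γ') :
    ∀ {i : ℕ} {A : Ty At}, Pick Γ i A → Nonempty (Pick Γ' (t.ren i) A) := by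
  induction t with
  | nil => exact fun p => ⟨p⟩
  | keep a t ih =>
      intro i A p
      cases p with
      | here b => exact ⟨.here (t.allBang b).some⟩
      | skip p => exact ⟨.skip (ih p).some⟩
      | weak B p => exact ⟨.weak B (ih p).some⟩
  | drop t ih => exact fun p => ⟨.skip (ih p).some⟩

theorem Thin.split {At : Type u} {Γ Γ' : Ctx At} (t : Thin Γ Γ') :
    ∀ {Γ₁ Γ₂ : Ctx At}, Split Γ Γ₁ Γ₂ → ∃ Γ₁' Γ₂', Nonempty (Split Γ' Γ₁' Γ₂') ∧
      (∃ t₁ : Thin Γ₁ Γ₁', t₁.ren = t.ren) ∧ (∃ t₂ : Thin Γ₂ Γ₂', t₂.ren = t.ren) := by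
  induction t with
  | nil =>
      intro _ _ p
      cases p
      exact ⟨_, _, ⟨.nil⟩, ⟨.nil, rfl⟩, ⟨.nil, rfl⟩⟩
  | keep a t ih =>
      intro _ _ p
      cases p with
      | skip p =>
          obtain ⟨_, _, ⟨q⟩, ⟨t₁, h₁⟩, ⟨t₂, h₂⟩⟩ := ih p
          exact ⟨_, _, ⟨.skip q⟩, ⟨.keep _ t₁, by simp [Thin.ren, h₁]⟩,
            ⟨.keep _ t₂, by simp [Thin.ren, h₂]⟩⟩
      | left A p =>
          obtain ⟨_, _, ⟨q⟩, ⟨t₁, h₁⟩, ⟨t₂, h₂⟩⟩ := ih p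
          exact ⟨_, _, ⟨.left A q⟩, ⟨.keep _ t₁, by simp [Thin.ren, h₁]⟩,
            ⟨.keep _ t₂, by simp [Thin.ren, h₂]⟩⟩
      | right A p =>
          obtain ⟨_, _, ⟨q⟩, ⟨t₁, h₁⟩, ⟨t₂, h₂⟩⟩ := ih p
          exact ⟨_, _, ⟨.right A q⟩, ⟨.keep _ t₁, by simp [Thin.ren, h₁]⟩,
            ⟨.keep _ t₂, by simp [Thin.ren, h₂]⟩⟩
      | both A p =>
          obtain ⟨_, _, ⟨q⟩, ⟨t₁, h₁⟩, ⟨t₂, h₂⟩⟩ := ih p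
          exact ⟨_, _, ⟨.both A q⟩, ⟨.keep _ t₁, by simp [Thin.ren, h₁]⟩,
            ⟨.keep _ t₂, by simp [Thin.ren, h₂]⟩⟩
  | drop t ih =>
      intro _ _ p
      obtain ⟨_, _, ⟨q⟩, ⟨t₁, h₁⟩, ⟨t₂, h₂⟩⟩ := ih p
      exact ⟨_, _, ⟨.skip q⟩, ⟨.drop t₁, by simp [Thin.ren, h₁]⟩,
        ⟨.drop t₂, by simp [Thin.ren, h₂]⟩⟩

theorem Valid.thin {S : Signature.{u, v}} {Γ : Ctx S.Atom} {M : Term S} {A : Ty S.Atom}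
    (d : Deriv Γ M A) : ∀ {Γ' : Ctx S.Atom} (t : Thin Γ Γ'), Valid Γ' (M.rename t.ren) A := by
  induction d with
  | ax1 p s => intro Γ' t; exact ⟨.ax1 (t.pick p).some s⟩
  | ax2 k b s => intro Γ' t; exact ⟨.ax2 k (t.allBang b).some s⟩
  | app sp d e ihd ihe =>
      intro Γ' t
      obtain ⟨_, _, ⟨q⟩, ⟨t₁, h₁⟩, ⟨t₂, h₂⟩⟩ := t.split sp
      exact ⟨.app q (h₁ ▸ ihd t₁).some (h₂ ▸ ihe t₂).some⟩
  | lam1 d ih => intro Γ' t; exact ⟨.lam1 (ih (.keep _ t)).some⟩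
  | lam2 n b d ih => intro Γ' t; exact ⟨.lam2 n (t.allBang b).some (ih (.keep _ t)).some⟩
  | oneI n b => intro Γ' t; exact ⟨.oneI n (t.allBang b).some⟩
  | tensorI n sp d e ihd ihe =>
      intro Γ' t
      obtain ⟨_, _, ⟨q⟩, ⟨t₁, h₁⟩, ⟨t₂, h₂⟩⟩ := t.split sp
      exact ⟨.tensorI n q (h₁ ▸ ihd t₁).some (h₂ ▸ ihe t₂).some⟩
  | oneE sp d e ihd ihe =>
      intro Γ' t
      obtain ⟨_, _, ⟨q⟩, ⟨t₁, h₁⟩, ⟨t₂, h₂⟩⟩ := t.split sp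
      exact ⟨.oneE q (h₁ ▸ ihd t₁).some (h₂ ▸ ihe t₂).some⟩
  | tensorE n sp d e ihd ihe =>
      intro Γ' t
      obtain ⟨_, _, ⟨q⟩, ⟨t₁, h₁⟩, ⟨t₂, h₂⟩⟩ := t.split sp
      have h := ihe (.keep _ (.keep _ t₂))
      simp only [Thin.ren, h₂] at h
      exact ⟨.tensorE n q (h₁ ▸ ihd t₁).some h.some⟩

theorem Pick.lt_length {At : Type u} {Γ : Ctx At} {i : ℕ} {A : Ty At} (p : Pick Γ i A) :
    i < Γ.length := by
  induction p with
  | here b => simp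
  | skip p ih => simpa using ih
  | weak B p ih => simpa using ih

theorem Split.length {At : Type u} {Γ Γ₁ Γ₂ : Ctx At} (s : Split Γ Γ₁ Γ₂) :
    Γ₁.length = Γ.length ∧ Γ₂.length = Γ.length := by
  induction s <;> simp_all

theorem liftRen_congr {r r' : ℕ → ℕ} {k : ℕ} (h : ∀ i < k, r i = r' i) :
    ∀ i < k + 1, liftRen r i = liftRen r' i := by
  rintro (_ | i) hi
  · rfl
  · simp [liftRen, h i (by omega)]

theorem Deriv.rename_congr {S : Signature.{u, v}} {Γ : Ctx S.Atom} {M : Term S} {A : Ty S.Atom}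
    (d : Deriv Γ M A) :
    ∀ {r r' : ℕ → ℕ}, (∀ i < Γ.length, r i = r' i) → M.rename r = M.rename r' := by
  induction d with
  | ax1 p s => intro r r' h; simp [Term.rename, h _ p.lt_length]
  | ax2 k b s => intros; rfl
  | lam1 d ih => intro r r' h; simp only [Term.rename]; rw [ih (liftRen_congr h)]
  | lam2 n b d ih => intro r r' h; simp only [Term.rename]; rw [ih (liftRen_congr h)]
  | oneI n b => intros; rfl
  | app sp d e ihd ihe | tensorI n sp d e ihd ihe | oneE sp d e ihd ihe =>
      intro r r' h
      simp only [Term.rename]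
      rw [ihd (r' := r') (by rwa [sp.length.1]), ihe (r' := r') (by rwa [sp.length.2])]
  | tensorE n sp d e ihd ihe =>
      intro r r' h
      simp only [Term.rename]
      rw [ihd (r' := r') (by rwa [sp.length.1]),
        ihe (liftRen_congr (liftRen_congr (by rwa [sp.length.2])))]

theorem liftRen_id : liftRen (fun i => i) = fun i => i := by
  funext i; cases i <;> rfl

theorem Term.rename_id {S : Signature.{u, v}} (M : Term S) : M.rename (fun i => i) = M := by
  induction M <;> simp_all [Term.rename, liftRen_id]

/-- The thinning of `x : A` which puts `k` undeclared variables before and `j` after `x`. -/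
def Thin.single {At : Type u} (A : Ty At) (j : ℕ) :
    ∀ k : ℕ, Thin [some A] (List.replicate k none ++ some A :: List.replicate j none)
  | 0 => .keep _ (Nat.rec .nil (fun _ t => .drop t) j)
  | k + 1 => .drop (Thin.single A j k)

theorem Thin.single_ren {At : Type u} (A : Ty At) (j k : ℕ) : (Thin.single A j k).ren 0 = k := by
  induction k with
  | zero => rfl
  | succ k ih => simp [Thin.single, Thin.ren, ih]

/-- A term whose only free variable is `0`, with that variable renamed to `k`. -/
abbrev Term.at {S : Signature.{u, v}} (M : Term S) (k : ℕ) : Term S :=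
  M.rename (fun _ => k)

theorem Valid.at {S : Signature.{u, v}} {A B : Ty S.Atom} {M : Term S} (h : Valid [some A] M B)
    (j k : ℕ) :
    Valid (List.replicate k none ++ some A :: List.replicate j none) (M.at k) B := by
  obtain ⟨d⟩ := h
  have h' := Valid.thin d (Thin.single A j k)
  rwa [d.rename_congr (r' := fun _ => k)] at h'
  intro i hi
  obtain rfl : i = 0 := by simpa using hi
  exact Thin.single_ren A j k

theorem Valid.at_zero {S : Signature.{u, v}} {A B : Ty S.Atom} {M : Term S}
    (h : Valid [some A] M B) (j : ℕ) : Valid (some A :: List.replicate j none) M B := by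
  have h' := h.at j 0
  obtain ⟨d⟩ := h
  rwa [Term.at, d.rename_congr (r' := fun i => i), Term.rename_id] at h'
  intro i hi
  have : i = 0 := by simpa using hi
  exact this.symm

theorem Split.allRight {At : Type u} (Γ : Ctx At) :
    Nonempty (Split Γ (Γ.map fun _ => none) Γ) := by
  induction Γ with
  | nil => exact ⟨.nil⟩
  | cons a Γ ih =>
      cases a with
      | none => exact ⟨.skip ih.some⟩
      | some A => exact ⟨.right A ih.some⟩

theorem AllBang.none {At : Type u} (Γ : Ctx At) :
    Nonempty (AllBang (Γ.map fun _ => (none : Option (Ty At)))) := by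
  induction Γ with
  | nil => exact ⟨.nil⟩
  | cons a Γ ih => exact ⟨.skip ih.some⟩

/-- The identity thinning. -/
def Thin.refl {At : Type u} : ∀ Γ : Ctx At, Thin Γ Γ
  | [] => .nil
  | a :: Γ => .keep a (Thin.refl Γ)

theorem Thin.refl_ren {At : Type u} (Γ : Ctx At) : (Thin.refl Γ).ren = fun i => i := by
  induction Γ with
  | nil => rfl
  | cons a Γ ih => rw [Thin.refl, Thin.ren, ih, liftRen_id]

theorem Valid.lamU {S : Signature.{u, v}} {Γ : Ctx S.Atom} {M : Term S} {A : Ty S.Atom}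
    (h : Valid Γ M A) : Valid Γ M.lamU (.lolli .one A) := by
  have h' := Valid.thin h.some (.drop (Thin.refl Γ))
  simp only [Thin.ren, Thin.refl_ren] at h'
  exact ⟨.lam1 (.oneE (.left _ (Split.allRight Γ).some)
    (.ax1 (.here (AllBang.none Γ).some) (Sub.refl _).some) h'.some)⟩

/-- Variable rule, for a variable at its declared type. -/
theorem Valid.var {S : Signature.{u, v}} {Γ : Ctx S.Atom} {i : ℕ} {A : Ty S.Atom}
    (p : Pick Γ i A) : Valid Γ (.var i A : Term S) A :=
  ⟨.ax1 p (Sub.refl A).some⟩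

/-! ### The category of values, with its operations -/

/-- Arrows `A → B` of the category of values, represented by the valid typing judgments
`x : A ⊢ V : B` with `V` a value. Two representatives are equal as arrows if they are
axiomatically equivalent. -/
structure Arrow (S : Signature.{u, v}) (A B : Ty S.Atom) where
  tm : Term S
  val : IsValue tm
  valid : Valid [some A] tm B

namespace Yaq

variable {S : Signature.{u, v}}

local notation "𝟏" => Ty.one
local infixr:60 " ⊸ " => Ty.lolli
local infixr:70 " ⊠ " => Ty.tensor
local prefix:80 "‼" => Ty.bang

/-- `x` -/
def id (A : Ty S.Atom) : Arrow S A A :=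
  ⟨.var 0 A, .var _ _, .var (.here .nil)⟩

/-- `let y = V in W` -/
def comp {A B C : Ty S.Atom} (f : Arrow S A B) (g : Arrow S B C) : Arrow S A C :=
  ⟨.letIn B f.tm g.tm, .letIn _ f.val g.val,
    ⟨.app (.right _ .nil) (.lam1 (g.valid.at_zero 1).some) f.valid.some⟩⟩

/-- `let ⟨x, y⟩ = z in ⟨V, W⟩` -/
def tensorHom {A B C D : Ty S.Atom} (f : Arrow S A B) (g : Arrow S C D) :
    Arrow S (A ⊠ C) (B ⊠ D) :=
  ⟨.letpair 0 A C (.var 0 (A ⊠ C)) (.pair 0 (f.tm.at 1) (g.tm.at 0)),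
    .letpair _ _ _ (.var _ _) (.pair _ (f.val.rename _) (g.val.rename _)),
    ⟨.tensorE 0 (.left _ .nil) (Valid.var (.here .nil)).some
      (.tensorI 0 (.right _ (.left _ (.skip .nil))) (f.valid.at 1 1).some
        (g.valid.at 2 0).some)⟩⟩

/-- `let ⟨y, z⟩ = x in let ⟨t, u⟩ = z in ⟨⟨y, t⟩, u⟩` -/
def assoc (A B C : Ty S.Atom) : Arrow S (A ⊠ (B ⊠ C)) ((A ⊠ B) ⊠ C) :=
  ⟨.letpair 0 A (B ⊠ C) (.var 0 (A ⊠ (B ⊠ C)))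
      (.letpair 0 B C (.var 0 (B ⊠ C))
        (.pair 0 (.pair 0 (.var 3 A) (.var 1 B)) (.var 0 C))),
    .letpair _ _ _ (.var _ _) (.letpair _ _ _ (.var _ _)
      (.pair _ (.pair _ (.var _ _) (.var _ _)) (.var _ _))),
    ⟨.tensorE 0 (.left _ .nil) (Valid.var (.here .nil)).some
      (.tensorE 0 (.left _ (.right _ (.skip .nil)))
        (Valid.var (.here (.skip (.skip .nil)))).some
        (.tensorI 0 (.right _ (.left _ (.skip (.left _ (.skip .nil)))))
          (.tensorI 0 (.skip (.right _ (.skip (.left _ (.skip .nil)))))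
            (Valid.var (.skip (.skip (.skip (.here (.skip .nil)))))).some
            (Valid.var (.skip (.here (.skip (.skip (.skip .nil)))))).some)
          (Valid.var (.here (.skip (.skip (.skip (.skip .nil)))))).some))⟩⟩

/-- `let ⟨y, z⟩ = x in let ⟨t, u⟩ = y in ⟨t, ⟨u, z⟩⟩` -/
def assocInv (A B C : Ty S.Atom) : Arrow S ((A ⊠ B) ⊠ C) (A ⊠ (B ⊠ C)) :=
  ⟨.letpair 0 (A ⊠ B) C (.var 0 ((A ⊠ B) ⊠ C))
      (.letpair 0 A B (.var 1 (A ⊠ B))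
        (.pair 0 (.var 1 A) (.pair 0 (.var 0 B) (.var 2 C)))),
    .letpair _ _ _ (.var _ _) (.letpair _ _ _ (.var _ _)
      (.pair _ (.var _ _) (.pair _ (.var _ _) (.var _ _)))),
    ⟨.tensorE 0 (.left _ .nil) (Valid.var (.here .nil)).some
      (.tensorE 0 (.right _ (.left _ (.skip .nil)))
        (Valid.var (.skip (.here (.skip .nil)))).some
        (.tensorI 0 (.right _ (.left _ (.right _ (.skip (.skip .nil)))))
          (Valid.var (.skip (.here (.skip (.skip (.skip .nil)))))).some
          (.tensorI 0 (.left _ (.skip (.right _ (.skip (.skip .nil)))))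
            (Valid.var (.here (.skip (.skip (.skip (.skip .nil)))))).some
            (Valid.var (.skip (.skip (.here (.skip (.skip .nil)))))).some)))⟩⟩

/-- `let ⟨y, z⟩ = x in let * = y in z` -/
def leftUnit (A : Ty S.Atom) : Arrow S (𝟏 ⊠ A) A :=
  ⟨.letpair 0 𝟏 A (.var 0 (𝟏 ⊠ A)) (.letunit (.var 1 𝟏) (.var 0 A)),
    .letpair _ _ _ (.var _ _) (.letunit (.var _ _) (.var _ _)),
    ⟨.tensorE 0 (.left _ .nil) (Valid.var (.here .nil)).some
      (.oneE (.right _ (.left _ (.skip .nil))) (Valid.var (.skip (.here (.skip .nil)))).some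
        (Valid.var (.here (.skip (.skip .nil)))).some)⟩⟩

/-- `⟨*, x⟩` -/
def leftUnitInv (A : Ty S.Atom) : Arrow S A (𝟏 ⊠ A) :=
  ⟨.pair 0 (.unit 0) (.var 0 A), .pair _ (.unit _) (.var _ _),
    ⟨.tensorI 0 (.right _ .nil) (.oneI 0 (.skip .nil)) (Valid.var (.here .nil)).some⟩⟩

/-- `let ⟨y, z⟩ = x in let * = z in y` -/
def rightUnit (A : Ty S.Atom) : Arrow S (A ⊠ 𝟏) A :=
  ⟨.letpair 0 A 𝟏 (.var 0 (A ⊠ 𝟏)) (.letunit (.var 0 𝟏) (.var 1 A)),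
    .letpair _ _ _ (.var _ _) (.letunit (.var _ _) (.var _ _)),
    ⟨.tensorE 0 (.left _ .nil) (Valid.var (.here .nil)).some
      (.oneE (.left _ (.right _ (.skip .nil))) (Valid.var (.here (.skip (.skip .nil)))).some
        (Valid.var (.skip (.here (.skip .nil)))).some)⟩⟩

/-- `⟨x, *⟩` -/
def rightUnitInv (A : Ty S.Atom) : Arrow S A (A ⊠ 𝟏) :=
  ⟨.pair 0 (.var 0 A) (.unit 0), .pair _ (.var _ _) (.unit _),
    ⟨.tensorI 0 (.left _ .nil) (Valid.var (.here .nil)).some (.oneI 0 (.skip .nil))⟩⟩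

/-- `let ⟨y, z⟩ = x in ⟨z, y⟩` -/
def swap (A B : Ty S.Atom) : Arrow S (A ⊠ B) (B ⊠ A) :=
  ⟨.letpair 0 A B (.var 0 (A ⊠ B)) (.pair 0 (.var 0 B) (.var 1 A)),
    .letpair _ _ _ (.var _ _) (.pair _ (.var _ _) (.var _ _)),
    ⟨.tensorE 0 (.left _ .nil) (Valid.var (.here .nil)).some
      (.tensorI 0 (.left _ (.right _ (.skip .nil)))
        (Valid.var (.here (.skip (.skip .nil)))).some
        (Valid.var (.skip (.here (.skip .nil)))).some)⟩⟩

/-- The promotion of `V` -/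
def Lmap {A B : Ty S.Atom} (f : Arrow S A B) : Arrow S (‼A) (‼B) :=
  ⟨f.tm.promote, f.val.promote, Valid.promote f.val f.valid.some⟩

/-- `x^A` -/
def counit (A : Ty S.Atom) : Arrow S (‼A) A :=
  ⟨.var 0 A, .var _ _, ⟨.ax1 (.here .nil) (Sub.refl A).some.bang_left.some⟩⟩

/-- `x^{!!A}` -/
def comult (A : Ty S.Atom) : Arrow S (‼A) (‼‼A) :=
  ⟨.var 0 (‼‼A), .var _ _, ⟨.ax1 (.here .nil) (Sub.refl (‼A)).some.bang_right.some⟩⟩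

/-- `let ⟨x, y⟩ = z in ⟨x, y⟩¹` -/
def d (A B : Ty S.Atom) : Arrow S (‼A ⊠ ‼B) (‼(A ⊠ B)) :=
  ⟨.letpair 0 (‼A) (‼B) (.var 0 (‼A ⊠ ‼B)) (.pair 1 (.var 1 (‼A)) (.var 0 (‼B))),
    .letpair _ _ _ (.var _ _) (.pair _ (.var _ _) (.var _ _)),
    ⟨.tensorE 0 (.left _ .nil) (Valid.var (.here .nil)).some
      (.tensorI 1 (.right _ (.left _ (.skip .nil)))
        (Valid.var (.skip (.here (.skip .nil)))).some
        (Valid.var (.here (.skip (.skip .nil)))).some)⟩⟩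

/-- `let ⟨x, y⟩¹ = z in ⟨x, y⟩` -/
def dInv (A B : Ty S.Atom) : Arrow S (‼(A ⊠ B)) (‼A ⊠ ‼B) :=
  ⟨.letpair 1 A B (.var 0 (‼(A ⊠ B))) (.pair 0 (.var 1 (‼A)) (.var 0 (‼B))),
    .letpair _ _ _ (.var _ _) (.pair _ (.var _ _) (.var _ _)),
    ⟨.tensorE 1 (.left _ .nil) (Valid.var (.here .nil)).some
      (.tensorI 0 (.right _ (.left _ (.skip .nil)))
        (Valid.var (.skip (.here (.skip .nil)))).some
        (Valid.var (.here (.skip (.skip .nil)))).some)⟩⟩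

/-- `let * = z in *¹` -/
def dOne : Arrow S 𝟏 (‼𝟏) :=
  ⟨.letunit (.var 0 𝟏) (.unit 1), .letunit (.var _ _) (.unit _),
    ⟨.oneE (.left _ .nil) (Valid.var (.here .nil)).some (.oneI 1 (.skip .nil))⟩⟩

/-- `⟨x, x⟩` -/
def dup (A : Ty S.Atom) : Arrow S (‼A) (‼A ⊠ ‼A) :=
  ⟨.pair 0 (.var 0 (‼A)) (.var 0 (‼A)), .pair _ (.var _ _) (.var _ _),
    ⟨.tensorI 0 (.both _ .nil) (Valid.var (.here .nil)).some (Valid.var (.here .nil)).some⟩⟩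

/-- `*` -/
def discard (A : Ty S.Atom) : Arrow S (‼A) 𝟏 :=
  ⟨.unit 0, .unit _, ⟨.oneI 0 (.cons _ .nil)⟩⟩

/-- `λ*. x` -/
def unit (A : Ty S.Atom) : Arrow S A (𝟏 ⊸ A) :=
  ⟨.lamU (.var 0 A), .lam _ _ _, (Valid.var (.here .nil)).lamU⟩

/-- `λ*. (x *) *` -/
def mult (A : Ty S.Atom) : Arrow S (𝟏 ⊸ 𝟏 ⊸ A) (𝟏 ⊸ A) :=
  ⟨.lamU (.app (.app (.var 0 (𝟏 ⊸ 𝟏 ⊸ A)) (.unit 0)) (.unit 0)), .lam _ _ _,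
    Valid.lamU ⟨.app (.left _ .nil)
      (.app (.left _ .nil) (Valid.var (.here .nil)).some (.oneI 0 (.skip .nil)))
      (.oneI 0 (.skip .nil))⟩⟩

/-- `λ*. let x = y * in V *` -/
def star {A B : Ty S.Atom} (f : Arrow S A (𝟏 ⊸ B)) : Arrow S (𝟏 ⊸ A) (𝟏 ⊸ B) :=
  ⟨.lamU (.letIn A (.app (.var 0 (𝟏 ⊸ A)) (.unit 0)) (.app f.tm (.unit 0))), .lam _ _ _,
    Valid.lamU ⟨.app (.right _ .nil)
      (.lam1 (.app (.left _ (.skip .nil)) (f.valid.at_zero 1).some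
        (.oneI 0 (.skip (.skip .nil)))))
      (.app (.left _ .nil) (Valid.var (.here .nil)).some (.oneI 0 (.skip .nil)))⟩⟩

/-- `let ⟨x, y⟩ = z in λ*. ⟨x, y *⟩` -/
def strength (A B : Ty S.Atom) : Arrow S (A ⊠ (𝟏 ⊸ B)) (𝟏 ⊸ A ⊠ B) :=
  ⟨.letpair 0 A (𝟏 ⊸ B) (.var 0 (A ⊠ (𝟏 ⊸ B)))
      (.lamU (.pair 0 (.var 1 A) (.app (.var 0 (𝟏 ⊸ B)) (.unit 0)))),
    .letpair _ _ _ (.var _ _) (.lam _ _ _),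
    ⟨.tensorE 0 (.left _ .nil) (Valid.var (.here .nil)).some
      (Valid.lamU ⟨.tensorI 0 (.right _ (.left _ (.skip .nil)))
        (Valid.var (.skip (.here (.skip .nil)))).some
        (.app (.left _ (.skip (.skip .nil))) (Valid.var (.here (.skip (.skip .nil)))).some
          (.oneI 0 (.skip (.skip (.skip .nil)))))⟩).some⟩⟩

/-- `λ x. let y = z V in W` -/
def lolliHom {A B C D : Ty S.Atom} (f : Arrow S A B) (g : Arrow S C D) :
    Arrow S (B ⊸ C) (A ⊸ D) :=
  ⟨.lam 0 A (.letIn C (.app (.var 1 (B ⊸ C)) f.tm) g.tm), .lam _ _ _,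
    ⟨.lam1 (.app (.right _ (.right _ .nil)) (.lam1 (g.valid.at_zero 2).some)
      (.app (.right _ (.left _ .nil)) (Valid.var (.skip (.here .nil))).some
        (f.valid.at_zero 1).some))⟩⟩

/-- `λ*. let ⟨x, y⟩ = t in V y` -/
def Phi {A B C : Ty S.Atom} (f : Arrow S A (B ⊸ C)) : Arrow S (A ⊠ B) (𝟏 ⊸ C) :=
  ⟨.lamU (.letpair 0 A B (.var 0 (A ⊠ B)) (.app (f.tm.at 1) (.var 0 B))), .lam _ _ _,
    Valid.lamU ⟨.tensorE 0 (.left _ .nil) (Valid.var (.here .nil)).some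
      (.app (.right _ (.left _ (.skip .nil))) (f.valid.at 1 1).some
        (Valid.var (.here (.skip (.skip .nil)))).some)⟩⟩

/-- `λ y. let t = ⟨x, y⟩ in V *`, the inverse of `Phi` -/
def PhiInv {A B C : Ty S.Atom} (f : Arrow S (A ⊠ B) (𝟏 ⊸ C)) : Arrow S A (B ⊸ C) :=
  ⟨.lam 0 B (.letIn (A ⊠ B) (.pair 0 (.var 1 A) (.var 0 B)) (.app f.tm (.unit 0))),
    .lam _ _ _,
    ⟨.lam1 (.app (.right _ (.right _ .nil))
      (.lam1 (.app (.left _ (.skip (.skip .nil))) (f.valid.at_zero 2).some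
        (.oneI 0 (.skip (.skip (.skip .nil))))))
      (.tensorI 0 (.right _ (.left _ .nil)) (Valid.var (.skip (.here .nil))).some
        (Valid.var (.here (.skip .nil))).some))⟩⟩

end Yaq

/-- The syntactic category: objects are types, arrows are (represented by) values with one free
variable, `L A = !A` and `T A = 1 ⊸ A`. -/
def yaq (S : Signature.{u, v}) : DupOps.{u, max u v} where
  Obj := Ty S.Atom
  Hom := Arrow S
  id := Yaq.id
  comp := Yaq.comp
  tensor := Ty.tensor
  tensorHom := Yaq.tensorHom
  one := Ty.one
  assoc := Yaq.assoc
  assocInv := Yaq.assocInv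
  leftUnit := Yaq.leftUnit
  leftUnitInv := Yaq.leftUnitInv
  rightUnit := Yaq.rightUnit
  rightUnitInv := Yaq.rightUnitInv
  swap := Yaq.swap
  L := Ty.bang
  Lmap := Yaq.Lmap
  counit := Yaq.counit
  comult := Yaq.comult
  d := Yaq.d
  dInv := Yaq.dInv
  dOne := Yaq.dOne
  dOneInv := Yaq.counit Ty.one
  dup := Yaq.dup
  discard := Yaq.discard
  T := fun A => Ty.lolli Ty.one A
  unit := Yaq.unit
  mult := Yaq.mult
  star := Yaq.star
  strength := Yaq.strength
  lolli := Ty.lolli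
  lolliHom := Yaq.lolliHom
  Phi := Yaq.Phi
  PhiInv := Yaq.PhiInv

theorem yaq_ty {S : Signature.{u, v}} (A : Ty S.Atom) :
    (yaq S).ty (Ty.atom : S.Atom → Ty S.Atom) A = A := by
  induction A with
  | atom a => rfl
  | lolli A B ihA ihB => exact congrArg₂ Ty.lolli ihA ihB
  | tensor A B ihA ihB => exact congrArg₂ Ty.tensor ihA ihB
  | one => rfl
  | bang A ih => exact congrArg Ty.bang ih

/-- The identity interpretation of the language in its syntactic category: a type constant is
interpreted by itself, and a constant `c` by `z : 1 ⊢ let * = z in c : !A_c`. -/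
def idInterp (S : Signature.{u, v}) : (yaq S).Interp S where
  atom := Ty.atom
  const c :=
    { tm := .letunit (.var 0 .one) (.const c (.bang (S.ty c)))
      val := .letunit (.var _ _) (.const _ _)
      valid := by
        rw [yaq_ty]
        exact ⟨.oneE (.left _ .nil) (Valid.var (.here .nil)).some
          (.ax2 c (.skip .nil) (Sub.refl _).some)⟩ }

/-- The computational denotation `⟦x : A ⊢ M : B⟧ᶜ : A → TB` in the syntactic category, read off
from a typing derivation. The interpretation of the one-variable context is `1 ⊗ A`, identified
with `A` by the unit isomorphism. -/
def denotC {S : Signature.{u, v}} {A B : Ty S.Atom} {M : Term S} (π : Deriv [some A] M B) :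
    Arrow S ((yaq S).ty (idInterp S).atom A) (.lolli .one ((yaq S).ty (idInterp S).atom B)) :=
  (yaq S).comp ((yaq S).leftUnitInv _) (DupOps.denC (idInterp S) π)

/-- The value denotation `⟦x : A ⊢ V : B⟧ᵛ : A → B` in the syntactic category. -/
def denotV {S : Signature.{u, v}} {A B : Ty S.Atom} {V : Term S} (hV : IsValue V)
    (π : Deriv [some A] V B) :
    Arrow S ((yaq S).ty (idInterp S).atom A) ((yaq S).ty (idInterp S).atom B) :=
  (yaq S).comp ((yaq S).leftUnitInv _) (DupOps.denV (idInterp S) V hV π)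

end LinLam

namespace LinLam

/-! ### Typing with contexts as functions -/

/-! The denotation of `Γ ⊢ M : A` is an arrow out of one object, the tensor product of the types in
`Γ`, whereas `M` has one free variable per declaration. The two are compared by feeding the
denotation with the tuple of the variables of `Γ`. Write `act f m` for `let x = m in f` and `tup Γ`
for that tuple. The claims proved by induction are that `act ⟦M⟧ᶜ (tup Γ)` rewrites to `λ*. M`
(`act_denC`) and that `act ⟦V⟧ᵛ (tup Γ)` rewrites to `V` (`act_denV`). For `Γ = x : A` the tuple is
`⟨*, x⟩`, the term of the left unit isomorphism, so the theorem is this special case.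

The inductions are computations with the combinators of the syntactic category. Composition of
arrows is `let`, so `act (f; g) m` becomes `act g (act f m)` (`act_comp`). Each structure map is
evaluated on arguments of the appropriate form: pairs for the monoidal maps, thunks `λ*. P` for the
monad. Components that the rearrangements move past one another are required to be values. All of
this reduces to a small calculus of `let`: nested `let`s flatten, a `let x = V` commutes with every
other `let` (`Red.let_comm_var`), and `let` moves in and out of the two sides of an application or a
pair (`Red.let_left`, `Red.let_right`). The β axioms are needed only when the substituted values are
variables or `*`, so no general substitution lemma is required.

Two places need more than this calculus. The canonical arrows of subtyping must act as the
re-indexing `castTo`; this is `IsCast.sub`, by induction on the subtyping derivation, using the cast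
and η axioms. The predicate `IsCast` includes all iterated promotions because `sub` applies `L` to
smaller canonical arrows. For `λⁿ⁺¹`, the arrow `!Δ → L(!Δ)` turns the tuple into its promotion
`ptup`, which can be moved under the λ because all its variables are duplicable, and which the cast
back to the type of the context turns into `tup` again (`act_Lmap_PhiInv`).

Axiomatic equivalence relates valid judgments only, so every rewriting step must preserve typing.
The relation `Red` combines the two: typability of the left side in any context yields typability of
the right side and equivalence there. It is a congruence in which contexts and types stay implicit.
Typing itself is handled by the recursive predicate `Typed` over contexts that are functions, where
exchange, weakening, contraction and subtyping of declarations become one lemma on renamings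
(`Typed.rename`). -/

/-- The declaration of the variable `i` in a context. -/
def lk {At : Type u} (Γ : Ctx At) (i : ℕ) : Option (Ty At) := Γ.getD i none

/-- Extend a context function by an innermost declaration. -/
def scons {At : Type u} (a : Option (Ty At)) (γ : ℕ → Option (Ty At)) : ℕ → Option (Ty At)
  | 0 => a
  | i + 1 => γ i

@[simp] theorem scons_zero {At : Type u} (a : Option (Ty At)) (γ : ℕ → Option (Ty At)) :
    scons a γ 0 = a := rfl

@[simp] theorem scons_succ {At : Type u} (a : Option (Ty At)) (γ : ℕ → Option (Ty At)) (i : ℕ) :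
    scons a γ (i + 1) = γ i := rfl

@[simp] theorem lk_nil {At : Type u} (i : ℕ) : lk ([] : Ctx At) i = none := by simp [lk]

@[simp] theorem lk_cons {At : Type u} (a : Option (Ty At)) (Γ : Ctx At) :
    lk (a :: Γ) = scons a (lk Γ) := by
  funext i; cases i <;> simp [lk]

theorem lk_of_length_le {At : Type u} {Γ : Ctx At} {i : ℕ} (h : Γ.length ≤ i) :
    lk Γ i = none := by
  simp [lk, List.getD_eq_getElem?_getD, h]

/-- The declaration may be discarded and copied. -/
def Disc {At : Type u} (o : Option (Ty At)) : Prop := ∀ A, o = some A → ∃ B, A = .bang B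

@[simp] theorem disc_none {At : Type u} : Disc (none : Option (Ty At)) := by simp [Disc]

theorem disc_some {At : Type u} {A : Ty At} : Disc (some A) ↔ ∃ B, A = .bang B := by
  simp [Disc]

/-- `Part a b c`: the declaration `a` is distributed to the two sides as `b` and `c`. -/
def Part {At : Type u} (a b c : Option (Ty At)) : Prop :=
  (b = a ∧ c = none) ∨ (b = none ∧ c = a) ∨ (b = a ∧ c = a ∧ Disc a)

/-- Pointwise distribution of a context. -/
def Parts {At : Type u} (γ γ₁ γ₂ : ℕ → Option (Ty At)) : Prop := ∀ i, Part (γ i) (γ₁ i) (γ₂ i)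

theorem nonempty_allBang {At : Type u} {Γ : Ctx At} :
    Nonempty (AllBang Γ) ↔ ∀ i, Disc (lk Γ i) := by
  induction Γ with
  | nil => simp only [lk_nil, disc_none, implies_true, iff_true]; exact ⟨.nil⟩
  | cons a Γ ih =>
      constructor
      · rintro ⟨_ | b | ⟨A, b⟩⟩
        · rintro (_ | i)
          · simp
          · simpa using ih.1 ⟨b⟩ i
        · rintro (_ | i)
          · simp [Disc]
          · simpa using ih.1 ⟨b⟩ i
      · intro h
        have b := (ih.2 fun i => by simpa using h (i + 1)).some
        cases a with
        | none => exact ⟨.skip b⟩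
        | some A =>
            obtain ⟨B, rfl⟩ := h 0 A (by simp)
            exact ⟨.cons B b⟩

theorem nonempty_pick {At : Type u} {Γ : Ctx At} {i : ℕ} {A : Ty At} :
    Nonempty (Pick Γ i A) ↔ lk Γ i = some A ∧ ∀ j, j ≠ i → Disc (lk Γ j) := by
  constructor
  · rintro ⟨p⟩
    induction p with
    | here b =>
        refine ⟨by simp, ?_⟩
        rintro (_ | j) h
        · exact absurd rfl h
        · simpa using nonempty_allBang.1 ⟨b⟩ j
    | skip p ih =>
        refine ⟨by simpa using ih.1, ?_⟩
        rintro (_ | j) h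
        · simp
        · simpa using ih.2 j (by omega)
    | weak B p ih =>
        refine ⟨by simpa using ih.1, ?_⟩
        rintro (_ | j) h
        · simp [Disc]
        · simpa using ih.2 j (by omega)
  · induction Γ generalizing i with
    | nil => simp
    | cons a Γ ih =>
        rintro ⟨h, h'⟩
        cases i with
        | zero =>
            simp only [lk_cons, scons_zero] at h
            subst h
            exact ⟨.here (nonempty_allBang.2 fun j => by simpa using h' (j + 1) (by omega)).some⟩
        | succ i =>
            have p := (ih ⟨by simpa using h,
              fun j hj => by simpa using h' (j + 1) (by omega)⟩).some
            cases a with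
            | none => exact ⟨.skip p⟩
            | some B =>
                obtain ⟨B, rfl⟩ := h' 0 (by omega) B (by simp)
                exact ⟨.weak B p⟩

theorem Split.parts {At : Type u} {Γ Γ₁ Γ₂ : Ctx At} (s : Split Γ Γ₁ Γ₂) :
    Parts (lk Γ) (lk Γ₁) (lk Γ₂) := by
  induction s with
  | nil => intro i; simp [Part]
  | skip s ih => rintro (_ | i) <;> simp [Part]; simpa [Part] using ih i
  | left A s ih => rintro (_ | i) <;> simp [Part]; simpa [Part] using ih i
  | right A s ih => rintro (_ | i) <;> simp [Part]; simpa [Part] using ih i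
  | both A s ih => rintro (_ | i) <;> simp [Part, Disc]; simpa [Part, Disc] using ih i

/-- Past the end of the list both sides of the distribution are forced to be `none`, so functions
that distribute a list context are themselves list contexts. -/
theorem exists_split {At : Type u} {Γ : Ctx At} :
    ∀ {γ₁ γ₂ : ℕ → Option (Ty At)}, Parts (lk Γ) γ₁ γ₂ →
      ∃ Γ₁ Γ₂, Nonempty (Split Γ Γ₁ Γ₂) ∧ lk Γ₁ = γ₁ ∧ lk Γ₂ = γ₂ := by
  induction Γ with
  | nil =>
      intro γ₁ γ₂ h
      refine ⟨[], [], ⟨.nil⟩, ?_, ?_⟩ <;> funext i <;> have := h i <;> simp_all [Part]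
  | cons a Γ ih =>
      intro γ₁ γ₂ h
      obtain ⟨Γ₁, Γ₂, ⟨s⟩, h₁, h₂⟩ := ih (γ₁ := fun i => γ₁ (i + 1)) (γ₂ := fun i => γ₂ (i + 1))
        (fun i => by simpa using h (i + 1))
      refine ⟨γ₁ 0 :: Γ₁, γ₂ 0 :: Γ₂, ?_, ?_, ?_⟩
      · have h0 := h 0
        simp only [lk_cons, scons_zero] at h0
        cases a with
        | none =>
            have h1 : γ₁ 0 = none ∧ γ₂ 0 = none := by rcases h0 with h | h | h <;> simp [h]
            rw [h1.1, h1.2]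
            exact ⟨.skip s⟩
        | some A =>
            rcases h0 with ⟨h, h'⟩ | ⟨h, h'⟩ | ⟨h, h', h''⟩ <;> rw [h, h']
            · exact ⟨.left A s⟩
            · exact ⟨.right A s⟩
            · obtain ⟨B, rfl⟩ := disc_some.1 h''
              exact ⟨.both B s⟩
      · rw [lk_cons, h₁]; funext i; cases i <;> rfl
      · rw [lk_cons, h₂]; funext i; cases i <;> rfl

/-- Typability, by recursion on the term, in a context given as a function. -/
def Typed {S : Signature.{u, v}} : Term S → (ℕ → Option (Ty S.Atom)) → Ty S.Atom → Prop
  | .var i B, γ, T =>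
      T = B ∧ (∃ A, γ i = some A ∧ Nonempty (Sub A B)) ∧ ∀ j, j ≠ i → Disc (γ j)
  | .const c B, γ, T => T = B ∧ Nonempty (Sub (.bang (S.ty c)) B) ∧ ∀ j, Disc (γ j)
  | .unit n, γ, T => T = Ty.bangs n .one ∧ ∀ j, Disc (γ j)
  | .lam n A M, γ, T => ∃ B, T = Ty.bangs n (.lolli A B) ∧ (n ≠ 0 → ∀ j, Disc (γ j)) ∧
      Typed M (scons (some A) γ) B
  | .app M N, γ, T => ∃ γ₁ γ₂ A, Parts γ γ₁ γ₂ ∧ Typed M γ₁ (.lolli A T) ∧ Typed N γ₂ A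
  | .pair n M N, γ, T => ∃ γ₁ γ₂ A B, T = Ty.bangs n (.tensor A B) ∧ Parts γ γ₁ γ₂ ∧
      Typed M γ₁ (Ty.bangs n A) ∧ Typed N γ₂ (Ty.bangs n B)
  | .letpair n A B M N, γ, T => ∃ γ₁ γ₂, Parts γ γ₁ γ₂ ∧
      Typed M γ₁ (Ty.bangs n (.tensor A B)) ∧
      Typed N (scons (some (Ty.bangs n B)) (scons (some (Ty.bangs n A)) γ₂)) T
  | .letunit M N, γ, T => ∃ γ₁ γ₂, Parts γ γ₁ γ₂ ∧ Typed M γ₁ .one ∧ Typed N γ₂ T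

theorem Deriv.typed {S : Signature.{u, v}} {Γ : Ctx S.Atom} {M : Term S} {T : Ty S.Atom}
    (d : Deriv Γ M T) : Typed M (lk Γ) T := by
  induction d with
  | ax1 p s =>
      obtain ⟨h, h'⟩ := nonempty_pick.1 ⟨p⟩
      exact ⟨rfl, ⟨_, h, ⟨s⟩⟩, h'⟩
  | ax2 c b s => exact ⟨rfl, ⟨s⟩, nonempty_allBang.1 ⟨b⟩⟩
  | app sp d e ihd ihe => exact ⟨_, _, _, sp.parts, ihd, ihe⟩
  | lam1 d ih => exact ⟨_, rfl, by simp, by simpa using ih⟩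
  | lam2 n b d ih => exact ⟨_, rfl, fun _ => nonempty_allBang.1 ⟨b⟩, by simpa using ih⟩
  | oneI n b => exact ⟨rfl, nonempty_allBang.1 ⟨b⟩⟩
  | tensorI n sp d e ihd ihe => exact ⟨_, _, _, _, rfl, sp.parts, ihd, ihe⟩
  | oneE sp d e ihd ihe => exact ⟨_, _, sp.parts, ihd, ihe⟩
  | tensorE n sp d e ihd ihe => exact ⟨_, _, sp.parts, ihd, by simpa using ihe⟩

/-- With `Deriv.typed` this makes `Typed` equivalent to validity. Inversion of a typing rule then
becomes destructuring of a proposition, and context manipulations are pointwise. -/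
theorem Typed.valid {S : Signature.{u, v}} {M : Term S} :
    ∀ {Γ : Ctx S.Atom} {T : Ty S.Atom}, Typed M (lk Γ) T → Valid Γ M T := by
  induction M with
  | var i A =>
      rintro Γ _ ⟨rfl, ⟨B, h, ⟨s⟩⟩, h'⟩
      exact ⟨.ax1 (nonempty_pick.2 ⟨h, h'⟩).some s⟩
  | const c A => rintro Γ _ ⟨rfl, ⟨s⟩, h⟩; exact ⟨.ax2 c (nonempty_allBang.2 h).some s⟩
  | unit n => rintro Γ _ ⟨rfl, h⟩; exact ⟨.oneI n (nonempty_allBang.2 h).some⟩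
  | lam n A M ih =>
      rintro Γ _ ⟨B, rfl, h, h'⟩
      rw [← lk_cons] at h'
      cases n with
      | zero => exact ⟨.lam1 (ih h').some⟩
      | succ n => exact ⟨.lam2 n (nonempty_allBang.2 (h (by omega))).some (ih h').some⟩
  | app M N ihM ihN =>
      rintro Γ T ⟨γ₁, γ₂, A, h, hM, hN⟩
      obtain ⟨Γ₁, Γ₂, ⟨s⟩, rfl, rfl⟩ := exists_split h
      exact ⟨.app s (ihM hM).some (ihN hN).some⟩
  | pair n M N ihM ihN =>
      rintro Γ _ ⟨γ₁, γ₂, A, B, rfl, h, hM, hN⟩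
      obtain ⟨Γ₁, Γ₂, ⟨s⟩, rfl, rfl⟩ := exists_split h
      exact ⟨.tensorI n s (ihM hM).some (ihN hN).some⟩
  | letpair n A B M N ihM ihN =>
      rintro Γ T ⟨γ₁, γ₂, h, hM, hN⟩
      obtain ⟨Γ₁, Γ₂, ⟨s⟩, rfl, rfl⟩ := exists_split h
      rw [← lk_cons, ← lk_cons] at hN
      exact ⟨.tensorE n s (ihM hM).some (ihN hN).some⟩
  | letunit M N ihM ihN =>
      rintro Γ T ⟨γ₁, γ₂, h, hM, hN⟩
      obtain ⟨Γ₁, Γ₂, ⟨s⟩, rfl, rfl⟩ := exists_split h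
      exact ⟨.oneE s (ihM hM).some (ihN hN).some⟩

theorem Valid.typed {S : Signature.{u, v}} {Γ : Ctx S.Atom} {M : Term S} {T : Ty S.Atom}
    (h : Valid Γ M T) : Typed M (lk Γ) T :=
  h.some.typed

/-! ### Structural renamings -/

/-- `r` maps the context `γ` to the context `γ'`, up to subtyping, exchange, and weakening and
contraction of the duplicable declarations. -/
structure Ren {At : Type u} (r : ℕ → ℕ) (γ γ' : ℕ → Option (Ty At)) : Prop where
  sub : ∀ i A, γ i = some A → ∃ A', γ' (r i) = some A' ∧ Nonempty (Sub A' A)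
  ex : ∀ j, ¬ Disc (γ' j) → ∃ i, γ i ≠ none ∧ r i = j
  uniq : ∀ i i', γ i ≠ none → γ i' ≠ none → r i = r i' → ¬ Disc (γ' (r i)) → i = i'

theorem Disc.of_sub {At : Type u} {A A' : Ty At} (h : Disc (some A)) (s : Nonempty (Sub A' A)) :
    Disc (some A') := by
  obtain ⟨B, rfl⟩ := disc_some.1 h
  exact disc_some.2 s.some.eq_bang

theorem Ren.disc {At : Type u} {r : ℕ → ℕ} {γ γ' : ℕ → Option (Ty At)} (h : Ren r γ γ') {i : ℕ}
    (hi : γ i ≠ none) (hd : Disc (γ i)) : Disc (γ' (r i)) := by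
  obtain ⟨A, hA⟩ := Option.ne_none_iff_exists'.1 hi
  obtain ⟨A', hA', s⟩ := h.sub i A hA
  rw [hA']
  rw [hA] at hd
  exact hd.of_sub s

/-- A non-duplicable declaration of the target has a declared preimage. This preimage is duplicable,
and only types `!B` lie below types `!A`, so its image would be duplicable as well. -/
theorem Ren.allDisc {At : Type u} {r : ℕ → ℕ} {γ γ' : ℕ → Option (Ty At)} (h : Ren r γ γ')
    (hd : ∀ i, Disc (γ i)) (j : ℕ) : Disc (γ' j) := by
  by_contra hj
  obtain ⟨i, hi, rfl⟩ := h.ex j hj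
  exact hj (h.disc hi (hd i))

theorem Ren.lift {At : Type u} {r : ℕ → ℕ} {γ γ' : ℕ → Option (Ty At)} (h : Ren r γ γ')
    (A : Ty At) : Ren (liftRen r) (scons (some A) γ) (scons (some A) γ') where
  sub := by
    rintro (_ | i) B hB
    · exact ⟨B, hB, Sub.refl _⟩
    · exact h.sub i B hB
  ex := by
    rintro (_ | j) hj
    · exact ⟨0, by simp, rfl⟩
    · obtain ⟨i, hi, rfl⟩ := h.ex j hj
      exact ⟨i + 1, hi, rfl⟩
  uniq := by
    rintro (_ | i) (_ | i') hi hi' he hd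
    · rfl
    · simp [liftRen] at he
    · simp [liftRen] at he
    · simp only [liftRen, Nat.add_right_cancel_iff] at he
      rw [h.uniq i i' hi hi' he hd]

open Classical in
-- A distribution of the source is transported to the target: duplicable declarations go to both
-- sides, and each of the others has exactly one declared preimage and goes where that preimage
-- went. This is what lets `Typed.rename` pass through the rules with two premises.
theorem Ren.parts {At : Type u} {r : ℕ → ℕ} {γ γ' γ₁ γ₂ : ℕ → Option (Ty At)} (h : Ren r γ γ')
    (hp : Parts γ γ₁ γ₂) : ∃ γ₁' γ₂', Parts γ' γ₁' γ₂' ∧ Ren r γ₁ γ₁' ∧ Ren r γ₂ γ₂' := by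
  -- The share of the target matching a share `δ` of the source: every duplicable declaration, and
  -- the images of the variables declared in `δ`.
  let f (δ : ℕ → Option (Ty At)) (j : ℕ) : Option (Ty At) :=
    if Disc (γ' j) ∨ ∃ i, δ i ≠ none ∧ r i = j then γ' j else none
  have key : ∀ δ : ℕ → Option (Ty At), (∀ i, δ i = γ i ∨ δ i = none) → Ren r δ (f δ) := by
    intro δ hδ
    have hne : ∀ i, δ i ≠ none → δ i = γ i := fun i hi => (hδ i).resolve_right hi
    have hf : ∀ i, δ i ≠ none → f δ (r i) = γ' (r i) := fun i hi => if_pos (.inr ⟨i, hi, rfl⟩)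
    refine ⟨fun i A hA => ?_, fun j hj => ?_, fun i i' hi hi' he hd => ?_⟩
    · have hi : δ i ≠ none := by simp [hA]
      rw [hf i hi]
      exact h.sub i A (by rw [← hne i hi, hA])
    · by_cases hc : Disc (γ' j) ∨ ∃ i, δ i ≠ none ∧ r i = j
      · rcases hc with hc | hc
        · exact absurd (by simpa only [f, if_pos (Or.inl hc)] using hc) hj
        · exact hc
      · exact absurd (by simp only [f, if_neg hc, disc_none]) hj
    · rw [hf i hi] at hd
      exact h.uniq i i' (by rwa [← hne i hi]) (by rwa [← hne i' hi']) he hd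
  refine ⟨f γ₁, f γ₂, fun j => ?_, key γ₁ fun i => ?_, key γ₂ fun i => ?_⟩
  · by_cases hj : Disc (γ' j)
    · simp only [f, hj, true_or, if_true]
      exact .inr (.inr ⟨rfl, rfl, hj⟩)
    · obtain ⟨i, hi, rfl⟩ := h.ex j hj
      have hi' : ∀ i', γ i' ≠ none → r i' = r i → i' = i := fun i' h' he =>
        h.uniq i' i h' hi he (by rwa [he])
      have h1 : ∀ {δ : ℕ → Option (Ty At)}, (∀ i, δ i = γ i ∨ δ i = none) → δ i = none →
          f δ (r i) = none := by
        intro δ hδ hn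
        refine if_neg ?_
        rintro (hd | ⟨i', hn', he⟩)
        · exact hj hd
        · have := hi' i' (by rw [← (hδ i').resolve_right hn']; exact hn') he
          exact hn' (this ▸ hn)
      have h2 : ∀ {δ : ℕ → Option (Ty At)}, δ i = γ i → f δ (r i) = γ' (r i) := by
        intro δ he
        exact if_pos (.inr ⟨i, by rwa [he], rfl⟩)
      have g1 : ∀ i, γ₁ i = γ i ∨ γ₁ i = none := fun i => by
        rcases hp i with h | h | h <;> simp [h.1]
      have g2 : ∀ i, γ₂ i = γ i ∨ γ₂ i = none := fun i => by
        rcases hp i with h | h | h <;> simp [h.2]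
      rcases hp i with ⟨a, b⟩ | ⟨a, b⟩ | ⟨a, b, c⟩
      · exact .inl ⟨h2 a, h1 g2 b⟩
      · exact .inr (.inl ⟨h1 g1 a, h2 b⟩)
      -- A shared source declaration is duplicable, hence so is its image, against the choice of
      -- `j`.
      · exact absurd (h.disc hi c) hj
  · rcases hp i with h | h | h <;> simp [h.1]
  · rcases hp i with h | h | h <;> simp [h.2]

/-- Exchange, narrowing of declared types, and weakening and contraction of duplicable declarations,
all at once; the conditions of `Ren` are what the variable rule and the splitting of contexts need.
-/
theorem Typed.rename {S : Signature.{u, v}} {M : Term S} :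
    ∀ {γ γ' : ℕ → Option (Ty S.Atom)} {r : ℕ → ℕ} {T : Ty S.Atom}, Typed M γ T → Ren r γ γ' →
      Typed (M.rename r) γ' T := by
  induction M with
  | var i B =>
      rintro γ γ' r _ ⟨rfl, ⟨A, h, ⟨s⟩⟩, h'⟩ hr
      obtain ⟨A', hA, ⟨s'⟩⟩ := hr.sub i A h
      refine ⟨rfl, ⟨A', hA, s'.trans s⟩, fun j hj => ?_⟩
      by_contra hd
      obtain ⟨i', hi', rfl⟩ := hr.ex j hd
      exact hd (hr.disc hi' (h' i' fun e => hj (by rw [e])))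
  | const c B => rintro γ γ' r _ ⟨rfl, s, h⟩ hr; exact ⟨rfl, s, hr.allDisc h⟩
  | unit n => rintro γ γ' r _ ⟨rfl, h⟩ hr; exact ⟨rfl, hr.allDisc h⟩
  | lam n A M ih =>
      rintro γ γ' r _ ⟨B, rfl, h, h'⟩ hr
      exact ⟨B, rfl, fun hn => hr.allDisc (h hn), ih h' (hr.lift A)⟩
  | app M N ihM ihN =>
      rintro γ γ' r T ⟨γ₁, γ₂, A, hp, hM, hN⟩ hr
      obtain ⟨_, _, hp', h₁, h₂⟩ := hr.parts hp
      exact ⟨_, _, A, hp', ihM hM h₁, ihN hN h₂⟩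
  | pair n M N ihM ihN =>
      rintro γ γ' r _ ⟨γ₁, γ₂, A, B, rfl, hp, hM, hN⟩ hr
      obtain ⟨_, _, hp', h₁, h₂⟩ := hr.parts hp
      exact ⟨_, _, A, B, rfl, hp', ihM hM h₁, ihN hN h₂⟩
  | letpair n A B M N ihM ihN =>
      rintro γ γ' r _ ⟨γ₁, γ₂, hp, hM, hN⟩ hr
      obtain ⟨_, _, hp', h₁, h₂⟩ := hr.parts hp
      exact ⟨_, _, hp', ihM hM h₁, ihN hN ((h₂.lift _).lift _)⟩
  | letunit M N ihM ihN =>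
      rintro γ γ' r _ ⟨γ₁, γ₂, hp, hM, hN⟩ hr
      obtain ⟨_, _, hp', h₁, h₂⟩ := hr.parts hp
      exact ⟨_, _, hp', ihM hM h₁, ihN hN h₂⟩

/-! ### Reassociating splittings, and pulling typing back along injective renamings -/

theorem liftRen_injective {r : ℕ → ℕ} (hr : Function.Injective r) :
    Function.Injective (liftRen r) := by
  rintro (_ | i) (_ | i') h
  · rfl
  · simp [liftRen] at h
  · simp [liftRen] at h
  · simp only [liftRen, Nat.add_right_cancel_iff] at h
    rw [hr h]

theorem scons_comp_liftRen {At : Type u} (a : Option (Ty At)) (γ : ℕ → Option (Ty At))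
    (r : ℕ → ℕ) : scons a γ ∘ liftRen r = scons a (γ ∘ r) := by
  funext i; cases i <;> rfl

theorem Part.disc {At : Type u} {a b c : Option (Ty At)} (h : Part a b c) (hb : Disc b)
    (hc : Disc c) : Disc a := by
  rcases h with ⟨rfl, _⟩ | ⟨_, rfl⟩ | ⟨_, _, h⟩ <;> assumption

theorem Part.symm {At : Type u} {a b c : Option (Ty At)} (h : Part a b c) : Part a c b := by
  rcases h with ⟨h, h'⟩ | ⟨h, h'⟩ | ⟨h, h', h''⟩
  · exact .inr (.inl ⟨h', h⟩)
  · exact .inl ⟨h', h⟩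
  · exact .inr (.inr ⟨h', h, h''⟩)

theorem Parts.symm {At : Type u} {γ γ₁ γ₂ : ℕ → Option (Ty At)} (h : Parts γ γ₁ γ₂) :
    Parts γ γ₂ γ₁ := fun i => (h i).symm

/-- A three-way distribution can be bracketed either way; the commuting conversions of `let` rest on
this. -/
theorem Part.assoc {At : Type u} {a b c b₁ b₂ : Option (Ty At)} (h : Part a b c)
    (h' : Part b b₁ b₂) : ∃ e, Part a b₁ e ∧ Part e b₂ c := by
  rcases h with ⟨rfl, rfl⟩ | ⟨rfl, rfl⟩ | ⟨rfl, rfl, h⟩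
  · exact ⟨b₂, h', .inl ⟨rfl, rfl⟩⟩
  · exact ⟨c, by rcases h' with ⟨rfl, rfl⟩ | ⟨rfl, rfl⟩ | ⟨rfl, rfl, _⟩ <;> simp [Part],
      by rcases h' with ⟨rfl, rfl⟩ | ⟨rfl, rfl⟩ | ⟨rfl, rfl, _⟩ <;> simp [Part]⟩
  · refine ⟨c, ?_, ?_⟩ <;> rcases h' with ⟨rfl, rfl⟩ | ⟨rfl, rfl⟩ | ⟨rfl, rfl, _⟩ <;>
      simp [Part, h]

theorem Parts.assoc {At : Type u} {γ γ₁ γ₂ δ₁ δ₂ : ℕ → Option (Ty At)} (h : Parts γ γ₁ γ₂)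
    (h' : Parts γ₁ δ₁ δ₂) : ∃ ε, Parts γ δ₁ ε ∧ Parts ε δ₂ γ₂ := by
  choose ε h₁ h₂ using fun i => (h i).assoc (h' i)
  exact ⟨ε, h₁, h₂⟩

/-- Indices outside the image of `r` do not occur in the renamed term, so the typing rules leave
them unused and their declarations must be discardable. -/
theorem Typed.unrename {S : Signature.{u, v}} {M : Term S} :
    ∀ {γ : ℕ → Option (Ty S.Atom)} {r : ℕ → ℕ} {T : Ty S.Atom}, Function.Injective r →
      Typed (M.rename r) γ T → Typed M (γ ∘ r) T ∧ ∀ j, (∀ i, r i ≠ j) → Disc (γ j) := by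
  induction M with
  | var i B =>
      rintro γ r _ hr ⟨rfl, ⟨A, h, s⟩, h'⟩
      exact ⟨⟨rfl, ⟨A, h, s⟩, fun j hj => h' _ fun e => hj (hr e)⟩,
        fun j hj => h' j fun e => hj i e.symm⟩
  | const c B =>
      rintro γ r _ hr ⟨rfl, s, h⟩; exact ⟨⟨rfl, s, fun j => h _⟩, fun j _ => h j⟩
  | unit n => rintro γ r _ hr ⟨rfl, h⟩; exact ⟨⟨rfl, fun j => h _⟩, fun j _ => h j⟩
  | lam n A M ih =>
      rintro γ r _ hr ⟨B, rfl, h, h'⟩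
      obtain ⟨h₁, h₂⟩ := ih (liftRen_injective hr) h'
      rw [scons_comp_liftRen] at h₁
      refine ⟨⟨B, rfl, fun hn j => h hn _, h₁⟩, fun j hj => h₂ (j + 1) ?_⟩
      rintro (_ | i) <;> simp [liftRen, hj]
  | app M N ihM ihN =>
      rintro γ r T hr ⟨γ₁, γ₂, A, hp, hM, hN⟩
      obtain ⟨a, a'⟩ := ihM hr hM
      obtain ⟨b, b'⟩ := ihN hr hN
      exact ⟨⟨_, _, A, fun i => hp _, a, b⟩, fun j hj => (hp j).disc (a' j hj) (b' j hj)⟩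
  | pair n M N ihM ihN =>
      rintro γ r _ hr ⟨γ₁, γ₂, A, B, rfl, hp, hM, hN⟩
      obtain ⟨a, a'⟩ := ihM hr hM
      obtain ⟨b, b'⟩ := ihN hr hN
      exact ⟨⟨_, _, A, B, rfl, fun i => hp _, a, b⟩, fun j hj => (hp j).disc (a' j hj) (b' j hj)⟩
  | letpair n A B M N ihM ihN =>
      rintro γ r _ hr ⟨γ₁, γ₂, hp, hM, hN⟩
      obtain ⟨a, a'⟩ := ihM hr hM
      obtain ⟨b, b'⟩ := ihN (liftRen_injective (liftRen_injective hr)) hN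
      rw [scons_comp_liftRen, scons_comp_liftRen] at b
      refine ⟨⟨_, _, fun i => hp _, a, b⟩, fun j hj => (hp j).disc (a' j hj) (b' (j + 2) ?_)⟩
      rintro (_ | _ | i) <;> simp [liftRen, hj]
  | letunit M N ihM ihN =>
      rintro γ r _ hr ⟨γ₁, γ₂, hp, hM, hN⟩
      obtain ⟨a, a'⟩ := ihM hr hM
      obtain ⟨b, b'⟩ := ihN hr hN
      exact ⟨⟨_, _, fun i => hp _, a, b⟩, fun j hj => (hp j).disc (a' j hj) (b' j hj)⟩

/-! ### Renaming and inferred types -/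

theorem liftRen_comp (r r' : ℕ → ℕ) : (fun i => liftRen r' (liftRen r i)) =
    liftRen (fun i => r' (r i)) := by
  funext i; cases i <;> rfl

theorem Term.rename_rename {S : Signature.{u, v}} (M : Term S) :
    ∀ r r' : ℕ → ℕ, (M.rename r).rename r' = M.rename (fun i => r' (r i)) := by
  induction M <;> intro r r' <;> simp_all [Term.rename, liftRen_comp]

@[simp] theorem Term.infer_rename {S : Signature.{u, v}} (M : Term S) :
    ∀ r : ℕ → ℕ, (M.rename r).infer = M.infer := by
  induction M <;> intro r <;> simp_all [Term.rename, Term.infer]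

theorem Term.promote_rename {S : Signature.{u, v}} {V : Term S} (hV : IsValue V) :
    ∀ r : ℕ → ℕ, (V.rename r).promote = V.promote.rename r := by
  induction hV <;> intro r <;> simp_all [Term.rename, Term.promote]

theorem Ty.unbangs_bangs {At : Type u} (n : ℕ) (A : Ty At) : Ty.unbangs n (Ty.bangs n A) = A := by
  induction n with
  | zero => cases A <;> rfl
  | succ n ih => simpa [Ty.bangs, Ty.unbangs] using ih

theorem Typed.infer_eq {S : Signature.{u, v}} {M : Term S} :
    ∀ {γ : ℕ → Option (Ty S.Atom)} {T : Ty S.Atom}, Typed M γ T → M.infer = T := by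
  induction M with
  | var i B => rintro γ _ ⟨rfl, _⟩; rfl
  | const c B => rintro γ _ ⟨rfl, _⟩; rfl
  | unit n => rintro γ _ ⟨rfl, _⟩; rfl
  | lam n A M ih => rintro γ _ ⟨B, rfl, _, h⟩; rw [Term.infer, ih h]
  | app M N ihM ihN => rintro γ T ⟨γ₁, γ₂, A, _, h, _⟩; rw [Term.infer, ihM h]; rfl
  | pair n M N ihM ihN =>
      rintro γ _ ⟨γ₁, γ₂, A, B, rfl, _, h, h'⟩
      rw [Term.infer, ihM h, ihN h', Ty.unbangs_bangs, Ty.unbangs_bangs]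
  | letpair n A B M N ihM ihN => rintro γ T ⟨γ₁, γ₂, _, _, h⟩; rw [Term.infer, ihN h]
  | letunit M N ihM ihN => rintro γ T ⟨γ₁, γ₂, _, _, h⟩; rw [Term.infer, ihN h]

/-! ### Re-indexing a term at a supertype preserves typing -/

theorem Term.castTo_self {S : Signature.{u, v}} {M : Term S} :
    ∀ {γ : ℕ → Option (Ty S.Atom)} {T : Ty S.Atom}, Typed M γ T → M.castTo T = M := by
  induction M with
  | var i B => rintro γ _ ⟨rfl, _⟩; rfl
  | const c B => rintro γ _ ⟨rfl, _⟩; rfl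
  | unit n => rintro γ _ ⟨rfl, _⟩; simp [Term.castTo, Ty.nb_bangs, Ty.nb]
  | lam n A M ih =>
      rintro γ _ ⟨B, rfl, _, h⟩
      simp [Term.castTo, Ty.nb_bangs, Ty.nb, Ty.core_bangs, Ty.core, ih h]
  | app M N ihM ihN =>
      rintro γ T ⟨γ₁, γ₂, A, _, h, _⟩
      rw [Term.castTo, h.infer_eq, Ty.dom, ihM h]
  | pair n M N ihM ihN =>
      rintro γ _ ⟨γ₁, γ₂, A, B, rfl, _, h, h'⟩
      simp [Term.castTo, Ty.nb_bangs, Ty.nb, Ty.core_bangs, Ty.core, ihM h, ihN h']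
  | letpair n A B M N ihM ihN => rintro γ T ⟨γ₁, γ₂, _, _, h⟩; rw [Term.castTo, ihN h]
  | letunit M N ihM ihN => rintro γ T ⟨γ₁, γ₂, _, _, h⟩; rw [Term.castTo, ihN h]

theorem Ren.ofCtxSub {At : Type u} {A A' : Ty At} (s : Sub A' A) (γ : ℕ → Option (Ty At)) :
    Ren (fun i => i) (scons (some A) γ) (scons (some A') γ) where
  sub := by
    rintro (_ | i) B hB
    · obtain rfl : A = B := by simpa using hB
      exact ⟨A', rfl, ⟨s⟩⟩
    · exact ⟨B, hB, Sub.refl _⟩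
  ex := by
    rintro (_ | i) hi
    · exact ⟨0, by simp, rfl⟩
    · refine ⟨i + 1, ?_, rfl⟩
      intro h
      rw [scons_succ] at hi h
      simp [h] at hi
  uniq := fun i i' _ _ h _ => h

theorem Sub.bangs_of {At : Type u} {A B : Ty At} (s : Sub A B) {n m : ℕ} (h : m = 0 ∨ 1 ≤ n) :
    Nonempty (Sub (Ty.bangs n A) (Ty.bangs m B)) := by
  obtain ⟨h1, h2⟩ := s.inv
  refine Sub.of_inv ?_ (by simpa only [Ty.core_bangs] using h2)
  rw [Ty.nb_bangs, Ty.nb_bangs]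
  omega

theorem Typed.castTo {S : Signature.{u, v}} {M : Term S} :
    ∀ {γ : ℕ → Option (Ty S.Atom)} {T T' : Ty S.Atom}, Typed M γ T → Nonempty (Sub T T') →
      Typed (M.castTo T') γ T' := by
  induction M with
  | var i B => rintro γ _ T' ⟨rfl, ⟨A, h, ⟨s⟩⟩, h'⟩ ⟨t⟩; exact ⟨rfl, ⟨A, h, s.trans t⟩, h'⟩
  | const c B => rintro γ _ T' ⟨rfl, ⟨s⟩, h'⟩ ⟨t⟩; exact ⟨rfl, s.trans t, h'⟩
  | unit n =>
      rintro γ _ T' ⟨rfl, h⟩ ⟨t⟩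
      obtain ⟨h1, h2⟩ := t.inv
      simp only [Ty.core_bangs, Ty.core, reduceCtorEq, false_and, exists_false, false_or,
        true_and, or_false] at h2
      exact ⟨by rw [← h2, Ty.bangs_core], h⟩
  | lam n A M ih =>
      rintro γ _ T' ⟨B, rfl, h, h'⟩ ⟨t⟩
      obtain ⟨h1, h2⟩ := t.inv
      simp only [Ty.core_bangs, Ty.core, reduceCtorEq, false_and, exists_false, false_or,
        or_false, Ty.lolli.injEq] at h2
      obtain ⟨P, P', Q, Q', ⟨rfl, rfl⟩, hz, ⟨s'⟩, t'⟩ := h2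
      simp only [Term.castTo, hz]
      refine ⟨Q', by rw [← hz, Ty.bangs_core], fun hn => h ?_, ?_⟩
      · simp only [Ty.nb_bangs, Ty.nb] at h1
        omega
      -- The cast replaces the annotation of the bound variable by a subtype, so the body is retyped
      -- under a narrower declaration.
      · have := (ih h' t').rename (Ren.ofCtxSub s' γ)
        rwa [Term.rename_id] at this
  | app M N ihM ihN =>
      rintro γ T T' ⟨γ₁, γ₂, A, hp, h, h'⟩ ⟨t⟩
      refine ⟨γ₁, γ₂, A, hp, ?_, h'⟩
      rw [h.infer_eq]
      exact ihM h ⟨.lolli 0 0 (.inl rfl) (Sub.refl _).some t⟩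
  | pair n M N ihM ihN =>
      rintro γ _ T' ⟨γ₁, γ₂, A, B, rfl, hp, h, h'⟩ ⟨t⟩
      obtain ⟨h1, h2⟩ := t.inv
      simp only [Ty.core_bangs, Ty.core, reduceCtorEq, false_and, exists_false, false_or,
        Ty.tensor.injEq] at h2
      obtain ⟨P, P', Q, Q', ⟨rfl, rfl⟩, hz, ⟨s'⟩, ⟨t'⟩⟩ := h2
      simp only [Term.castTo, hz]
      simp only [Ty.nb_bangs, Ty.nb] at h1
      have h3 : T'.nb = 0 ∨ 1 ≤ n := by omega
      exact ⟨γ₁, γ₂, P', Q', by rw [← hz, Ty.bangs_core], hp, ihM h (s'.bangs_of h3),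
        ihN h' (t'.bangs_of h3)⟩
  | letpair n A B M N ihM ihN =>
      rintro γ T T' ⟨γ₁, γ₂, hp, h, h'⟩ t; exact ⟨γ₁, γ₂, hp, h, ihN h' t⟩
  | letunit M N ihM ihN =>
      rintro γ T T' ⟨γ₁, γ₂, hp, h, h'⟩ t; exact ⟨γ₁, γ₂, hp, h, ihN h' t⟩

/-! ### The typing rule of `let p = M in N` -/

/-- The type matched by a placeholder. -/
def Pat.ty {At : Type u} : Pat At → Ty At
  | .var A => A
  | .unit => .one
  | .pair n A B => Ty.bangs n (.tensor A B)

/-- Extend a context by the variables of a placeholder. -/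
def Pat.ext {At : Type u} : Pat At → (ℕ → Option (Ty At)) → ℕ → Option (Ty At)
  | .var A, γ => scons (some A) γ
  | .unit, γ => γ
  | .pair n A B, γ => scons (some (Ty.bangs n B)) (scons (some (Ty.bangs n A)) γ)

/-- Extend a context by `k` undeclared variables. -/
def pad {At : Type u} (k : ℕ) (γ : ℕ → Option (Ty At)) (i : ℕ) : Option (Ty At) :=
  if i < k then none else γ (i - k)

@[simp] theorem Pat.ext_add {At : Type u} (p : Pat At) (γ : ℕ → Option (Ty At)) (i : ℕ) :
    p.ext γ (i + p.arity) = γ i := by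
  cases p <;> rfl

theorem Pat.ext_lt {At : Type u} (p : Pat At) {i : ℕ} (hi : i < p.arity) :
    ∃ A, ∀ γ : ℕ → Option (Ty At), p.ext γ i = some A := by
  cases p with
  | var A =>
      simp only [Pat.arity, Nat.lt_one_iff] at hi
      subst hi
      exact ⟨A, fun _ => rfl⟩
  | unit => simp [Pat.arity] at hi
  | pair n A B =>
      rcases i with _ | _ | i
      · exact ⟨_, fun _ => rfl⟩
      · exact ⟨_, fun _ => rfl⟩
      · simp [Pat.arity] at hi

theorem Pat.lt_or_add {At : Type u} (p : Pat At) (i : ℕ) :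
    i < p.arity ∨ ∃ j, i = j + p.arity := by
  by_cases h : i < p.arity
  · exact .inl h
  · exact .inr ⟨i - p.arity, by omega⟩

@[simp] theorem pad_add {At : Type u} (k : ℕ) (γ : ℕ → Option (Ty At)) (i : ℕ) :
    pad k γ (i + k) = γ i := by
  simp [pad]

theorem pad_lt {At : Type u} {k i : ℕ} (γ : ℕ → Option (Ty At)) (h : i < k) :
    pad k γ i = none := by
  simp [pad, h]

/-- A single rule covers the three placeholders. For a variable the two shares are exchanged,
because `letIn` is an application whose function part contains the body. -/
theorem typed_letP {S : Signature.{u, v}} {p : Pat S.Atom} {M N : Term S}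
    {γ : ℕ → Option (Ty S.Atom)} {T : Ty S.Atom} : Typed (.letP p M N) γ T ↔
      ∃ γ₁ γ₂, Parts γ γ₁ γ₂ ∧ Typed M γ₁ p.ty ∧ Typed N (p.ext γ₂) T := by
  cases p with
  | var A =>
      constructor
      · rintro ⟨γ₁, γ₂, A', hp, ⟨B, hB, _, h⟩, h'⟩
        cases hB
        exact ⟨γ₂, γ₁, hp.symm, h', h⟩
      · rintro ⟨γ₁, γ₂, hp, h, h'⟩
        exact ⟨γ₂, γ₁, A, hp.symm, ⟨T, rfl, by simp, h'⟩, h⟩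
  | unit => exact Iff.rfl
  | pair n A B => exact Iff.rfl

theorem Ren.liftN {At : Type u} {r : ℕ → ℕ} {γ γ' : ℕ → Option (Ty At)} (h : Ren r γ γ')
    (p : Pat At) : Ren (liftRenN p.arity r) (p.ext γ) (p.ext γ') := by
  cases p with
  | var A => exact h.lift A
  | unit => exact h
  | pair n A B => exact (h.lift _).lift _

theorem Ren.pad {At : Type u} (k : ℕ) (γ : ℕ → Option (Ty At)) :
    Ren (fun i => i + k) γ (LinLam.pad k γ) where
  sub i A h := ⟨A, by simp [h], Sub.refl _⟩
  ex j hj := by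
    by_cases h : j < k
    · simp [pad_lt γ h] at hj
    · obtain ⟨i, rfl⟩ : ∃ i, j = i + k := ⟨j - k, by omega⟩
      rw [pad_add] at hj
      exact ⟨i, fun h => by simp [h] at hj, rfl⟩
  uniq i i' _ _ h _ := by simpa using h

theorem Parts.ext_left {At : Type u} {γ γ₁ γ₂ : ℕ → Option (Ty At)} (h : Parts γ γ₁ γ₂)
    (p : Pat At) : Parts (p.ext γ) (p.ext γ₁) (pad p.arity γ₂) := by
  intro i
  rcases p.lt_or_add i with hi | ⟨j, rfl⟩
  · obtain ⟨A, hA⟩ := p.ext_lt hi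
    exact .inl ⟨by rw [hA, hA], pad_lt _ hi⟩
  · simpa using h j

theorem liftRenN_lt {k : ℕ} : ∀ {i : ℕ} (r : ℕ → ℕ), i < k → liftRenN k r i = i := by
  induction k with
  | zero => intro i r h; omega
  | succ k ih =>
      intro i r h
      have : liftRenN (k + 1) r = liftRen (liftRenN k r) := Function.iterate_succ_apply' _ _ _
      rw [this]
      cases i with
      | zero => rfl
      | succ i => rw [liftRen, ih r (by omega)]

theorem liftRenN_add (k : ℕ) (r : ℕ → ℕ) (i : ℕ) : liftRenN k r (i + k) = r i + k := by
  induction k with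
  | zero => rfl
  | succ k ih =>
      have : liftRenN (k + 1) r = liftRen (liftRenN k r) := Function.iterate_succ_apply' _ _ _
      rw [this, ← Nat.add_assoc, liftRen, ih]
      omega

theorem liftRenN_injective (k : ℕ) {r : ℕ → ℕ} (hr : Function.Injective r) :
    Function.Injective (liftRenN k r) := by
  induction k with
  | zero => exact hr
  | succ k ih =>
      have : liftRenN (k + 1) r = liftRen (liftRenN k r) := Function.iterate_succ_apply' _ _ _
      rw [this]
      exact liftRen_injective ih

theorem Pat.ext_comp {At : Type u} (p : Pat At) (γ : ℕ → Option (Ty At)) (r : ℕ → ℕ) :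
    p.ext γ ∘ liftRenN p.arity r = p.ext (γ ∘ r) := by
  funext i
  rcases p.lt_or_add i with hi | ⟨j, rfl⟩
  · obtain ⟨A, hA⟩ := p.ext_lt hi
    rw [Function.comp, liftRenN_lt r hi, hA, hA]
  · rw [Function.comp, liftRenN_add, Pat.ext_add, Pat.ext_add, Function.comp]

theorem Typed.unlift {S : Signature.{u, v}} {p : Pat S.Atom} {k : ℕ} {P : Term S}
    {γ : ℕ → Option (Ty S.Atom)} {T : Ty S.Atom}
    (h : Typed (P.rename (liftRenN p.arity fun i => i + k)) (p.ext γ) T) :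
    Typed P (p.ext fun i => γ (i + k)) T ∧ ∀ i < k, Disc (γ i) := by
  obtain ⟨h₁, h₂⟩ := h.unrename (liftRenN_injective _ fun i j h => by simpa using h)
  rw [Pat.ext_comp] at h₁
  refine ⟨h₁, fun i hi => ?_⟩
  have := h₂ (i + p.arity) fun j hj => ?_
  · simpa using this
  · rcases p.lt_or_add j with hj' | ⟨j, rfl⟩
    · rw [liftRenN_lt _ hj'] at hj; omega
    · rw [liftRenN_add] at hj; omega

theorem Typed.unshift {S : Signature.{u, v}} {k : ℕ} {P : Term S}
    {γ : ℕ → Option (Ty S.Atom)} {T : Ty S.Atom} (h : Typed (P.shift k) γ T) :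
    Typed P (fun i => γ (i + k)) T ∧ ∀ i < k, Disc (γ i) :=
  Typed.unlift (p := .unit) h

/-- A part of an extended context where the variables of the placeholder are either declared or
duplicable is as good as an extended context. -/
theorem Ren.absorb {At : Type u} {p : Pat At} {γ γ₁ γ₂ : ℕ → Option (Ty At)}
    (h : Parts (p.ext γ) γ₁ γ₂) (hd : ∀ i < p.arity, Disc (γ₂ i)) :
    Ren (fun i => i) γ₁ (p.ext fun i => γ₁ (i + p.arity)) where
  sub i A hA := by
    refine ⟨A, ?_, Sub.refl _⟩
    rcases p.lt_or_add i with hi | ⟨j, rfl⟩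
    · obtain ⟨B, hB⟩ := p.ext_lt hi
      have := h i
      rw [hB] at this ⊢
      rcases this with ⟨a, _⟩ | ⟨a, _⟩ | ⟨a, _⟩
      · rw [← a, hA]
      · simp [a] at hA
      · rw [← a, hA]
    · simpa using hA
  ex j hj := by
    refine ⟨j, fun hn => hj ?_, rfl⟩
    rcases p.lt_or_add j with hi | ⟨j, rfl⟩
    · obtain ⟨B, hB⟩ := p.ext_lt hi
      have := h j
      rw [hB] at this ⊢
      exact this.disc (by simp [hn]) (hd j hi)
    · simp [hn]
  uniq _ _ _ _ h _ := h

/-- When the other share of a splitting has only discardable declarations for the variables of the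
placeholder, all these variables can be handed to `N`, however the splitting distributed them. -/
theorem Typed.absorb {S : Signature.{u, v}} {p : Pat S.Atom} {N : Term S}
    {γ γ₁ γ₂ : ℕ → Option (Ty S.Atom)} {T : Ty S.Atom} (h : Typed N γ₁ T)
    (hp : Parts (p.ext γ) γ₁ γ₂) (hd : ∀ i < p.arity, Disc (γ₂ i)) :
    Typed N (p.ext fun i => γ₁ (i + p.arity)) T := by
  have := h.rename (Ren.absorb hp hd)
  rwa [Term.rename_id] at this

theorem Parts.tail {At : Type u} {p : Pat At} {γ γ₁ γ₂ : ℕ → Option (Ty At)}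
    (h : Parts (p.ext γ) γ₁ γ₂) :
    Parts γ (fun i => γ₁ (i + p.arity)) (fun i => γ₂ (i + p.arity)) := by
  intro i
  simpa using h (i + p.arity)

theorem swapRen_swapRen (a b i : ℕ) : swapRen b a (swapRen a b i) = i := by
  simp only [swapRen]
  split_ifs <;> omega

theorem Pat.ext_swap {At : Type u} (p q : Pat At) (γ : ℕ → Option (Ty At)) (i : ℕ) :
    p.ext (q.ext γ) (swapRen q.arity p.arity i) = q.ext (p.ext γ) i := by
  rcases q.lt_or_add i with hi | ⟨j, rfl⟩
  · obtain ⟨A, hA⟩ := q.ext_lt hi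
    rw [hA, swapRen, if_pos hi, Pat.ext_add, hA]
  · rcases p.lt_or_add j with hj | ⟨k, rfl⟩
    · obtain ⟨A, hA⟩ := p.ext_lt hj
      rw [swapRen, if_neg (by omega), if_pos (by omega), Nat.add_sub_cancel, Pat.ext_add, hA, hA]
    · rw [swapRen, if_neg (by omega), if_neg (by omega), Pat.ext_add, Pat.ext_add,
        Nat.add_right_comm, Pat.ext_add, Pat.ext_add]

theorem Ren.swap {At : Type u} (p q : Pat At) (γ : ℕ → Option (Ty At)) :
    Ren (swapRen q.arity p.arity) (q.ext (p.ext γ)) (p.ext (q.ext γ)) where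
  sub i A h := ⟨A, by rw [Pat.ext_swap, h], Sub.refl _⟩
  ex j hj := by
    refine ⟨swapRen p.arity q.arity j, fun h => hj ?_, swapRen_swapRen _ _ _⟩
    rw [← Pat.ext_swap, swapRen_swapRen] at h
    simp [h]
  uniq i i' _ _ h _ := by
    rw [← swapRen_swapRen q.arity p.arity i, h, swapRen_swapRen]

/-- Both sides distribute the context to `M`, `N` and `P`, with different bracketings. From right to
left, the renamed `P` cannot use the variables of `q`, so `N` absorbs them. -/
theorem Typed.let_let {S : Signature.{u, v}} {p q : Pat S.Atom} {M N P : Term S}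
    {γ : ℕ → Option (Ty S.Atom)} {T : Ty S.Atom} :
    Typed (.letP p (.letP q M N) P) γ T ↔
      Typed (.letP q M (.letP p N (P.rename (liftRenN p.arity (fun i => i + q.arity))))) γ T := by
  simp only [typed_letP]
  constructor
  · rintro ⟨γ₁, γ₂, hp, ⟨δ₁, δ₂, hp', hM, hN⟩, hP⟩
    obtain ⟨ε, h₁, h₂⟩ := hp.assoc hp'
    exact ⟨δ₁, ε, h₁, hM, _, _, h₂.ext_left q, hN, hP.rename ((Ren.pad _ _).liftN p)⟩
  · rintro ⟨γ₁, γ₂, hp, hM, ε₁, ε₂, hp', hN, hP⟩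
    obtain ⟨hP', hd⟩ := hP.unlift
    obtain ⟨ξ, h₁, h₂⟩ := hp.symm.assoc hp'.tail.symm
    exact ⟨ξ, _, h₁.symm, ⟨_, _, h₂.symm, hM, hN.absorb hp' hd⟩, hP'⟩

/-- The shifted `W` cannot use the variables of `p`, so these are all absorbed by `M`, and the
shares of `V` and `W` can then be regrouped. Typing does not need the two terms to be values. -/
theorem Typed.let_comm {S : Signature.{u, v}} {p q : Pat S.Atom} {V W M : Term S}
    {γ : ℕ → Option (Ty S.Atom)} {T : Ty S.Atom}
    (h : Typed (.letP p V (.letP q (W.shift p.arity) M)) γ T) :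
    Typed (.letP q W (.letP p (V.shift q.arity) (M.rename (swapRen q.arity p.arity)))) γ T := by
  simp only [typed_letP] at h ⊢
  obtain ⟨γ₁, γ₂, hp, hV, ε₁, ε₂, hp', hW, hM⟩ := h
  obtain ⟨hW', hd⟩ := hW.unshift
  obtain ⟨ξ, h₁, h₂⟩ := hp.symm.assoc hp'.tail
  refine ⟨_, ξ, h₁, hW', _, _, (h₂.ext_left q).symm, hV.rename (Ren.pad _ _), ?_⟩
  have hM' := hM.rename ((Ren.absorb hp'.symm hd).liftN q)
  have he : liftRenN q.arity (fun i => i) = fun i => i := by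
    funext i
    rcases q.lt_or_add i with hi | ⟨j, rfl⟩
    · rw [liftRenN_lt _ hi]
    · rw [liftRenN_add]
  rw [he, Term.rename_id] at hM'
  exact hM'.rename (Ren.swap p q _)

/-! ### Equational reasoning on terms with implicit contexts -/

theorem Eqax.valids {S : Signature.{u, v}} {Γ : Ctx S.Atom} {M M' : Term S} {A : Ty S.Atom}
    (h : Eqax Γ M M' A) : Valid Γ M A ∧ Valid Γ M' A := by
  induction h with
  | ax h hM hM' => exact ⟨hM, hM'⟩
  | refl hM => exact ⟨hM, hM⟩
  | symm h ih => exact ih.symm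
  | trans h h' ih ih' => exact ⟨ih.1, ih'.2⟩
  | app sp h h' ih ih' => exact ⟨⟨.app sp ih.1.some ih'.1.some⟩, ⟨.app sp ih.2.some ih'.2.some⟩⟩
  | lam1 h ih => exact ⟨⟨.lam1 ih.1.some⟩, ⟨.lam1 ih.2.some⟩⟩
  | lam2 n b h ih => exact ⟨⟨.lam2 n b ih.1.some⟩, ⟨.lam2 n b ih.2.some⟩⟩
  | pair n sp h h' ih ih' =>
      exact ⟨⟨.tensorI n sp ih.1.some ih'.1.some⟩, ⟨.tensorI n sp ih.2.some ih'.2.some⟩⟩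
  | letunit sp h h' ih ih' =>
      exact ⟨⟨.oneE sp ih.1.some ih'.1.some⟩, ⟨.oneE sp ih.2.some ih'.2.some⟩⟩
  | letpair n sp h h' ih ih' =>
      exact ⟨⟨.tensorE n sp ih.1.some ih'.1.some⟩, ⟨.tensorE n sp ih.2.some ih'.2.some⟩⟩

/-- In all contexts where `M` is typable, `N` is typable with the same type and axiomatically
equivalent to `M`. -/
def Red {S : Signature.{u, v}} (M N : Term S) : Prop :=
  ∀ ⦃Γ : Ctx S.Atom⦄ ⦃T : Ty S.Atom⦄, Valid Γ M T → Eqax Γ M N T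

local infix:50 " ⇛ " => Red

namespace Red

variable {S : Signature.{u, v}}

@[refl] theorem refl (M : Term S) : M ⇛ M := fun _ _ h => .refl h

theorem of_eq {M N : Term S} (h : M = N) : M ⇛ N := h ▸ refl M

@[trans] theorem trans {M N P : Term S} (h : M ⇛ N) (h' : N ⇛ P) : M ⇛ P :=
  fun _ _ hM => (h hM).trans (h' (h hM).valids.2)

/-- An axiom becomes a rewriting step in a direction that preserves typing. The two directions need
separate proofs: for instance, β can erase a value that is not typable. -/
theorem of_axm {M N : Term S} (h : Axm M N) (ht : ∀ γ T, Typed M γ T → Typed N γ T) : M ⇛ N :=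
  fun _ _ hM => .ax h hM (ht _ _ hM.typed).valid

theorem of_axm_symm {M N : Term S} (h : Axm N M) (ht : ∀ γ T, Typed M γ T → Typed N γ T) :
    M ⇛ N :=
  fun _ _ hM => (Eqax.ax h (ht _ _ hM.typed).valid hM).symm

theorem of_symm {M N : Term S} (h : N ⇛ M) (ht : ∀ γ T, Typed M γ T → Typed N γ T) : M ⇛ N :=
  fun _ _ hM => (h (ht _ _ hM.typed).valid).symm

/-- Lets a rewriting proof use the types found by inverting a typing of its left side, typically to
identify annotations. -/
theorem of_typed {M N : Term S} (h : ∀ γ T, Typed M γ T → M ⇛ N) : M ⇛ N :=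
  fun _ _ hM => h _ _ hM.typed hM

@[gcongr] theorem app {M M' N N' : Term S} (h : M ⇛ M') (h' : N ⇛ N') :
    .app M N ⇛ .app M' N' := by
  rintro Γ T ⟨d⟩
  cases d with
  | app sp d e => exact .app sp (h ⟨d⟩) (h' ⟨e⟩)

@[gcongr] theorem lam {M M' : Term S} (n : ℕ) (A : Ty S.Atom) (h : M ⇛ M') :
    .lam n A M ⇛ .lam n A M' := by
  rintro Γ T ⟨d⟩
  cases d with
  | lam1 d => exact .lam1 (h ⟨d⟩)
  | lam2 n b d => exact .lam2 n b (h ⟨d⟩)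

@[gcongr] theorem pair {M M' N N' : Term S} (n : ℕ) (h : M ⇛ M') (h' : N ⇛ N') :
    .pair n M N ⇛ .pair n M' N' := by
  rintro Γ T ⟨d⟩
  cases d with
  | tensorI _ sp d e => exact .pair n sp (h ⟨d⟩) (h' ⟨e⟩)

@[gcongr] theorem letunit {M M' N N' : Term S} (h : M ⇛ M') (h' : N ⇛ N') :
    .letunit M N ⇛ .letunit M' N' := by
  rintro Γ T ⟨d⟩
  cases d with
  | oneE sp d e => exact .letunit sp (h ⟨d⟩) (h' ⟨e⟩)

@[gcongr] theorem letpair {M M' N N' : Term S} (n : ℕ) (A B : Ty S.Atom) (h : M ⇛ M')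
    (h' : N ⇛ N') : .letpair n A B M N ⇛ .letpair n A B M' N' := by
  rintro Γ T ⟨d⟩
  cases d with
  | tensorE _ sp d e => exact .letpair n sp (h ⟨d⟩) (h' ⟨e⟩)

theorem letIn {M M' N N' : Term S} (A : Ty S.Atom) (h : M ⇛ M') (h' : N ⇛ N') :
    .letIn A M N ⇛ .letIn A M' N' :=
  app (lam 0 A h') h

@[gcongr] theorem letP {M M' N N' : Term S} (p : Pat S.Atom) (h : M ⇛ M') (h' : N ⇛ N') :
    .letP p M N ⇛ .letP p M' N' := by
  cases p with
  | var A => exact letIn A h h'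
  | unit => exact letunit h h'
  | pair n A B => exact letpair n A B h h'

/-! Rules for `let`. -/

theorem let_let (p q : Pat S.Atom) (M N P : Term S) : .letP p (.letP q M N) P ⇛
    .letP q M (.letP p N (P.rename (liftRenN p.arity (fun i => i + q.arity)))) :=
  of_axm (.let_let p q M N P) fun _ _ => Typed.let_let.1

theorem let_let_symm (p q : Pat S.Atom) (M N P : Term S) :
    .letP q M (.letP p N (P.rename (liftRenN p.arity (fun i => i + q.arity)))) ⇛
      .letP p (.letP q M N) P :=
  of_axm_symm (.let_let p q M N P) fun _ _ => Typed.let_let.2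

theorem let_comm (p q : Pat S.Atom) {V W : Term S} (M : Term S) (hV : IsValue V)
    (hW : IsValue W) : .letP p V (.letP q (W.shift p.arity) M) ⇛
      .letP q W (.letP p (V.shift q.arity) (M.rename (swapRen q.arity p.arity))) :=
  of_axm (.let_comm p q M hV hW) fun _ _ => Typed.let_comm

/-- The body uses nothing but the bound variable, so the rest of its share of the context is
discardable and can be given to `N`. -/
theorem let_var (A : Ty S.Atom) (N : Term S) : .letIn A N (.var 0 A) ⇛ N := by
  refine of_axm (.let_var A N) ?_
  rintro γ T ⟨γ₁, γ₂, A', hp, ⟨B, hB, _, ⟨rfl, _, h⟩⟩, h'⟩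
  cases hB
  have := h'.rename (r := fun i => i) (γ' := γ) ⟨fun i A hA => ?_, fun j hj => ⟨j, ?_, rfl⟩,
    fun _ _ _ _ h _ => h⟩
  · rwa [Term.rename_id] at this
  · refine ⟨A, ?_, Sub.refl _⟩
    rcases hp i with ⟨_, b⟩ | ⟨_, b⟩ | ⟨_, b, _⟩
    · simp [b] at hA
    · exact b ▸ hA
    · exact b ▸ hA
  · intro hn
    have := h (j + 1) (by omega)
    exact hj ((hp j).disc (by simpa using this) (by simp [hn]))

theorem let_var_symm (N : Term S) : N ⇛ .letIn N.infer N (.var 0 N.infer) := by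
  refine of_axm_symm (.let_var _ N) fun γ T h => ?_
  rw [h.infer_eq]
  refine ⟨fun _ => none, γ, T, fun i => .inr (.inl ⟨rfl, rfl⟩), ⟨T, rfl, by simp, rfl,
    ⟨T, rfl, Sub.refl _⟩, ?_⟩, h⟩
  rintro (_ | j) hj
  · exact absurd rfl hj
  · simp

/-- `let x = M in let p = x in P` is `let p = M in P`. -/
theorem letP_var (p : Pat S.Atom) (M P : Term S) :
    .letIn p.ty M (.letP p (.var 0 p.ty) (P.rename (liftRenN p.arity (fun i => i + 1)))) ⇛
      .letP p M P :=
  (let_let_symm p (.var p.ty) M (.var 0 p.ty) P).trans (letP p (let_var _ _) (refl _))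

theorem letP_var_symm (p : Pat S.Atom) (M P : Term S) : .letP p M P ⇛
    .letIn p.ty M (.letP p (.var 0 p.ty) (P.rename (liftRenN p.arity (fun i => i + 1)))) := by
  refine of_typed fun γ T h => ?_
  obtain ⟨_, _, _, h, _⟩ := typed_letP.1 h
  have := let_var_symm M
  rw [h.infer_eq] at this
  exact (letP p this (refl _)).trans (let_let p (.var p.ty) M (.var 0 p.ty) P)

end Red

/-- The term formers whose two arguments are evaluated from left to right: application and
pairing. -/
inductive Binary (S : Signature.{u, v}) : Type
  | app
  | pair (n : ℕ)

/-- The application `M N`, or the pair `⟨M, N⟩ⁿ`. -/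
def Binary.tm {S : Signature.{u, v}} : Binary S → Term S → Term S → Term S
  | .app, M, N => .app M N
  | .pair n, M, N => .pair n M N

/-! ### Application and pairing as sequences of `let`s -/

namespace Red

variable {S : Signature.{u, v}}

theorem _root_.LinLam.Binary.congr (b : Binary S) {M M' N N' : Term S} (h : M ⇛ M') (h' : N ⇛ N') :
    b.tm M N ⇛ b.tm M' N' := by
  cases b
  · exact Red.app h h'
  · exact Red.pair _ h h'

theorem _root_.LinLam.Binary.rename (b : Binary S) (M N : Term S) (r : ℕ → ℕ) :
    (b.tm M N).rename r = b.tm (M.rename r) (N.rename r) := by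
  cases b <;> rfl

/-- The last conjunct is the typing rule itself, with the types of the two arguments fixed, so that
later arguments can retype new arguments without distinguishing application from pairing. -/
theorem _root_.LinLam.Binary.typed {b : Binary S} {M N : Term S} {γ : ℕ → Option (Ty S.Atom)} {T : Ty S.Atom} :
    Typed (b.tm M N) γ T ↔ ∃ γ₁ γ₂ A B, Parts γ γ₁ γ₂ ∧ Typed M γ₁ A ∧ Typed N γ₂ B ∧
      (∀ M' N' γ' γ₁' γ₂', Parts γ' γ₁' γ₂' → Typed M' γ₁' A → Typed N' γ₂' B →
        Typed (b.tm M' N') γ' T) := by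
  cases b with
  | app =>
      constructor
      · rintro ⟨γ₁, γ₂, A, hp, h, h'⟩
        exact ⟨γ₁, γ₂, _, _, hp, h, h', fun _ _ _ _ _ a b c => ⟨_, _, _, a, b, c⟩⟩
      · rintro ⟨_, _, _, _, a, b, c, h⟩
        exact h _ _ _ _ _ a b c
  | pair n =>
      constructor
      · rintro ⟨γ₁, γ₂, A, B, rfl, hp, h, h'⟩
        exact ⟨γ₁, γ₂, _, _, hp, h, h', fun _ _ _ _ _ a b c => ⟨_, _, _, _, rfl, a, b, c⟩⟩
      · rintro ⟨_, _, _, _, a, b, c, h⟩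
        exact h _ _ _ _ _ a b c

/-- `let x = M in let y = N in x y`, or the same with `⟨x, y⟩ⁿ`. -/
def _root_.LinLam.Binary.letForm (b : Binary S) (M N : Term S) : Term S :=
  .letIn M.infer M (.letIn N.infer (N.shift 1) (b.tm (.var 1 M.infer) (.var 0 N.infer)))

theorem typed_var_iff {i : ℕ} {B T : Ty S.Atom} {γ : ℕ → Option (Ty S.Atom)} :
    Typed (.var i B) γ T ↔
      T = B ∧ (∃ A, γ i = some A ∧ Nonempty (Sub A B)) ∧ ∀ j, j ≠ i → Disc (γ j) := Iff.rfl

/-- Declarations which may be discarded can be added to a context. -/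
theorem _root_.LinLam.Typed.weaken {M : Term S} {γ γ₁ γ₂ : ℕ → Option (Ty S.Atom)} {T : Ty S.Atom}
    (h : Typed M γ₁ T) (hp : Parts γ γ₁ γ₂) (hd : ∀ i, Disc (γ₂ i)) : Typed M γ T := by
  have := h.rename (r := fun i => i) (γ' := γ) ⟨fun i A hA => ?_, fun j hj => ⟨j, ?_, rfl⟩,
    fun _ _ _ _ h _ => h⟩
  · rwa [Term.rename_id] at this
  · refine ⟨A, ?_, Sub.refl _⟩
    rcases hp i with ⟨b, _⟩ | ⟨b, _⟩ | ⟨b, _, _⟩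
    · exact b ▸ hA
    · simp [b] at hA
    · exact b ▸ hA
  · intro hn
    exact hj ((hp j).disc (by simp [hn]) (hd j))

theorem _root_.LinLam.Binary.typed_letForm {b : Binary S} {M N : Term S} {γ : ℕ → Option (Ty S.Atom)}
    {T : Ty S.Atom} (h : Typed (b.tm M N) γ T) : Typed (b.letForm M N) γ T := by
  obtain ⟨γ₁, γ₂, A, B, hp, hM, hN, h⟩ := Binary.typed.1 h
  rw [Binary.letForm, hM.infer_eq, hN.infer_eq]
  refine (typed_letP (p := .var A)).2 ⟨_, _, hp, hM, (typed_letP (p := .var B)).2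
    -- `N` receives its whole former share and does not use the variable naming `M`; the innermost
    -- body receives only the two new variables.
    ⟨pad 1 γ₂, scons (some A) fun _ => none, ?_, hN.rename (Ren.pad 1 _), ?_⟩⟩
  · rintro (_ | i)
    · exact .inr (.inl ⟨rfl, rfl⟩)
    · exact .inl ⟨rfl, rfl⟩
  · refine h _ _ _ (scons none (scons (some A) fun _ => none))
      (scons (some B) fun _ => none) ?_ ⟨rfl, ⟨A, rfl, Sub.refl _⟩, ?_⟩
      ⟨rfl, ⟨B, rfl, Sub.refl _⟩, ?_⟩
    · rintro (_ | _ | i) <;> simp [Part, Pat.ext]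
    · rintro (_ | _ | i) hi <;> simp at hi ⊢
    · rintro (_ | _ | i) hi <;> simp at hi ⊢

theorem _root_.LinLam.Binary.typed_of_letForm {b : Binary S} {M N : Term S} {γ : ℕ → Option (Ty S.Atom)}
    {T : Ty S.Atom} (h : Typed (b.letForm M N) γ T) : Typed (b.tm M N) γ T := by
  obtain ⟨γ₁, γ₂, hp, hM, h⟩ := (typed_letP (p := .var M.infer)).1 h
  obtain ⟨δ₁, δ₂, hp', hN, h⟩ := (typed_letP (p := .var N.infer)).1 h
  obtain ⟨ε₁, ε₂, A, B, hp'', hM', hN', h⟩ := Binary.typed.1 h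
  obtain ⟨rfl, -, d₁⟩ := typed_var_iff.1 hM'
  obtain ⟨rfl, -, d₂⟩ := typed_var_iff.1 hN'
  obtain ⟨hN₁, hd⟩ := hN.unshift
  have hp₁ : Parts γ₂ (fun i => δ₁ (i + 1)) (fun i => δ₂ (i + 1)) := fun i => hp' (i + 1)
  -- Whatever is not in the share of `N` goes to two bare variables that do not mention it, so it is
  -- discardable and can be returned to `N`.
  have hd₂ : ∀ i, Disc (δ₂ (i + 1)) := fun i =>
    (hp'' (i + 2)).disc (d₁ _ (by omega)) (d₂ _ (by omega))
  exact h _ _ _ _ _ hp hM (hN₁.weaken hp₁ hd₂)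

/-- The axioms `let_app` and `let_tensor` read from right to left. In `let` form the order of
evaluation is explicit, so moving a `let` in or out of a subterm becomes an instance of the rules
for nested `let`s. -/
theorem _root_.LinLam.Binary.to_letForm (b : Binary S) (M N : Term S) : b.tm M N ⇛ b.letForm M N := by
  refine of_typed fun γ T h => of_axm_symm ?_ fun _ _ => Binary.typed_letForm
  cases b with
  | app =>
      obtain ⟨γ₁, γ₂, A, _, hM, hN⟩ := h
      rw [Binary.letForm, hM.infer_eq, hN.infer_eq]
      exact .let_app _ _ _ _
  | pair n => exact .let_tensor _ _ _ _ _

theorem _root_.LinLam.Binary.of_letForm (b : Binary S) (M N : Term S) : b.letForm M N ⇛ b.tm M N :=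
  fun _ _ h => ((b.to_letForm M N) (Binary.typed_of_letForm h.typed).valid).symm

theorem _root_.LinLam.Term.infer_letP (p : Pat S.Atom) (M N : Term S) : (Term.letP p M N).infer = N.infer := by
  cases p <;> rfl

theorem _root_.LinLam.Term.rename_letP (p : Pat S.Atom) (M N : Term S) (r : ℕ → ℕ) :
    (Term.letP p M N).rename r = .letP p (M.rename r) (N.rename (liftRenN p.arity r)) := by
  cases p <;> rfl

/-- `let` commutes with the left subterm of an application or of a pair. -/
theorem let_left (b : Binary S) (p : Pat S.Atom) (W P Q : Term S) :
    .letP p W (b.tm P (Q.shift p.arity)) ⇛ b.tm (.letP p W P) Q := by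
  refine .trans (letP p (refl _) (b.to_letForm _ _)) (.trans ?_ (b.of_letForm _ _))
  have := let_let_symm (.var P.infer) p W P
    (.letIn Q.infer (Q.shift 1) (b.tm (.var 1 P.infer) (.var 0 Q.infer)))
  rw [Binary.letForm, Binary.letForm, Term.infer_letP]
  simp only [Term.infer_rename]
  refine .trans (of_eq ?_) this
  simp [Term.letP, Term.rename, Pat.arity, liftRenN, Binary.rename, liftRen, Term.rename_rename]

theorem left_let (b : Binary S) (p : Pat S.Atom) (W P Q : Term S) :
    b.tm (.letP p W P) Q ⇛ .letP p W (b.tm P (Q.shift p.arity)) := by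
  refine .trans (b.to_letForm _ _) (.trans ?_ (letP p (refl _) (b.of_letForm _ _)))
  have := let_let (.var P.infer) p W P
    (.letIn Q.infer (Q.shift 1) (b.tm (.var 1 P.infer) (.var 0 Q.infer)))
  rw [Binary.letForm, Binary.letForm, Term.infer_letP]
  simp only [Term.infer_rename]
  refine .trans this (of_eq ?_)
  simp [Term.letP, Term.rename, Pat.arity, liftRenN, Binary.rename, liftRen, Term.rename_rename]

/-- Only for `λ⁰`: with a positive index the right side demands that the variables of `V` be
duplicable, which the left side does not ensure. -/
theorem let_lam (A D : Ty S.Atom) {V : Term S} (M : Term S) (hV : IsValue V) :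
    .letIn D V (.lam 0 A M) ⇛
      .lam 0 A (.letIn D (V.shift 1) (M.rename (swapRen 1 1))) := by
  refine of_axm (.let_lam 0 A D M hV) fun γ T h => ?_
  obtain ⟨γ₁, γ₂, hp, hV, ⟨B, rfl, -, hM⟩⟩ := (typed_letP (p := .var D)).1 h
  exact ⟨B, rfl, by simp, (typed_letP (p := .var D)).2 ⟨_, _, (hp.symm.ext_left (.var A)).symm,
    hV.rename (Ren.pad 1 _), hM.rename (Ren.swap (.var D) (.var A) _)⟩⟩

end Red

/-! ### Axiomatic equivalence is stable under injective renamings -/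

theorem Term.castTo_rename {S : Signature.{u, v}} (M : Term S) :
    ∀ (r : ℕ → ℕ) (T : Ty S.Atom), (M.rename r).castTo T = (M.castTo T).rename r := by
  induction M with
  | lam n A M ih =>
      intro r T
      simp only [Term.rename, Term.castTo]
      split <;> simp [Term.rename, ih]
  | pair n M N ihM ihN =>
      intro r T
      simp only [Term.rename, Term.castTo]
      split <;> simp [Term.rename, ihM, ihN]
  | _ => intro r T; simp_all [Term.rename, Term.castTo]

theorem liftSubst_liftRen {S : Signature.{u, v}} (f : Subst S) (r : ℕ → ℕ) :
    (fun i A => liftSubst f (liftRen r i) A) = liftSubst (fun i A => f (r i) A) := by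
  funext i A; cases i <;> rfl

theorem Term.subst_rename {S : Signature.{u, v}} (M : Term S) :
    ∀ (r : ℕ → ℕ) (f : Subst S), (M.rename r).subst f = M.subst (fun i A => f (r i) A) := by
  induction M <;> intro r f <;> simp_all [Term.rename, Term.subst, liftSubst_liftRen]

theorem rename_liftSubst {S : Signature.{u, v}} (f : Subst S) (r : ℕ → ℕ) :
    (fun i A => (liftSubst f i A).rename (liftRen r)) = liftSubst (fun i A => (f i A).rename r) := by
  funext i A
  cases i <;> simp [liftSubst, Term.rename, liftRen, Term.rename_rename]

theorem Term.rename_subst {S : Signature.{u, v}} (M : Term S) :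
    ∀ (r : ℕ → ℕ) (f : Subst S), (M.subst f).rename r = M.subst (fun i A => (f i A).rename r) := by
  induction M <;> intro r f <;> simp_all [Term.rename, Term.subst, rename_liftSubst]

theorem Term.subst_eq_rename {S : Signature.{u, v}} (M : Term S) :
    ∀ (r : ℕ → ℕ) (f : Subst S), (∀ i A, f i A = .var (r i) A) → M.subst f = M.rename r := by
  have key : ∀ (r : ℕ → ℕ) (f : Subst S), (∀ i A, f i A = .var (r i) A) →
      ∀ i A, liftSubst f i A = .var (liftRen r i) A := by
    rintro r f h (_ | i) A
    · rfl
    · simp [liftSubst, h, Term.rename, liftRen]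
  induction M with
  | var i A => intro r f h; exact h i A
  | const c A => intros; rfl
  | unit n => intros; rfl
  | lam n A M ih => intro r f h; simp only [Term.subst, Term.rename, ih _ _ (key r f h)]
  | app M N ihM ihN => intro r f h; simp only [Term.subst, Term.rename, ihM _ _ h, ihN _ _ h]
  | pair n M N ihM ihN => intro r f h; simp only [Term.subst, Term.rename, ihM _ _ h, ihN _ _ h]
  | letpair n A B M N ihM ihN =>
      intro r f h
      simp only [Term.subst, Term.rename, ihM _ _ h, ihN _ _ (key _ _ (key r f h))]
  | letunit M N ihM ihN => intro r f h; simp only [Term.subst, Term.rename, ihM _ _ h, ihN _ _ h]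

theorem Term.inst_rename {S : Signature.{u, v}} (M V : Term S) (r : ℕ → ℕ) :
    (M.inst V).rename r = (M.rename (liftRen r)).inst (V.rename r) := by
  rw [Term.inst, Term.inst, Term.rename_subst, Term.subst_rename]
  congr 1
  funext i A
  rcases i with _ | i
  · exact (Term.castTo_rename V r A).symm
  · rfl

theorem Term.inst₂_rename {S : Signature.{u, v}} (M V W : Term S) (r : ℕ → ℕ) :
    (M.inst₂ V W).rename r = (M.rename (liftRen (liftRen r))).inst₂ (V.rename r) (W.rename r) := by
  rw [Term.inst₂, Term.inst₂, Term.rename_subst, Term.subst_rename]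
  congr 1
  funext i A
  rcases i with _ | _ | i
  · exact (Term.castTo_rename W r A).symm
  · exact (Term.castTo_rename V r A).symm
  · rfl

theorem liftRenN_comp (k : ℕ) (r r' : ℕ → ℕ) (i : ℕ) :
    liftRenN k r' (liftRenN k r i) = liftRenN k (fun i => r' (r i)) i := by
  by_cases h : i < k
  · rw [liftRenN_lt r h, liftRenN_lt r' h, liftRenN_lt _ h]
  · obtain ⟨j, rfl⟩ : ∃ j, i = j + k := ⟨i - k, by omega⟩
    simp only [liftRenN_add]

theorem Term.rename_shift_liftRenN {S : Signature.{u, v}} (M : Term S) (k : ℕ) (r : ℕ → ℕ) :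
    (M.shift k).rename (liftRenN k r) = (M.rename r).shift k := by
  simp only [Term.shift, Term.rename_rename, liftRenN_add]

theorem liftRenN_swapRen (a b : ℕ) (r : ℕ → ℕ) (i : ℕ) :
    liftRenN b (liftRenN a r) (swapRen a b i) = swapRen a b (liftRenN a (liftRenN b r) i) := by
  by_cases h : i < a
  · rw [swapRen, if_pos h, liftRenN_add, liftRenN_lt _ h, liftRenN_lt _ h, swapRen, if_pos h]
  · obtain ⟨j, rfl⟩ : ∃ j, i = j + a := ⟨i - a, by omega⟩
    rw [liftRenN_add, swapRen, if_neg h]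
    by_cases h' : j < b
    · rw [if_pos (by omega), Nat.add_sub_cancel, liftRenN_lt _ h', liftRenN_lt _ h', swapRen,
        if_neg (by omega), if_pos (by omega), Nat.add_sub_cancel]
    · obtain ⟨k, rfl⟩ : ∃ k, j = k + b := ⟨j - b, by omega⟩
      rw [if_neg (by omega), Nat.add_right_comm, liftRenN_add, liftRenN_add, liftRenN_add, swapRen,
        if_neg (by omega), if_neg (by omega), Nat.add_right_comm]

theorem exists_ctx {At : Type u} (γ : ℕ → Option (Ty At)) {k : ℕ} (h : ∀ i, k ≤ i → γ i = none) :
    ∃ Γ : Ctx At, lk Γ = γ := by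
  refine ⟨(List.range k).map γ, ?_⟩
  funext i
  by_cases hi : i < k
  · simp [lk, List.getD_eq_getElem?_getD, hi]
  · rw [h i (by omega), lk_of_length_le (by simpa using hi)]

theorem Ren.of_injective {At : Type u} {r : ℕ → ℕ} (hr : Function.Injective r)
    (γ : ℕ → Option (Ty At)) : Ren r γ (Function.extend r γ fun _ => none) where
  sub i A h := ⟨A, by rw [hr.extend_apply, h], Sub.refl _⟩
  ex j hj := by
    by_cases h : ∃ i, r i = j
    · obtain ⟨i, rfl⟩ := h
      rw [hr.extend_apply] at hj
      exact ⟨i, fun h => by simp [h] at hj, rfl⟩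
    · rw [Function.extend_apply' _ _ _ h] at hj
      simp at hj
  uniq _ _ _ _ h _ := hr h

/-- The axiom `cast_app` carries typing judgments of its two subterms; renaming it requires some
list context for each renamed subterm. -/
theorem Valid.rename_injective {S : Signature.{u, v}} {Γ : Ctx S.Atom} {M : Term S}
    {T : Ty S.Atom} (h : Valid Γ M T) {r : ℕ → ℕ} (hr : Function.Injective r) :
    ∃ Γ', Valid Γ' (M.rename r) T := by
  -- The context pushed forward along `r` is empty beyond the largest image of an index of `Γ`,
  -- hence is a list.
  have hb : ∀ j, (Finset.range Γ.length).sup r + 1 ≤ j →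
      Function.extend r (lk Γ) (fun _ => none) j = none := by
    intro j hj
    by_cases h : ∃ i, r i = j
    · obtain ⟨i, rfl⟩ := h
      rw [hr.extend_apply]
      refine lk_of_length_le (le_of_not_gt fun hi => ?_)
      have := Finset.le_sup (f := r) (Finset.mem_range.2 hi)
      omega
    · exact Function.extend_apply' _ _ _ h
  obtain ⟨Γ', h'⟩ := exists_ctx _ hb
  have := h.typed.rename (Ren.of_injective hr _)
  rw [← h'] at this
  exact ⟨Γ', this.valid⟩

/-- Each axiom is a schema compatible with renaming. Injectivity serves only to transport the
judgments carried by `cast_app`. -/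
theorem Axm.rename {S : Signature.{u, v}} {M N : Term S} (h : Axm M N) {r : ℕ → ℕ}
    (hr : Function.Injective r) : Axm (M.rename r) (N.rename r) := by
  cases h with
  | beta_lam A hV => rw [Term.inst_rename]; exact .beta_lam A (hV.rename r)
  | beta_tensor n A B hV hW =>
      rw [Term.inst₂_rename]; exact .beta_tensor n A B (hV.rename r) (hW.rename r)
  | beta_one => exact .beta_one _
  | eta_lam n A B hV hT =>
      have := Axm.eta_lam n A B (hV.rename r) (by rwa [Term.infer_rename])
      rw [Term.castTo_rename, ← Term.rename_shift_liftRenN] at this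
      exact this
  | let_var A => exact .let_var A _
  | eta_tensor n A B => exact .eta_tensor n A B _
  | eta_one n N hT =>
      have := Axm.eta_one n (N.rename r) (by rwa [Term.infer_rename])
      rwa [Term.castTo_rename] at this
  | let_let p q M N P =>
      have := Axm.let_let p q (M.rename r) (N.rename (liftRenN q.arity r))
        (P.rename (liftRenN p.arity r))
      simp only [Term.rename_letP]
      convert this using 3
      simp only [Term.rename_rename, liftRenN_comp, liftRenN_add]
  | let_comm p q M hV hW =>
      have := Axm.let_comm p q (M.rename (liftRenN q.arity (liftRenN p.arity r)))
        (hV.rename r) (hW.rename r)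
      simp only [Term.rename_letP, Term.rename_shift_liftRenN]
      convert this using 3
      simp only [Term.rename_rename, liftRenN_swapRen]
  | let_app A B M N =>
      have := Axm.let_app A B (M.rename r) (N.rename r)
      rwa [← Term.rename_shift_liftRenN] at this
  | let_lam n A D M hV =>
      have := Axm.let_lam n A D (M.rename (liftRenN 1 (liftRenN 1 r))) (hV.rename r)
      rw [← Term.rename_shift_liftRenN] at this
      simp only [Term.rename]
      have he : (M.rename (swapRen 1 1)).rename (liftRen (liftRen r)) =
          (M.rename (liftRenN 1 (liftRenN 1 r))).rename (swapRen 1 1) := by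
        rw [Term.rename_rename, Term.rename_rename]
        exact congrArg (fun f => M.rename f) (funext (liftRenN_swapRen 1 1 r))
      rw [he]
      exact this
  | let_tensor n A B M N =>
      have := Axm.let_tensor n A B (M.rename r) (N.rename r)
      rwa [← Term.rename_shift_liftRenN] at this
  | cast_pair n n' A A' B B' M N s =>
      have := Axm.cast_pair n n' A A' B B' (M.rename r) (N.rename (liftRenN 2 r)) s
      rwa [Term.castTo_rename] at this
  | cast_let A A' M N s =>
      have := Axm.cast_let A A' (M.rename r) (N.rename (liftRenN 1 r)) s
      rwa [Term.castTo_rename] at this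
  | cast_letunit m n M N hT s =>
      have := Axm.cast_letunit m n (M.rename r) (N.rename r) (by rwa [Term.infer_rename]) s
      rwa [Term.castTo_rename] at this
  | cast_app n A B C D D' M N Γ₁ Γ₂ hM hN s t =>
      obtain ⟨_, hM'⟩ := hM.rename_injective hr
      obtain ⟨_, hN'⟩ := hN.rename_injective hr
      have := Axm.cast_app n A B C D D' _ _ _ _ hM' hN' s t
      rw [Term.castTo_rename, Term.castTo_rename, Term.castTo_rename, Term.castTo_rename] at this
      exact (Term.castTo_rename (.app _ _) r D') ▸ this

theorem Eqax.rename {S : Signature.{u, v}} {Γ : Ctx S.Atom} {M N : Term S} {T : Ty S.Atom}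
    (h : Eqax Γ M N T) : ∀ {r : ℕ → ℕ} {Γ' : Ctx S.Atom}, Function.Injective r →
      Ren r (lk Γ) (lk Γ') → Eqax Γ' (M.rename r) (N.rename r) T := by
  induction h with
  | ax h hM hM' =>
      intro r Γ' hr hR
      exact .ax (h.rename hr) (hM.typed.rename hR).valid (hM'.typed.rename hR).valid
  | refl hM => intro r Γ' hr hR; exact .refl (hM.typed.rename hR).valid
  | symm h ih => intro r Γ' hr hR; exact (ih hr hR).symm
  | trans h h' ih ih' => intro r Γ' hr hR; exact (ih hr hR).trans (ih' hr hR)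
  | app sp h h' ih ih' =>
      intro r Γ' hr hR
      obtain ⟨_, _, hp, h₁, h₂⟩ := hR.parts sp.parts
      obtain ⟨_, _, ⟨sp'⟩, rfl, rfl⟩ := exists_split hp
      exact .app sp' (ih hr h₁) (ih' hr h₂)
  | lam1 h ih =>
      intro r Γ' hr hR
      exact .lam1 (ih (liftRen_injective hr) (by simpa using hR.lift _))
  | lam2 n b h ih =>
      intro r Γ' hr hR
      exact .lam2 n (nonempty_allBang.2 (hR.allDisc (nonempty_allBang.1 ⟨b⟩))).some
        (ih (liftRen_injective hr) (by simpa using hR.lift _))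
  | pair n sp h h' ih ih' =>
      intro r Γ' hr hR
      obtain ⟨_, _, hp, h₁, h₂⟩ := hR.parts sp.parts
      obtain ⟨_, _, ⟨sp'⟩, rfl, rfl⟩ := exists_split hp
      exact .pair n sp' (ih hr h₁) (ih' hr h₂)
  | letunit sp h h' ih ih' =>
      intro r Γ' hr hR
      obtain ⟨_, _, hp, h₁, h₂⟩ := hR.parts sp.parts
      obtain ⟨_, _, ⟨sp'⟩, rfl, rfl⟩ := exists_split hp
      exact .letunit sp' (ih hr h₁) (ih' hr h₂)
  | letpair n sp h h' ih ih' =>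
      intro r Γ' hr hR
      obtain ⟨_, _, hp, h₁, h₂⟩ := hR.parts sp.parts
      obtain ⟨_, _, ⟨sp'⟩, rfl, rfl⟩ := exists_split hp
      exact .letpair n sp' (ih hr h₁) (ih' (liftRen_injective (liftRen_injective hr))
        (by simpa using (h₂.lift _).lift _))

theorem Ren.of_comp {At : Type u} {r : ℕ → ℕ} (hr : Function.Injective r)
    {γ : ℕ → Option (Ty At)} (hd : ∀ j, (∀ i, r i ≠ j) → Disc (γ j)) : Ren r (γ ∘ r) γ where
  sub i A h := ⟨A, h, Sub.refl _⟩
  ex j hj := by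
    by_contra hn
    push Not at hn
    refine hj (hd j fun i hi => hn i ?_ hi)
    rw [Function.comp, hi]
    intro h
    simp [h] at hj
  uniq _ _ _ _ h _ := hr h

/-- A typing of the shifted term restricts to the context without its `k` innermost declarations,
which are discardable. The equivalence obtained there is renamed back. Rewriting under `λ*` and
inside the tuple of a longer context both depend on this. -/
theorem Red.shift {S : Signature.{u, v}} {M N : Term S} (h : M ⇛ N) (k : ℕ) :
    M.shift k ⇛ N.shift k := by
  intro Γ T hM
  have hr : Function.Injective fun i => i + k := fun i j h => by simpa using h
  obtain ⟨h₁, h₂⟩ := hM.typed.unrename hr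
  obtain ⟨Γ', h'⟩ := exists_ctx (lk Γ ∘ fun i => i + k) (k := Γ.length)
    fun i hi => lk_of_length_le (show _ ≤ i + k by omega)
  refine (h (Γ := Γ') (T := T) (Typed.valid (h' ▸ h₁))).rename hr ?_
  rw [h']
  exact Ren.of_comp hr h₂

/-! ### Derived rules -/

/-- The renaming which substitutes the variable `i` for the innermost variable. -/
def ren0 (i : ℕ) : ℕ → ℕ
  | 0 => i
  | j + 1 => j

theorem Ren.ren0 {S : Signature.{u, v}} {A : Ty S.Atom} {i : ℕ}
    {γ γ₁ γ₂ : ℕ → Option (Ty S.Atom)} (hp : Parts γ γ₁ γ₂)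
    (h : Typed (.var i A : Term S) γ₁ A) : Ren (LinLam.ren0 i) (scons (some A) γ₂) γ where
  sub := by
    obtain ⟨-, ⟨A', hA, s⟩, h⟩ := h
    rintro (_ | j) B hB
    · cases hB
      refine ⟨A', ?_, s⟩
      rcases hp i with ⟨a, _⟩ | ⟨a, _⟩ | ⟨a, _⟩
      · exact a ▸ hA
      · simp [a] at hA
      · exact a ▸ hA
    · refine ⟨B, ?_, Sub.refl _⟩
      rw [scons_succ] at hB
      rcases hp j with ⟨_, a⟩ | ⟨_, a⟩ | ⟨_, a, _⟩
      · simp [a] at hB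
      · exact a ▸ hB
      · exact a ▸ hB
  ex j hj := by
    by_cases hi : j = i
    · exact ⟨0, by simp, hi.symm⟩
    · refine ⟨j + 1, fun hn => hj ((hp j).disc (h.2.2 j hi) ?_), rfl⟩
      rw [scons_succ] at hn
      simp [hn]
  uniq := by
    obtain ⟨-, ⟨A', hA, s⟩, h⟩ := h
    -- If the substituted variable also occurs in the share of the body, then it is contracted,
    -- which is allowed only because a shared declaration is duplicable.
    have key : ∀ j, γ₂ j ≠ none → i = j → Disc (γ i) := by
      rintro j hj rfl
      rcases hp i with ⟨_, a⟩ | ⟨a, _⟩ | ⟨_, _, a⟩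
      · exact absurd a hj
      · simp [a] at hA
      · exact a
    rintro (_ | j) (_ | j') hj hj' he hd
    · rfl
    · exact absurd (key j' hj' he) hd
    · change j = i at he
      subst he
      exact absurd (key j hj rfl) hd
    · change j = j' at he
      rw [he]

namespace Red

variable {S : Signature.{u, v}}

theorem lamU {M M' : Term S} (h : M ⇛ M') : M.lamU ⇛ M'.lamU :=
  lam 0 _ (letunit (refl _) (h.shift 1))

/-- Casting a variable only changes its annotation, so substituting a variable is a renaming and its
typing follows from `Ren.ren0`. -/
theorem let_var_beta (A : Ty S.Atom) (i : ℕ) (M : Term S) :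
    .letIn A (.var i A) M ⇛ M.rename (ren0 i) := by
  have he : M.inst (.var i A) = M.rename (ren0 i) := by
    refine Term.subst_eq_rename M _ _ ?_
    rintro (_ | j) B <;> rfl
  rw [← he]
  refine of_axm (.beta_lam A (.var i A)) fun γ T h => ?_
  obtain ⟨γ₁, γ₂, hp, h, h'⟩ := (typed_letP (p := .var A)).1 h
  rw [he]
  exact h'.rename (Ren.ren0 hp h)

theorem letunit_unit (M : Term S) : .letunit (.unit 0) M ⇛ M := by
  refine of_axm (.beta_one M) ?_
  rintro γ T ⟨γ₁, γ₂, hp, ⟨-, hd⟩, h⟩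
  exact h.weaken hp.symm hd

theorem letpair_pair_var (n : ℕ) (A B : Ty S.Atom) (M : Term S) :
    .letpair n A B (.pair n (.var 1 (Ty.bangs n A)) (.var 0 (Ty.bangs n B)))
      (M.rename (liftRenN 2 fun i => i + 2)) ⇛ M := by
  set P := M.rename (liftRenN 2 fun i => i + 2) with hP
  have h0 : ∀ i, ren0 1 (ren0 1 (liftRenN 2 (fun i => i + 2) i)) = i := by
    rintro (_ | _ | i) <;> simp [ren0, liftRenN, liftRen]
  -- The inner renaming replaces `y` by the ambient variable `0`, which has index `1` while `x` is
  -- still bound; the outer one replaces `x` by the ambient variable `1`.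
  have he : P.inst₂ (.var 1 (Ty.bangs n A)) (.var 0 (Ty.bangs n B)) =
      (P.rename (ren0 1)).rename (ren0 1) := by
    rw [Term.rename_rename]
    refine Term.subst_eq_rename P _ _ ?_
    rintro (_ | _ | j) B <;> rfl
  have he' : (P.rename (ren0 1)).rename (ren0 1) = M := by
    rw [hP, Term.rename_rename, Term.rename_rename]
    simp only [h0, Term.rename_id]
  have hA := Axm.beta_tensor n A B (M := P) (.var 1 (Ty.bangs n A)) (.var 0 (Ty.bangs n B))
  rw [he, he'] at hA
  refine of_axm hA ?_
  rintro γ T ⟨γ₁, γ₂, hp, ⟨δ₁, δ₂, A', B', -, hp', h₁, h₂⟩, h⟩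
  have h₁ := (typed_var_iff.1 h₁).2
  have h₂ := (typed_var_iff.1 h₂).2
  obtain ⟨ε, hp₁, hp₂⟩ := hp.assoc hp'
  rw [← he']
  refine (h.rename (Ren.ren0 (i := 1) (hp₂.symm.ext_left (.var (Ty.bangs n A))).symm ?_)).rename
    (Ren.ren0 hp₁ ⟨rfl, h₁⟩)
  exact Typed.rename (M := .var 0 (Ty.bangs n B)) (r := fun i => i + 1) ⟨rfl, h₂⟩ (Ren.pad 1 _)

/-- β for pairs of arbitrary terms: name the components by `let_tensor`, flatten the `let`s, and
apply β to a pair of variables. -/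
theorem letpair_pair (n : ℕ) (A B : Ty S.Atom) (M N P : Term S) :
    .letpair n A B (.pair n M N) P ⇛
      .letIn (Ty.bangs n A) M (.letIn (Ty.bangs n B) (N.shift 1) P) := by
  refine of_typed fun γ T h => ?_
  obtain ⟨γ₁, γ₂, hp, ⟨δ₁, δ₂, A', B', hT, hp', h₁, h₂⟩, h⟩ := h
  -- Removing the `n` bangs identifies the component types of the pair with the annotations of the
  -- pattern.
  have hT' := congrArg (Ty.unbangs n) hT
  rw [Ty.unbangs_bangs, Ty.unbangs_bangs] at hT'
  cases hT'
  have h3 := (Binary.pair n).to_letForm M N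
  rw [Binary.letForm, h₁.infer_eq, h₂.infer_eq] at h3
  refine (letpair n A B h3 (refl P)).trans ?_
  refine (let_let (.pair n A B) (.var (Ty.bangs n A)) M _ P).trans (letIn _ (refl _) ?_)
  refine (let_let (.pair n A B) (.var (Ty.bangs n B)) _ _ _).trans (letIn _ (refl _) ?_)
  refine .trans (of_eq ?_) (letpair_pair_var n A B P)
  simp only [Term.letP, Pat.arity, Binary.tm, Term.rename_rename, liftRenN_comp]

/-! A `let x = V` commutes with any other `let`. -/

theorem let_comm_var (D : Ty S.Atom) (q : Pat S.Atom) {V : Term S} (M N : Term S)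
    (hV : IsValue V) : .letIn D V (.letP q (M.shift 1) N) ⇛
      .letP q M (.letIn D (V.shift q.arity) (N.rename (swapRen q.arity 1))) := by
  -- The axiom `let_comm` needs two values, but `M` is arbitrary. When `q` is a variable, the inner
  -- `let` is the application of `λ A. N` to `M`, so the outer one moves to the function part and
  -- then under its λ.
  have key : ∀ (A : Ty S.Atom) (M N : Term S), .letIn D V (.letIn A (M.shift 1) N) ⇛
      .letIn A M (.letIn D (V.shift 1) (N.rename (swapRen 1 1))) := fun A M N =>
    (let_left .app (.var D) V (.lam 0 A N) M).trans (app (let_lam A D N hV) (refl M))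
  refine (letIn D (refl V) (letP_var_symm q (M.shift 1) N)).trans ((key _ _ _).trans ?_)
  refine .trans (letIn _ (refl M) ?_) (letP_var q M _)
  have h := let_comm (.var D) q (V := V.shift 1) (W := .var 0 q.ty)
    ((N.rename (liftRenN q.arity fun i => i + 1)).rename (liftRenN q.arity (swapRen 1 1)))
    (hV.rename _) (.var _ _)
  have hr : ∀ i, swapRen q.arity 1 (liftRenN q.arity (swapRen 1 1)
      (liftRenN q.arity (fun i => i + 1) i)) =
      liftRen (liftRenN q.arity fun i => i + 1) (swapRen q.arity 1 i) := by
    intro i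
    cases q <;> rcases i with _ | _ | _ | i <;> simp [liftRenN, liftRen, swapRen, Pat.arity]
    rw [if_neg (by omega), if_neg (by omega)]
  refine .trans ?_ (h.trans (of_eq ?_))
  · rw [Term.rename_letP]
    exact refl _
  · have e : ((V.shift 1).shift q.arity) =
        (V.shift q.arity).rename (liftRenN q.arity fun i => i + 1) := by
      simp only [Term.rename_rename, liftRenN_add]
    have e' : ((N.rename (liftRenN q.arity fun i => i + 1)).rename
        (liftRenN q.arity (swapRen 1 1))).rename (swapRen q.arity 1) =
        (N.rename (swapRen q.arity 1)).rename (liftRen (liftRenN q.arity fun i => i + 1)) := by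
      simp only [Term.rename_rename, hr]
    exact congrArg (Term.letP q _) (congrArg₂ (Term.letIn D) e e')

theorem comm_var_let (D : Ty S.Atom) (q : Pat S.Atom) {V : Term S} (M N : Term S)
    (hV : IsValue V) : .letP q M (.letIn D (V.shift q.arity) N) ⇛
      .letIn D V (.letP q (M.shift 1) (N.rename (swapRen 1 q.arity))) := by
  have h := let_comm_var D q M (N.rename (swapRen 1 q.arity)) hV
  rw [Term.rename_rename] at h
  simp only [swapRen_swapRen, Term.rename_id] at h
  exact of_symm h fun γ T => Typed.let_comm (p := q) (q := .var D)

theorem letForm_rename_right (b : Binary S) (A : Ty S.Atom) (k : ℕ) (Q : Term S) :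
    (Term.letIn Q.infer (Q.shift 1) (b.tm (.var 1 A) (.var 0 Q.infer))).rename (swapRen 1 k) =
      .letIn Q.infer (Q.rename (liftRenN k fun i => i + 1))
        ((b.tm (.var 1 A) (.var 0 Q.infer)).rename (liftRenN 1 fun i => i + k)) := by
  have h : ∀ i, swapRen 1 k (i + 1) = liftRenN k (fun i => i + 1) i := by
    intro i
    by_cases hi : i < k
    · rw [liftRenN_lt _ hi]; simp [swapRen]; omega
    · obtain ⟨j, rfl⟩ : ∃ j, i = j + k := ⟨i - k, by omega⟩
      rw [liftRenN_add, swapRen, if_neg (by omega), if_neg (by omega)]; omega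
  have h' : liftRen (swapRen 1 k) 1 = liftRenN 1 (fun i => i + k) 1 := by
    simp [liftRen, liftRenN, swapRen]
  simp only [Term.rename, Binary.rename, Term.rename_rename, h]
  rw [h']
  rfl

/-- `let` commutes with the right subterm of an application or of a pair, if the left subterm is
a value. -/
theorem let_right (b : Binary S) (p : Pat S.Atom) (W Q : Term S) {P : Term S} (hP : IsValue P) :
    .letP p W (b.tm (P.shift p.arity) Q) ⇛ b.tm P (.letP p W Q) := by
  refine .trans (letP p (refl _) (b.to_letForm _ _)) (.trans ?_ (b.of_letForm _ _))
  rw [Binary.letForm, Binary.letForm, Term.infer_letP, Term.infer_rename]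
  simp only [Term.shift, Term.rename_letP]
  refine (comm_var_let _ p W _ hP).trans (letIn _ (refl P) ?_)
  rw [letForm_rename_right]
  exact let_let_symm (.var Q.infer) p _ _ _

theorem right_let (b : Binary S) (p : Pat S.Atom) (W Q : Term S) {P : Term S} (hP : IsValue P) :
    b.tm P (.letP p W Q) ⇛ .letP p W (b.tm (P.shift p.arity) Q) := by
  refine .trans (b.to_letForm _ _) (.trans ?_ (letP p (refl _) (b.of_letForm _ _)))
  rw [Binary.letForm, Binary.letForm, Term.infer_letP, Term.infer_rename]
  simp only [Term.shift, Term.rename_letP]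
  have h := let_comm_var P.infer p W
    ((Term.letIn Q.infer (Q.shift 1) (b.tm (.var 1 P.infer) (.var 0 Q.infer))).rename
      (swapRen 1 p.arity)) hP
  rw [Term.rename_rename] at h
  simp only [swapRen_swapRen, Term.rename_id] at h
  refine .trans (letIn _ (refl P) ?_) h
  rw [letForm_rename_right]
  exact let_let (.var Q.infer) p _ _ _

/-! Rules for `λ*. M`. -/

theorem _root_.LinLam.Term.lamU_rename (M : Term S) (r : ℕ → ℕ) :
    M.lamU.rename r = (M.rename r).lamU := by
  simp [Term.lamU, Term.rename, Term.rename_rename, liftRen]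

theorem _root_.LinLam.IsValue.lamU (M : Term S) : IsValue M.lamU := .lam _ _ _

/-- Forcing a thunk: unfolded, the left side is `let x = * in let * = x in M`. -/
theorem app_lamU (M : Term S) : .app M.lamU (.unit 0) ⇛ M :=
  (letP_var .unit (.unit 0) M).trans (letunit_unit M)

theorem let_lamU (D : Ty S.Atom) {V : Term S} (M : Term S) (hV : IsValue V) :
    .letIn D V M.lamU ⇛ (Term.letIn D V M).lamU := by
  refine (let_lam .one D _ hV).trans (lam 0 _ ?_)
  refine .trans (let_comm (.var D) .unit (W := .var 0 .one)
    ((M.shift 1).rename (swapRen 1 1)) (hV.rename _) (.var _ _)) (of_eq ?_)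
  have h : ∀ i, swapRen 0 1 (swapRen 1 1 (i + 1)) = liftRen (fun i => i + 1) i := by
    rintro (_ | i) <;> simp [swapRen, liftRen]
  simp [Term.letP, Pat.arity, Term.rename, Term.rename_rename, h]

end Red

/-! ### Collecting `let`s -/

namespace Red

variable {S : Signature.{u, v}}

theorem Binary.let_fst (b : Binary S) (A : Ty S.Atom) (m n : Term S) :
    .letIn A m (b.tm (.var 0 A) (n.shift 1)) ⇛ b.tm m n :=
  (let_left b (.var A) m _ n).trans (b.congr (let_var A m) (refl n))

theorem Binary.let_snd (b : Binary S) (A : Ty S.Atom) (n : Term S) {m : Term S}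
    (hm : IsValue m) : .letIn A n (b.tm (m.shift 1) (.var 0 A)) ⇛ b.tm m n :=
  (let_right b (.var A) n _ hm).trans (b.congr (refl m) (let_var A n))

theorem Binary.let_both (b : Binary S) (A B : Ty S.Atom) (m n : Term S) :
    .letIn A m (.letIn B (n.shift 1) (b.tm (.var 1 A) (.var 0 B))) ⇛ b.tm m n :=
  (letIn A (refl m) (Binary.let_snd b B (n.shift 1) (.var 0 A))).trans (Binary.let_fst b A m n)

/-- Several structure maps have the shape `let ⟨x, y⟩ = z in P` with no other use of `z`; this
evaluates them on a pair. -/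
theorem let_letpair_pair (A B : Ty S.Atom) (m n P : Term S) :
    .letIn (.tensor A B) (.pair 0 m n) (.letpair 0 A B (.var 0 (.tensor A B))
      (P.rename (liftRenN 2 fun i => i + 1))) ⇛ .letIn A m (.letIn B (n.shift 1) P) :=
  (letP_var (.pair 0 A B) (.pair 0 m n) P).trans (letpair_pair 0 A B m n P)

end Red

/-! ### The action of arrows on terms -/

/-- `let x = m in f` -/
def act {S : Signature.{u, v}} {A B : Ty S.Atom} (f : Arrow S A B) (m : Term S) : Term S :=
  .letIn A m f.tm

variable {S : Signature.{u, v}} {A B C D : Ty S.Atom}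

/-- The term of an arrow has no free variable except `0`; hence it is unaffected by the shifts that
the rules for `let` introduce. -/
theorem Arrow.rename_congr (f : Arrow S A B) {r r' : ℕ → ℕ} (h : r 0 = r' 0) :
    f.tm.rename r = f.tm.rename r' := by
  refine f.valid.some.rename_congr ?_
  intro i hi
  obtain rfl : i = 0 := by simpa using hi
  exact h

theorem Arrow.rename_eq (f : Arrow S A B) {r : ℕ → ℕ} (h : r 0 = 0) : f.tm.rename r = f.tm := by
  rw [f.rename_congr (r' := fun i => i) h, Term.rename_id]

theorem act_rename (f : Arrow S A B) (m : Term S) (r : ℕ → ℕ) :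
    (act f m).rename r = act f (m.rename r) := by
  simp only [act, Term.rename, f.rename_eq (r := liftRen r) rfl]

theorem act_congr (f : Arrow S A B) {m n : Term S} (h : m ⇛ n) : act f m ⇛ act f n :=
  Red.letIn A h (Red.refl _)

theorem act_letP (f : Arrow S A B) (p : Pat S.Atom) (M N : Term S) :
    act f (.letP p M N) ⇛ .letP p M (act f N) := by
  have h := Red.let_let (.var A) p M N f.tm
  rwa [f.rename_eq (by rfl)] at h

theorem letP_act (f : Arrow S A B) (p : Pat S.Atom) (M N : Term S) :
    .letP p M (act f N) ⇛ act f (.letP p M N) := by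
  have h := Red.let_let_symm (.var A) p M N f.tm
  rwa [f.rename_eq (by rfl)] at h

theorem act_var (f : Arrow S A B) (i : ℕ) : act f (.var i A) ⇛ f.tm.at i := by
  refine (Red.let_var_beta A i f.tm).trans (Red.of_eq ?_)
  exact f.rename_congr rfl

/-- Composition is itself a `let`, so this is reassociation of nested `let`s. It allows a composite
denotation to be computed one factor at a time. -/
theorem act_comp (f : Arrow S A B) (g : Arrow S B C) (m : Term S) :
    act ((yaq S).comp f g) m ⇛ act g (act f m) :=
  letP_act g (.var A) m f.tm

theorem act_id (A : Ty S.Atom) (m : Term S) : act ((yaq S).id A) m ⇛ m :=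
  Red.let_var A m

/-- The components `m` and `n` need not be values: `m` is still evaluated before `n`, and the only
thing that `n` passes is the term of `f`, which is a value. -/
theorem act_tensor (f : Arrow S A B) (g : Arrow S C D) (m n : Term S) :
    act ((yaq S).tensorHom f g) (.pair 0 m n) ⇛ .pair 0 (act f m) (act g n) := by
  have h := Red.let_letpair_pair A C m n (.pair 0 (f.tm.at 1) (g.tm.at 0))
  have e : (Term.pair 0 (f.tm.at 1) (g.tm.at 0)).rename (liftRenN 2 fun i => i + 1) =
      .pair 0 (f.tm.at 1) (g.tm.at 0) := by
    simp [Term.rename, Term.rename_rename, liftRenN, liftRen]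
  rw [e] at h
  refine h.trans (.trans (Red.letIn A (.refl m) ?_) (Red.let_left (.pair 0) (.var A) m f.tm _))
  have e₁ : g.tm.at 0 = g.tm := g.rename_eq rfl
  have e₂ : f.tm.at 1 = f.tm.shift 1 := f.rename_congr rfl
  rw [e₁, e₂]
  refine (Red.let_right (.pair 0) (.var C) (n.shift 1) g.tm f.val).trans (.of_eq ?_)
  have := act_rename g n (fun i => i + 1)
  exact congrArg (Term.pair 0 f.tm) this.symm

/-- Exchanging the components exchanges their evaluation, so the first one has to be a value. -/
theorem act_swap (A B : Ty S.Atom) {m : Term S} (n : Term S) (hm : IsValue m) :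
    act ((yaq S).swap A B) (.pair 0 m n) ⇛ .pair 0 n m := by
  refine (Red.let_letpair_pair A B m n (.pair 0 (.var 0 B) (.var 1 A))).trans ?_
  refine (Red.let_comm_var A (.var B) n _ hm).trans ?_
  exact Red.Binary.let_both (.pair 0) B A n m

theorem act_assoc (A B C : Ty S.Atom) (m n k : Term S) :
    act ((yaq S).assoc A B C) (.pair 0 m (.pair 0 n k)) ⇛ .pair 0 (.pair 0 m n) k := by
  refine (Red.let_letpair_pair A (.tensor B C) m (.pair 0 n k) (.letpair 0 B C
    (.var 0 (.tensor B C)) (.pair 0 (.pair 0 (.var 3 A) (.var 1 B)) (.var 0 C)))).trans ?_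
  refine .trans (Red.letIn A (.refl m) ?_) ((Red.let_left (.pair 0) (.var A) m
    (.pair 0 (.var 0 A) (n.shift 1)) k).trans
      (Red.pair 0 (Red.Binary.let_fst (.pair 0) A m n) (.refl k)))
  refine (Red.let_letpair_pair B C (n.shift 1) (k.shift 1)
    (.pair 0 (.pair 0 (.var 2 A) (.var 1 B)) (.var 0 C))).trans ?_
  refine (Red.letIn B (.refl _) (Red.Binary.let_snd (.pair 0) C ((k.shift 1).shift 1)
    (m := .pair 0 (.var 1 A) (.var 0 B)) (.pair _ (.var _ _) (.var _ _)))).trans ?_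
  exact (Red.let_left (.pair 0) (.var B) (n.shift 1) (.pair 0 (.var 1 A) (.var 0 B))
    (k.shift 1)).trans (Red.pair 0 (Red.Binary.let_snd (.pair 0) B (n.shift 1) (.var 0 A)) (.refl _))

theorem act_assocInv (A B C : Ty S.Atom) {m n : Term S} (k : Term S) (hm : IsValue m)
    (hn : IsValue n) :
    act ((yaq S).assocInv A B C) (.pair 0 (.pair 0 m n) k) ⇛ .pair 0 m (.pair 0 n k) := by
  refine (Red.let_letpair_pair (.tensor A B) C (.pair 0 m n) k (.letpair 0 A B
    (.var 1 (.tensor A B)) (.pair 0 (.var 1 A) (.pair 0 (.var 0 B) (.var 2 C))))).trans ?_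
  -- The term of the arrow names `k` before it opens the inner pair; the value `⟨m, n⟩` is carried
  -- past `k` so that it can be opened.
  refine (Red.let_comm_var (.tensor A B) (.var C) k _ (.pair 0 hm hn)).trans ?_
  refine .trans (Red.letIn C (.refl k) (.trans (Red.let_letpair_pair A B (m.shift 1) (n.shift 1)
    (.pair 0 (.var 1 A) (.pair 0 (.var 0 B) (.var 2 C)))) ?_))
    ((Red.let_right (.pair 0) (.var C) k (.pair 0 (n.shift 1) (.var 0 C)) hm).trans
      (Red.pair 0 (.refl m) (Red.Binary.let_snd (.pair 0) C k hn)))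
  refine .trans (Red.letIn A (.refl _) (.trans (Red.let_right (.pair 0) (.var B)
    ((n.shift 1).shift 1) (.pair 0 (.var 0 B) (.var 2 C)) (.var 0 A)) (Red.pair 0 (.refl _)
      (Red.Binary.let_fst (.pair 0) B ((n.shift 1).shift 1) (.var 1 C)))))
    (Red.Binary.let_fst (.pair 0) A (m.shift 1) (.pair 0 (n.shift 1) (.var 0 C)))

theorem act_swapRight (A B C : Ty S.Atom) {m n : Term S} (k : Term S) (hm : IsValue m)
    (hn : IsValue n) :
    act ((yaq S).swapRight A B C) (.pair 0 (.pair 0 m n) k) ⇛ .pair 0 (.pair 0 m k) n := by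
  refine (act_comp _ _ _).trans (.trans ?_ (act_assoc A C B m k n))
  refine .trans (act_congr _ (act_assocInv A B C k hm hn)) ?_
  refine (act_comp _ _ _).trans (act_congr _ ?_)
  exact (act_tensor _ _ m _).trans (Red.pair 0 (act_id A m) (act_swap B C k hn))

theorem act_leftUnit (A : Ty S.Atom) (m : Term S) :
    act ((yaq S).leftUnit A) (.pair 0 (.unit 0) m) ⇛ m := by
  refine (Red.let_letpair_pair .one A (.unit 0) m (.letunit (.var 1 .one) (.var 0 A))).trans ?_
  refine (Red.let_comm_var .one (.var A) m _ (.unit 0)).trans ?_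
  refine .trans (Red.letIn A (.refl m) ?_) (Red.let_var A m)
  exact (Red.letP_var .unit (.unit 0) (.var 0 A)).trans (Red.letunit_unit _)

/-- The component `n` may be a computation and therefore survives as a scrutinee; this is how the
denotation of `let * = n` arises. -/
theorem act_rightUnit (A : Ty S.Atom) {m : Term S} (n : Term S) (hm : IsValue m) :
    act ((yaq S).rightUnit A) (.pair 0 m n) ⇛ .letunit n m := by
  refine (Red.let_letpair_pair A .one m n (.letunit (.var 0 .one) (.var 1 A))).trans ?_
  refine (Red.letIn A (.refl m) (Red.letP_var .unit (n.shift 1) (.var 0 A))).trans ?_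
  refine (Red.let_comm_var A .unit n (.var 0 A) hm).trans ?_
  refine Red.letunit (.refl n) ?_
  have : m.shift 0 = m := Term.rename_id m
  refine (Red.let_var A (m.shift 0)).trans (.of_eq this)

theorem act_leftUnitInv (A : Ty S.Atom) (m : Term S) :
    act ((yaq S).leftUnitInv A) m ⇛ .pair 0 (.unit 0) m :=
  Red.Binary.let_snd (.pair 0) A m (.unit 0)

theorem act_d (A B : Ty S.Atom) (m n : Term S) :
    act ((yaq S).d A B) (.pair 0 m n) ⇛ .pair 1 m n :=
  (Red.let_letpair_pair _ _ m n (.pair 1 (.var 1 (.bang A)) (.var 0 (.bang B)))).trans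
    (Red.Binary.let_both (.pair 1) _ _ m n)

theorem act_dOne (m : Term S) : act (yaq S).dOne m ⇛ .letunit m (.unit 1) :=
  Red.letP_var .unit m (.unit 1)

/-! ### The monad and the Kleisli exponential acting on thunks -/

theorem act_unit (A : Ty S.Atom) {m : Term S} (hm : IsValue m) :
    act ((yaq S).unit A) m ⇛ m.lamU :=
  (Red.let_lamU A (.var 0 A) hm).trans (Red.lamU (Red.let_var A m))

theorem let_lamU_app (A : Ty S.Atom) (m M : Term S) :
    .app (.letIn A m M.lamU) (.unit 0) ⇛ .letIn A m M :=
  (Red.left_let .app (.var A) m _ (.unit 0)).trans (Red.letIn A (.refl m) (Red.app_lamU M))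

theorem app_act_unit (A : Ty S.Atom) (m : Term S) :
    .app (act ((yaq S).unit A) m) (.unit 0) ⇛ m :=
  (let_lamU_app A m _).trans (Red.let_var A m)

theorem act_star (f : Arrow S A (.lolli .one B)) (P : Term S) :
    act ((yaq S).star f) P.lamU ⇛ (Term.app (act f P) (.unit 0)).lamU := by
  refine (Red.let_lamU _ _ (.lamU P)).trans (Red.lamU ?_)
  refine .trans ?_ (Red.let_left .app (.var A) P f.tm (.unit 0))
  have h := Red.let_let_symm (.var A) (.var (.lolli .one A)) P.lamU
    (.app (.var 0 (.lolli .one A)) (.unit 0)) (.app f.tm (.unit 0))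
  have e : (Term.app f.tm (.unit 0)).rename (liftRenN 1 fun i => i + 1) = .app f.tm (.unit 0) := by
    rw [Term.rename, f.rename_eq rfl]; rfl
  refine .trans ?_ (h.trans (Red.letIn A ?_ (.refl _)))
  · exact .of_eq (by rw [Pat.arity, Pat.arity, e]; rfl)
  · exact (Red.Binary.let_fst .app _ P.lamU (.unit 0)).trans (Red.app_lamU P)

/-- For an arbitrary `m` the evaluation of `m` stays outside the thunk. Forcing the result restores
the plain pair, which is what `act_Psi` needs. -/
theorem act_strength_aux (A B : Ty S.Atom) (m N : Term S) :
    act ((yaq S).strength A B) (.pair 0 m N.lamU) ⇛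
      .letIn A m (Term.pair 0 (.var 0 A) (N.shift 1)).lamU := by
  refine (Red.let_letpair_pair A (.lolli .one B) m N.lamU
    (Term.lamU (.pair 0 (.var 1 A) (.app (.var 0 (.lolli .one B)) (.unit 0))))).trans ?_
  refine Red.letIn A (.refl m) ?_
  rw [Term.shift, Term.lamU_rename]
  refine (Red.let_lamU _ _ (.lamU _)).trans (Red.lamU ?_)
  refine (Red.let_right (.pair 0) (.var (.lolli .one B)) _ _ (.var 0 A)).trans ?_
  exact Red.pair 0 (.refl _)
    ((Red.Binary.let_fst .app _ (N.shift 1).lamU (.unit 0)).trans (Red.app_lamU _))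

theorem act_strength (A B : Ty S.Atom) {m : Term S} (N : Term S) (hm : IsValue m) :
    act ((yaq S).strength A B) (.pair 0 m N.lamU) ⇛ (Term.pair 0 m N).lamU :=
  (act_strength_aux A B m N).trans ((Red.let_lamU A _ hm).trans
    (Red.lamU (Red.Binary.let_fst (.pair 0) A m N)))

theorem app_act_strength (A B : Ty S.Atom) (M N : Term S) :
    .app (act ((yaq S).strength A B) (.pair 0 M N.lamU)) (.unit 0) ⇛ .pair 0 M N :=
  (Red.app (act_strength_aux A B M N) (.refl _)).trans ((let_lamU_app A M _).trans
    (Red.Binary.let_fst (.pair 0) A M N))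

theorem app_congr_unit {M N : Term S} (h : M ⇛ N) : .app M (.unit 0) ⇛ .app N (.unit 0) :=
  Red.app h (.refl _)

/-- The first strength acts on the swapped pair of thunks and opens `M`. Inside the resulting thunk,
`M` is swapped past the thunk of `N`, and the second strength is forced at once with `M` on its
left, so `M` is evaluated before `N`. -/
theorem act_Psi (A B : Ty S.Atom) (M N : Term S) :
    act ((yaq S).Psi A B) (.pair 0 M.lamU N.lamU) ⇛ (Term.pair 0 M N).lamU := by
  refine (act_comp _ _ _).trans (.trans (act_congr _ (act_swap _ _ _ (.lamU M))) ?_)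
  refine (act_comp _ _ _).trans (.trans (act_congr _ (act_strength _ _ M (.lamU N))) ?_)
  refine (act_star _ _).trans (Red.lamU ?_)
  refine (app_congr_unit ((act_comp _ _ _).trans (act_congr _ (act_swap _ _ M (.lamU N))))).trans ?_
  exact app_act_strength A B M N

theorem app_act_ev (A B : Ty S.Atom) (M N : Term S) :
    .app (act ((yaq S).ev A B) (.pair 0 M N)) (.unit 0) ⇛ .app M N := by
  refine (let_lamU_app _ _ _).trans ?_
  refine (Red.let_letpair_pair (.lolli A B) A M N (.app (.var 1 (.lolli A B)) (.var 0 A))).trans ?_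
  exact Red.Binary.let_both .app _ _ M N

theorem act_Tmap (f : Arrow S A B) (M : Term S) :
    act ((yaq S).Tmap f) M.lamU ⇛ (act f M).lamU :=
  (act_star _ _).trans (Red.lamU ((app_congr_unit (act_comp _ _ _)).trans (app_act_unit B _)))

/-- Since `m` is a value, its `let` enters the λ; there it is absorbed into the pair and then into
the action of `f`. -/
theorem act_PhiInv (f : Arrow S (.tensor A B) (.lolli .one C)) {m : Term S} (hm : IsValue m) :
    act ((yaq S).PhiInv f) m ⇛
      .lam 0 B (.app (act f (.pair 0 (m.shift 1) (.var 0 B))) (.unit 0)) := by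
  refine (Red.let_lam B A _ hm).trans (Red.lam 0 B ?_)
  refine .trans ?_ (Red.let_left .app (.var (.tensor A B)) _ f.tm (.unit 0))
  have h := Red.let_let_symm (.var (.tensor A B)) (.var A) (m.shift 1)
    (.pair 0 (.var 0 A) (.var 1 B)) (.app f.tm (.unit 0))
  refine .trans (.of_eq ?_) (h.trans (Red.letIn _ (Red.Binary.let_fst (.pair 0) A _ (.var 0 B))
    (.refl _)))
  simp only [Term.letP, Term.rename, Pat.arity, f.rename_eq (r := liftRenN 1 fun i => i + 1) rfl,
    f.rename_eq (r := liftRen (swapRen 1 1)) rfl]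
  rfl

theorem act_dup (A : Ty S.Atom) (i : ℕ) :
    act ((yaq S).dup A) (.var i (.bang A)) ⇛ .pair 0 (.var i (.bang A)) (.var i (.bang A)) :=
  act_var _ i

theorem act_discard (A : Ty S.Atom) (i : ℕ) :
    act ((yaq S).discard A) (.var i (.bang A)) ⇛ .unit 0 :=
  act_var _ i

theorem act_comult (A : Ty S.Atom) (i : ℕ) :
    act ((yaq S).comult A) (.var i (.bang A)) ⇛ .var i (.bang (.bang A)) :=
  act_var _ i

/-! ### Promotion and casts -/

variable {S : Signature.{u, v}} {A B C D : Ty S.Atom}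

theorem Ty.bangs_bang {At : Type u} (k : ℕ) (A : Ty At) :
    Ty.bangs k (.bang A) = .bang (Ty.bangs k A) := by
  induction k with
  | zero => rfl
  | succ k ih => rw [Ty.bangs, ih]; rfl

theorem Ty.bangs_injective {At : Type u} (k : ℕ) : Function.Injective (Ty.bangs (At := At) k) := by
  intro A B h
  rw [← Ty.unbangs_bangs k A, h, Ty.unbangs_bangs]

/-- Iterated promotion. -/
def Term.promoteN (k : ℕ) (M : Term S) : Term S := Term.promote^[k] M

theorem Term.promoteN_succ (k : ℕ) (M : Term S) :
    M.promoteN (k + 1) = (M.promoteN k).promote := Function.iterate_succ_apply' _ _ _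

theorem Term.promoteN_promote (k : ℕ) (M : Term S) : M.promote.promoteN k = M.promoteN (k + 1) :=
  rfl

theorem Term.promoteN_var (k i : ℕ) (A : Ty S.Atom) :
    (Term.var i A : Term S).promoteN k = .var i (Ty.bangs k A) := by
  induction k with
  | zero => rfl
  | succ k ih => rw [promoteN_succ, ih]; rfl

theorem Term.promoteN_lam (k n : ℕ) (A : Ty S.Atom) (M : Term S) :
    (Term.lam n A M).promoteN k = .lam (n + k) A M := by
  induction k with
  | zero => rfl
  | succ k ih => rw [promoteN_succ, ih]; rfl

theorem Term.promoteN_letIn (k : ℕ) (A : Ty S.Atom) (V W : Term S) :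
    (Term.letIn A V W).promoteN k = .letIn (Ty.bangs k A) (V.promoteN k) (W.promoteN k) := by
  induction k with
  | zero => rfl
  | succ k ih => rw [promoteN_succ, ih, promoteN_succ, promoteN_succ]; rfl

theorem Term.promoteN_pair (k n : ℕ) (V W : Term S) :
    (Term.pair n V W).promoteN k = .pair (n + k) (V.promoteN k) (W.promoteN k) := by
  induction k with
  | zero => rfl
  | succ k ih => rw [promoteN_succ, ih, promoteN_succ, promoteN_succ]; rfl

theorem Term.promoteN_letpair (k n : ℕ) (A B : Ty S.Atom) (V W : Term S) :
    (Term.letpair n A B V W).promoteN k =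
      .letpair (n + k) A B (V.promoteN k) (W.promoteN k) := by
  induction k with
  | zero => rfl
  | succ k ih => rw [promoteN_succ, ih, promoteN_succ, promoteN_succ]; rfl

theorem IsValue.promoteN {V : Term S} (hV : IsValue V) (k : ℕ) : IsValue (V.promoteN k) := by
  induction k with
  | zero => exact hV
  | succ k ih => rw [Term.promoteN_succ]; exact ih.promote

theorem Term.promoteN_rename {V : Term S} (hV : IsValue V) (k : ℕ) (r : ℕ → ℕ) :
    (V.rename r).promoteN k = (V.promoteN k).rename r := by
  induction k with
  | zero => rfl
  | succ k ih => rw [promoteN_succ, ih, promoteN_succ, Term.promote_rename (hV.promoteN k)]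

/-- The axiom `cast_let` moves the change of annotation from the bound variable to `M`, after which
the `let` is trivial. The subtyping is read off from the typing of the left side. -/
theorem Red.let_cast (A A' : Ty S.Atom) (M : Term S) :
    .letIn A M (.var 0 A') ⇛ M.castTo A' := by
  refine .of_typed fun γ T h => ?_
  obtain ⟨_, _, _, -, ⟨-, ⟨X, hX, ⟨s⟩⟩, -⟩⟩ := (typed_letP (p := .var A)).1 h
  obtain rfl : A = X := by simpa [Pat.ext] using hX
  refine .trans (.of_axm_symm (.cast_let A A' M (.var 0 A') s) fun γ T h => ?_) (.let_var A' _)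
  obtain ⟨γ₁, γ₂, hp, hM, ⟨hT, -, hd⟩⟩ := (typed_letP (p := .var A)).1 h
  refine (typed_letP (p := .var A')).2 ⟨γ₁, γ₂, hp, hM.castTo ⟨s⟩, hT, ⟨A', rfl, Sub.refl _⟩, ?_⟩
  rintro (_ | j) hj
  · exact absurd rfl hj
  · exact hd (j + 1) hj

/-- The term `M`, with the free variable `0`, is a cast of this variable to the type `T`, and so
are its promotions. -/
def IsCast (M : Term S) (T : Ty S.Atom) : Prop :=
  ∀ (k : ℕ) (r : ℕ → ℕ), (M.promoteN k).rename r ⇛ .var (r 0) (Ty.bangs k T)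

theorem IsCast.red {M : Term S} {T : Ty S.Atom} (h : IsCast M T) (r : ℕ → ℕ) :
    M.rename r ⇛ .var (r 0) T := h 0 r

theorem IsCast.act {f : Arrow S A B} {T : Ty S.Atom} (h : IsCast f.tm T) (m : Term S) :
    act f m ⇛ m.castTo T := by
  have := h.red fun i => i
  rw [Term.rename_id] at this
  exact (Red.letIn A (.refl m) this).trans (Red.let_cast A T m)

theorem IsCast.var (A : Ty S.Atom) : IsCast (.var 0 A : Term S) A := by
  intro k r
  rw [Term.promoteN_var]
  exact .refl _

theorem IsCast.letIn {M N : Term S} {T : Ty S.Atom} (h : IsCast M A) (h' : IsCast N T) :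
    IsCast (.letIn A M N) T := by
  intro k r
  rw [Term.promoteN_letIn]
  exact (Red.letIn _ (h k r) (h' k (liftRen r))).trans (Red.let_var_beta _ _ _)

/-- Immediate because `IsCast` speaks of all iterated promotions at once; knowing that `M` rewrites
to a variable would say nothing about its promotion. -/
theorem IsCast.promote {M : Term S} (h : IsCast M A) : IsCast M.promote (.bang A) := by
  intro k r
  rw [Term.promoteN_promote, Ty.bangs_bang]
  exact h (k + 1) r

/-- Under a binder the declared type of variable `0` is known. Some axioms preserve typing only
thanks to this, so they do not give an instance of `Red`, which quantifies over all contexts. -/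
theorem Red.lam_of_axm {M N : Term S} (n : ℕ) (A : Ty S.Atom) (h : Axm M N ∨ Axm N M)
    (ht : ∀ γ T, Typed M (scons (some A) γ) T → Typed N (scons (some A) γ) T) :
    .lam n A M ⇛ .lam n A N := by
  have key : ∀ {Γ T}, Deriv (some A :: Γ) M T → Eqax (some A :: Γ) M N T := by
    intro Γ T d
    have hN : Valid (some A :: Γ) N T := Typed.valid (by
      have := d.typed
      rw [lk_cons] at this ⊢
      exact ht _ _ this)
    rcases h with h | h
    · exact .ax h ⟨d⟩ hN
    · exact (Eqax.ax h hN ⟨d⟩).symm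
  rintro Γ T ⟨d⟩
  cases d with
  | lam1 d => exact .lam1 (key d)
  | lam2 n b d => exact .lam2 n b (key d)

theorem Sub.bangs_right {At : Type u} {X Y : Ty At} (s : Sub (.bang X) Y) (k : ℕ) :
    Nonempty (Sub (.bang X) (Ty.bangs k Y)) := by
  induction k with
  | zero => exact ⟨s⟩
  | succ k ih => exact ih.some.bang_right

theorem Red.lam_app_var (k j : ℕ) (A D : Ty S.Atom) :
    .lam k A (.app (.var (j + 1) (.lolli A D)) (.var 0 A)) ⇛
      (.var j (Ty.bangs k (.lolli A D)) : Term S) := by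
  refine .of_axm (.eta_lam k A D (V := .var j (Ty.bangs k (.lolli A D))) (.var _ _) rfl) ?_
  rintro γ T ⟨B, rfl, hk, δ₁, δ₂, A', hp, ⟨hA, ⟨X, hX, ⟨s⟩⟩, h₁⟩, ⟨-, -, h₂⟩⟩
  cases hA
  have hX' : γ j = some X := by
    rcases hp (j + 1) with ⟨a, _⟩ | ⟨a, _⟩ | ⟨a, _⟩
    · exact a.symm.trans hX
    · exact absurd (a.symm.trans hX) (by simp)
    · exact a.symm.trans hX
  refine ⟨rfl, ⟨X, hX', ?_⟩, fun i hi =>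
    (hp (i + 1)).disc (h₁ _ (by omega)) (h₂ _ (by omega))⟩
  cases k with
  | zero => exact ⟨s⟩
  | succ k =>
      -- A positive index on the λ forces the declared type of the variable to be banged, so the
      -- subtyping can be raised to any number of bangs.
      obtain ⟨Y, rfl⟩ := hk (by omega) j X hX'
      exact s.bangs_right _

/-- When `f` and `g` are casts, the body becomes `let y = z x in y` with `x` used at `B` and `y` at
`D`, that is, `z x` cast to `D`. The axiom `cast_app`, read from right to left, moves both casts
onto `z`, and η finishes. -/
theorem IsCast.lolliHom {f : Arrow S A B} {g : Arrow S C D} (hf : IsCast f.tm B)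
    (hg : IsCast g.tm D) (s : Nonempty (Sub A B)) (t : Nonempty (Sub C D)) :
    IsCast ((yaq S).lolliHom f g).tm (.lolli A D) := by
  intro k r
  have e : ((yaq S).lolliHom f g).tm =
      .lam 0 A (.letIn C (.app (.var 1 (.lolli B C)) f.tm) g.tm) := rfl
  rw [e, Term.promoteN_lam, Nat.zero_add]
  refine .trans (Red.lam k A (Red.letIn C (Red.app (.refl _) (hf.red (liftRen r)))
    (hg.red (liftRen (liftRen r))))) ?_
  refine .trans (Red.lam k A (Red.let_cast C D _)) ?_
  refine .trans (Red.lam_of_axm k A (.inr ?_) ?_) (Red.lam_app_var k (r 0) A D)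
  · have hM : Valid (S := S) (List.replicate (r 0 + 1) none ++ [some (.lolli B C)])
        (.var (r 0 + 1) (.lolli B C)) (.lolli B C) :=
      (Valid.var (.here .nil) : Valid [some (.lolli B C)] (.var 0 (.lolli B C)) _).at 0 (r 0 + 1)
    have hN : Valid (S := S) [some A] (.var 0 A) A := Valid.var (.here .nil)
    exact .cast_app 0 B A A C D _ _ _ _ hM hN
      (.lolli 0 0 (.inl rfl) s.some t.some) (Sub.refl A).some
  · rintro γ T ⟨γ₁, γ₂, A', hp, ⟨hBD, ⟨X, hX, ⟨s'⟩⟩, h₁⟩, ⟨-, ⟨Y, hY, -⟩, h₂⟩⟩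
    cases hBD
    -- The argument is the λ-bound variable, declared with type `A` exactly, so it may be annotated
    -- by `A` as well as by `B`.
    have hY' : Y = A := by
      rcases hp 0 with ⟨_, a⟩ | ⟨_, a⟩ | ⟨_, a, _⟩
      · exact absurd (a.symm.trans hY) (by simp)
      · exact (Option.some.inj (a.symm.trans hY)).symm
      · exact (Option.some.inj (a.symm.trans hY)).symm
    subst hY'
    exact ⟨γ₁, γ₂, _, hp,
      ⟨rfl, ⟨X, hX, s'.trans (.lolli 0 0 (.inl rfl) s.some (Sub.refl D).some)⟩, h₁⟩,
      ⟨rfl, ⟨Y, hY, Sub.refl _⟩, h₂⟩⟩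

/-- If the components of a pair are used only to rebuild it, then nothing else is used. -/
theorem Red.letpair_eta (n : ℕ) (A B : Ty S.Atom) (M : Term S) :
    .letpair n A B M (.pair n (.var 1 (Ty.bangs n A)) (.var 0 (Ty.bangs n B))) ⇛ M := by
  refine .of_axm (.eta_tensor n A B M) ?_
  rintro γ T ⟨γ₁, γ₂, hp, hM, δ₁, δ₂, A', B', rfl, hp', ⟨hA, -, d₁⟩, ⟨hB, -, d₂⟩⟩
  rw [Ty.bangs_injective n hA, Ty.bangs_injective n hB]
  exact hM.weaken hp fun i => (hp' (i + 2)).disc (d₁ _ (by omega)) (d₂ _ (by omega))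

theorem Red.letpair_eta_symm (n : ℕ) {A B : Ty S.Atom} {M : Term S}
    (hM : M.infer = Ty.bangs n (.tensor A B)) :
    M ⇛ .letpair n A B M (.pair n (.var 1 (Ty.bangs n A)) (.var 0 (Ty.bangs n B))) := by
  refine .of_axm_symm (.eta_tensor n A B M) fun γ T h => ?_
  obtain rfl : _ = T := hM.symm.trans h.infer_eq
  refine ⟨γ, fun _ => none, fun i => .inl ⟨rfl, rfl⟩, h,
    scons none (scons (some (Ty.bangs n A)) fun _ => none),
    scons (some (Ty.bangs n B)) fun _ => none, A, B, rfl, ?_, ⟨rfl, ⟨_, rfl, Sub.refl _⟩, ?_⟩,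
    ⟨rfl, ⟨_, rfl, Sub.refl _⟩, ?_⟩⟩
  · rintro (_ | _ | i) <;> simp [Part]
  · rintro (_ | _ | i) hi <;> simp at hi ⊢
  · rintro (_ | _ | i) hi <;> simp at hi ⊢

/-- The casts of the two bound components are moved to the scrutinee by `cast_pair`, leaving an
η-redex. -/
theorem Red.letpair_cast (k j : ℕ) (s : Nonempty (Sub A B)) (t : Nonempty (Sub C D)) :
    .letpair k A C (.var j (Ty.bangs k (.tensor A C)))
      (.pair k (.var 1 (Ty.bangs k B)) (.var 0 (Ty.bangs k D))) ⇛
    .letpair k B D (.var j (Ty.bangs k (.tensor B D)) : Term S)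
      (.pair k (.var 1 (Ty.bangs k B)) (.var 0 (Ty.bangs k D))) := by
  have hs : Nonempty (Sub (Ty.bangs k (.tensor A C)) (Ty.bangs k (.tensor B D))) :=
    ⟨.tensor k k (by omega) s.some t.some⟩
  refine .of_axm_symm (.cast_pair k k A B C D (.var j (Ty.bangs k (.tensor A C))) _ hs.some) ?_
  rintro γ T ⟨γ₁, γ₂, hp, ⟨-, ⟨X, hX, ⟨s'⟩⟩, d⟩, δ₁, δ₂, A', B', rfl, hp', ⟨hA, -, d₁⟩,
    ⟨hB, -, d₂⟩⟩
  have hd : ∀ i, Disc (γ₂ i) := fun i =>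
    (hp' (i + 2)).disc (d₁ _ (by omega)) (d₂ _ (by omega))
  rw [Ty.bangs_injective k hA, Ty.bangs_injective k hB]
  refine ⟨γ₁, γ₂, hp, ⟨rfl, ⟨X, hX, s'.trans hs.some⟩, d⟩,
    scons none (scons (some (Ty.bangs k B)) γ₂), scons (some (Ty.bangs k D)) (scons none γ₂),
    B, D, rfl, ?_, ⟨rfl, ⟨_, rfl, Sub.refl _⟩, ?_⟩, ⟨rfl, ⟨_, rfl, Sub.refl _⟩, ?_⟩⟩
  · rintro (_ | _ | i)
    · simp [Part]
    · simp [Part]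
    · exact .inr (.inr ⟨rfl, rfl, hd i⟩)
  · rintro (_ | _ | i) hi
    · simp
    · exact absurd rfl hi
    · exact hd i
  · rintro (_ | _ | i) hi
    · exact absurd rfl hi
    · simp
    · exact hd i

theorem IsCast.tensorHom {f : Arrow S A B} {g : Arrow S C D} (hf : IsCast f.tm B)
    (hg : IsCast g.tm D) (s : Nonempty (Sub A B)) (t : Nonempty (Sub C D)) :
    IsCast ((yaq S).tensorHom f g).tm (.tensor B D) := by
  intro k r
  have e : ((yaq S).tensorHom f g).tm =
      .letpair 0 A C (.var 0 (.tensor A C)) (.pair 0 (f.tm.at 1) (g.tm.at 0)) := rfl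
  rw [e, Term.promoteN_letpair, Term.promoteN_pair, Term.promoteN_var, Term.promoteN_rename f.val,
    Term.promoteN_rename g.val, Nat.zero_add]
  simp only [Term.rename, Term.rename_rename]
  refine .trans (Red.letpair k A C (.refl _) (Red.pair k (hf k _) (hg k _))) ?_
  exact (Red.letpair_cast k (r 0) s t).trans (Red.letpair_eta k B D _)

/-! ### The canonical subtyping arrows are casts -/

section
open DupOps

theorem IsCast.bangDown (X : Ty S.Atom) (n : ℕ) :
    IsCast (bangDown (C := yaq S) Ty.atom X n).tm ((yaq S).ty Ty.atom (.bang X)) := by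
  induction n with
  | zero => exact .var _
  | succ n ih => exact .letIn (.var _) ih

theorem IsCast.bangUp (X : Ty S.Atom) (m : ℕ) :
    IsCast (bangUp (C := yaq S) Ty.atom X m).tm
      ((yaq S).ty Ty.atom (Ty.bangs (m + 1) X)) := by
  induction m with
  | zero => exact .var _
  | succ m ih => exact .letIn ih (.var _)

theorem IsCast.bangMap (X : Ty S.Atom) (n m : ℕ) (h : m = 0 ∨ 1 ≤ n) :
    IsCast (bangMap (C := yaq S) Ty.atom X n m h).tm
      ((yaq S).ty Ty.atom (Ty.bangs m X)) := by
  rcases n with _ | n <;> rcases m with _ | m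
  · exact .var _
  · omega
  · exact .letIn (.bangDown X n) (.var _)
  · exact .letIn (.bangDown X n) (.bangUp X m)

theorem IsCast.LmapN {A B : Ty S.Atom}
    {f : Arrow S ((yaq S).ty Ty.atom A) ((yaq S).ty Ty.atom B)}
    (h : IsCast f.tm ((yaq S).ty Ty.atom B)) (n : ℕ) :
    IsCast (LmapN (C := yaq S) Ty.atom f n).tm ((yaq S).ty Ty.atom (Ty.bangs n B)) := by
  induction n with
  | zero => exact h
  | succ n ih => exact ih.promote

theorem nonempty_sub_ty {A B : Ty S.Atom} (s : Sub A B) :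
    Nonempty (Sub ((yaq S).ty Ty.atom A) ((yaq S).ty Ty.atom B)) := by
  rw [yaq_ty, yaq_ty]
  exact ⟨s⟩

/-- Every constituent of a canonical arrow is a cast, and casts are closed under composition,
promotion, `⊗` and `⊸`. Through `IsCast.act` the arrow therefore acts as `castTo`. -/
theorem IsCast.sub {A B : Ty S.Atom} (s : Sub A B) :
    IsCast (sub (C := yaq S) Ty.atom s).tm ((yaq S).ty Ty.atom B) := by
  induction s with
  | atom n m h a => exact .bangMap _ _ _ _
  | one n m h => exact .bangMap _ _ _ _
  | lolli n m h s t ihs iht =>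
      exact .letIn (.bangMap _ _ _ _) (IsCast.LmapN (A := .lolli _ _) (B := .lolli _ _)
        (IsCast.lolliHom ihs iht (nonempty_sub_ty s) (nonempty_sub_ty t)) m)
  | tensor n m h s t ihs iht =>
      exact .letIn (.bangMap _ _ _ _) (IsCast.LmapN (A := .tensor _ _) (B := .tensor _ _)
        (IsCast.tensorHom ihs iht (nonempty_sub_ty s) (nonempty_sub_ty t)) m)

/-! ### The monoidal structure of the iterated comonad -/

/-- Iterated promotion of an arrow. -/
def Arrow.promoteN (f : Arrow S A B) : ∀ k : ℕ, Arrow S (Ty.bangs k A) (Ty.bangs k B)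
  | 0 => f
  | k + 1 => Yaq.Lmap (f.promoteN k)

theorem Arrow.promoteN_tm (f : Arrow S A B) (k : ℕ) : (f.promoteN k).tm = f.tm.promoteN k := by
  induction k with
  | zero => rfl
  | succ k ih => rw [Term.promoteN_succ, ← ih]; rfl

theorem act_promoteN_eq (f : Arrow S A B) (k : ℕ) (m : Term S) :
    act (f.promoteN k) m = .letIn (Ty.bangs k A) m (f.tm.promoteN k) := by
  rw [act, Arrow.promoteN_tm]

theorem act_promoteN_Lmap (f : Arrow S A B) (k : ℕ) (m : Term S) :
    act ((Yaq.Lmap f).promoteN k) m = act (f.promoteN (k + 1)) m := by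
  rw [act_promoteN_eq, act_promoteN_eq, Ty.bangs_bang]
  rfl

theorem act_promoteN_comp (f : Arrow S A B) (g : Arrow S B C) (k : ℕ) (m : Term S) :
    act ((Yaq.comp f g).promoteN k) m ⇛ act (g.promoteN k) (act (f.promoteN k) m) := by
  refine .trans (.of_eq ?_) (act_comp (f.promoteN k) (g.promoteN k) m)
  rw [act_promoteN_eq, Yaq.comp, Term.promoteN_letIn, ← Arrow.promoteN_tm, ← Arrow.promoteN_tm]
  rfl

theorem act_promoteN_id (A : Ty S.Atom) (k : ℕ) (m : Term S) :
    act ((Yaq.id A).promoteN k) m ⇛ m := by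
  rw [act_promoteN_eq, Yaq.id, Term.promoteN_var]
  exact Red.let_var _ _

theorem act_promoteN_d (A B : Ty S.Atom) (k : ℕ) (m n : Term S) :
    act ((Yaq.d A B).promoteN k) (.pair k m n) ⇛ .pair (k + 1) m n := by
  rw [act_promoteN_eq, Yaq.d]
  simp only [Term.promoteN_letpair, Term.promoteN_var, Term.promoteN_pair, Nat.zero_add]
  rw [Nat.add_comm 1 k]
  exact (Red.letP_var (.pair k (.bang A) (.bang B)) (.pair k m n) (.pair (k + 1) (.var 1 _)
    (.var 0 _))).trans ((Red.letpair_pair k _ _ m n _).trans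
      (Red.Binary.let_both (.pair (k + 1)) _ _ m n))

theorem act_promoteN_dInv (A B : Ty S.Atom) (k : ℕ) (m n : Term S) :
    act ((Yaq.dInv A B).promoteN k) (.pair (k + 1) m n) ⇛ .pair k m n := by
  rw [act_promoteN_eq, Yaq.dInv]
  simp only [Term.promoteN_letpair, Term.promoteN_var, Term.promoteN_pair, Nat.zero_add,
    Ty.bangs_bang]
  rw [Nat.add_comm 1 k]
  exact (Red.letP_var (.pair (k + 1) A B) (.pair (k + 1) m n)
    (.pair k (.var 1 _) (.var 0 _))).trans ((Red.letpair_pair (k + 1) _ _ m n _).trans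
      (Red.Binary.let_both (.pair k) _ _ m n))

/-- The recursive call of `dN` stands under `L`, so the induction must allow for an arbitrary number
`k` of outer promotions. -/
theorem act_promoteN_dN (A B : Ty S.Atom) (m l : Term S) (n : ℕ) : ∀ k : ℕ,
    act (Arrow.promoteN (dN (C := yaq S) Ty.atom A B n) k) (.pair k m l) ⇛
      .pair (n + k) m l := by
  induction n with
  | zero =>
      intro k
      rw [Nat.zero_add]
      exact act_promoteN_id _ k _
  | succ n ih =>
      intro k
      refine (act_promoteN_comp _ _ k _).trans ((act_congr _ (act_promoteN_d _ _ k m l)).trans ?_)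
      rw [Nat.add_right_comm, Nat.add_assoc]
      exact .trans (.of_eq (act_promoteN_Lmap _ k _)) (ih (k + 1))

theorem act_dN (A B : Ty S.Atom) (m l : Term S) (n : ℕ) :
    act (dN (C := yaq S) Ty.atom A B n) (.pair 0 m l) ⇛ .pair n m l :=
  act_promoteN_dN A B m l n 0

/-- As for `dN`, but the argument need not be a pair, so it remains a scrutinee and the base case is
η for `⊗`. -/
theorem act_promoteN_dInvN (A B : Ty S.Atom) (m : Term S) (n : ℕ) : ∀ k : ℕ,
    act (Arrow.promoteN (dInvN (C := yaq S) Ty.atom A B n) k) m ⇛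
      .letpair (n + k) ((yaq S).ty Ty.atom A) ((yaq S).ty Ty.atom B) m
        (.pair k (.var 1 (Ty.bangs k ((yaq S).ty Ty.atom (Ty.bangs n A))))
          (.var 0 (Ty.bangs k ((yaq S).ty Ty.atom (Ty.bangs n B))))) := by
  induction n with
  | zero =>
      intro k
      rw [Nat.zero_add]
      refine .of_typed fun γ T h => (act_promoteN_id _ k _).trans (Red.letpair_eta_symm k ?_)
      obtain ⟨_, _, _, h, _⟩ := (typed_letP (p := .var _)).1 h
      exact h.infer_eq
  | succ n ih =>
      intro k
      refine (act_promoteN_comp _ _ k _).trans ((act_congr _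
        (.trans (.of_eq (act_promoteN_Lmap _ k _)) (ih (k + 1)))).trans ?_)
      rw [Nat.add_right_comm n 1 k, Nat.add_assoc n k 1]
      refine (act_letP _ (.pair (n + (k + 1)) _ _) _ _).trans (Red.letpair _ _ _ (.refl m) ?_)
      refine (act_promoteN_dInv _ _ k _ _).trans (.of_eq ?_)
      exact congrArg₂ (fun X Y => Term.pair k (.var 1 X) (.var 0 Y))
        (Ty.bangs_bang k _).symm (Ty.bangs_bang k _).symm

end

/-! ### The tuple of the variables of a context -/

section
open DupOps
variable {S : Signature.{u, v}} {A B C : Ty S.Atom}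

/-- The tuple of the variables of a context. -/
def tup : Ctx S.Atom → Term S
  | [] => .unit 0
  | none :: Γ => (tup Γ).shift 1
  | some A :: Γ => .pair 0 ((tup Γ).shift 1) (.var 0 ((yaq S).ty Ty.atom A))

/-- The promotion of `tup Γ`, for a context `Γ` of the form `!Δ`. -/
def ptup : Ctx S.Atom → Term S
  | [] => .unit 1
  | none :: Γ => (ptup Γ).shift 1
  | some A :: Γ => .pair 1 ((ptup Γ).shift 1) (.var 0 (.bang ((yaq S).ty Ty.atom A)))

theorem IsValue.tup (Γ : Ctx S.Atom) : IsValue (tup Γ) := by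
  induction Γ with
  | nil => exact .unit 0
  | cons a Γ ih =>
      cases a with
      | none => exact ih.rename _
      | some A => exact .pair 0 (ih.rename _) (.var _ _)

theorem IsValue.ptup (Γ : Ctx S.Atom) : IsValue (ptup Γ) := by
  induction Γ with
  | nil => exact .unit 1
  | cons a Γ ih =>
      cases a with
      | none => exact ih.rename _
      | some A => exact .pair 1 (ih.rename _) (.var _ _)

theorem act_shift (f : Arrow S A B) {m N : Term S} (h : act f m ⇛ N) (k : ℕ) :
    act f (m.shift k) ⇛ N.shift k :=
  (Red.of_eq (act_rename f m _).symm).trans (h.shift k)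

theorem act_discardCtx {Γ : Ctx S.Atom} (b : AllBang Γ) :
    act (discardCtx (C := yaq S) Ty.atom b) (tup Γ) ⇛ .unit 0 := by
  induction b with
  | nil => exact act_id _ _
  | skip b ih => exact act_shift _ ih 1
  | cons A b ih =>
      refine (act_comp _ _ _).trans ((act_congr _ ((act_tensor _ _ _ _).trans
        (Red.pair 0 (act_shift _ ih 1) (act_discard _ 0)))).trans ?_)
      exact act_leftUnit _ _

theorem act_pick {Γ : Ctx S.Atom} {i : ℕ} (p : Pick Γ i A) :
    act (pick (C := yaq S) Ty.atom p) (tup Γ) ⇛ .var i ((yaq S).ty Ty.atom A) := by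
  induction p with
  | here b =>
      refine (act_comp _ _ _).trans ((act_congr _ ((act_tensor _ _ _ _).trans
        (Red.pair 0 (act_shift _ (act_discardCtx b) 1) (act_id _ _)))).trans ?_)
      exact act_leftUnit _ _
  | skip p ih => exact act_shift _ ih 1
  | weak B p ih =>
      refine (act_comp _ _ _).trans ((act_congr _ ((act_tensor _ _ _ _).trans
        (Red.pair 0 (act_shift _ ih 1) (act_discard _ 0)))).trans ?_)
      exact (act_rightUnit _ _ (.var _ _)).trans (Red.letunit_unit _)

/-- The tuple of a split context separates into the tuples of its shares. The side conditions of the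
reassociations hold because tuples of variables are values, and a shared variable is doubled by the
comonoid. -/
theorem act_split {Γ Γ₁ Γ₂ : Ctx S.Atom} (sp : Split Γ Γ₁ Γ₂) :
    act (split (C := yaq S) Ty.atom sp) (tup Γ) ⇛ .pair 0 (tup Γ₁) (tup Γ₂) := by
  induction sp with
  | nil => exact act_leftUnitInv _ _
  | skip s ih => exact act_shift _ ih 1
  | left A s ih =>
      refine (act_comp _ _ _).trans ((act_congr _ ((act_tensor _ _ _ _).trans
        (Red.pair 0 (act_shift _ ih 1) (act_id _ _)))).trans ?_)
      exact act_swapRight _ _ _ _ ((IsValue.tup _).rename _) ((IsValue.tup _).rename _)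
  | right A s ih =>
      refine (act_comp _ _ _).trans ((act_congr _ ((act_tensor _ _ _ _).trans
        (Red.pair 0 (act_shift _ ih 1) (act_id _ _)))).trans ?_)
      exact act_assocInv _ _ _ _ ((IsValue.tup _).rename _) ((IsValue.tup _).rename _)
  | both A s ih =>
      refine (act_comp _ _ _).trans ((act_congr _ ((act_tensor _ _ _ _).trans
        (Red.pair 0 (act_shift _ ih 1) (act_dup _ 0)))).trans ?_)
      refine (act_comp _ _ _).trans ((act_congr _ (act_assoc _ _ _ _ _ _)).trans ?_)
      refine (act_comp _ _ _).trans ((act_congr _ ((act_tensor _ _ _ _).trans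
        (Red.pair 0 (act_swapRight _ _ _ _ ((IsValue.tup _).rename _) ((IsValue.tup _).rename _))
          (act_id _ _)))).trans ?_)
      exact act_assocInv _ _ _ _ (.pair 0 ((IsValue.tup _).rename _) (.var _ _))
        ((IsValue.tup _).rename _)

theorem act_promoteCtx {Γ : Ctx S.Atom} (b : AllBang Γ) :
    act (promoteCtx (C := yaq S) Ty.atom b) (tup Γ) ⇛ ptup Γ := by
  induction b with
  | nil => exact (act_dOne _).trans (Red.letunit_unit _)
  | skip b ih => exact act_shift _ ih 1
  | cons A b ih =>
      refine (act_comp _ _ _).trans ((act_congr _ ((act_tensor _ _ _ _).trans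
        (Red.pair 0 (act_shift _ ih 1) (act_comult _ 0)))).trans ?_)
      exact act_d _ _ _ _

theorem act_feed {Γ Γ₁ Γ₂ : Ctx S.Atom} (sp : Split Γ Γ₁ Γ₂)
    (f : Arrow S ((yaq S).ctx Ty.atom Γ₁) A) :
    act (feed (C := yaq S) Ty.atom sp f) (tup Γ) ⇛ .pair 0 (tup Γ₂) (act f (tup Γ₁)) := by
  refine (act_comp _ _ _).trans ((act_congr _ (act_split sp)).trans ?_)
  refine (act_comp _ _ _).trans ((act_congr _ (act_swap _ _ _ (IsValue.tup _))).trans ?_)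
  exact (act_tensor _ _ _ _).trans (Red.pair 0 (act_id _ _) (.refl _))

theorem act_unpair (n : ℕ) (A B : Ty S.Atom) (Γ : Ctx S.Atom) (N : Term S) :
    act (unpair (C := yaq S) Ty.atom n A B Γ) (.pair 0 (tup Γ) N) ⇛
      .letpair n A B N (tup (some (Ty.bangs n B) :: some (Ty.bangs n A) :: Γ)) := by
  have h := act_promoteN_dInvN A B N n 0
  refine (act_comp _ _ _).trans ((act_congr _ ((act_tensor _ _ _ _).trans
    (Red.pair 0 (act_id _ _) h))).trans ?_)
  -- The tuple on the left is a value, so the destructuring of `N` can be pulled out of the pair.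
  refine (act_congr _ (Red.right_let (.pair 0) (.pair n _ _) _ _ (IsValue.tup Γ))).trans ?_
  refine (act_letP _ (.pair n _ _) _ _).trans
    ((Red.letpair n _ _ (.refl N) (act_assoc _ _ _ _ _ _)).trans (.of_eq ?_))
  rw [yaq_ty, yaq_ty]
  simp only [tup, Term.rename, Term.rename_rename]
  rfl

theorem ptup_castTo {Γ : Ctx S.Atom} (b : AllBang Γ) :
    (ptup Γ).castTo ((yaq S).ctx Ty.atom Γ) = tup Γ := by
  induction b with
  | nil => rfl
  | skip b ih => exact (Term.castTo_rename _ _ _).trans (congrArg (Term.shift 1) ih)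
  | cons A b ih =>
      exact congrArg (fun M => Term.pair 0 M (.var 0 _))
        ((Term.castTo_rename _ _ _).trans (congrArg (Term.shift 1) ih))

/-- Every variable of `ptup` is annotated with a type `!A`, and subtypes of such types are banged;
unused declarations are discardable in any case. -/
theorem Typed.disc_ptup {Γ : Ctx S.Atom} :
    ∀ {γ : ℕ → Option (Ty S.Atom)} {T : Ty S.Atom}, Typed (ptup Γ) γ T → ∀ i, Disc (γ i) := by
  have key : ∀ (M : Term S), (∀ {γ : ℕ → Option (Ty S.Atom)} {T : Ty S.Atom},
      Typed M γ T → ∀ i, Disc (γ i)) → ∀ (γ : ℕ → Option (Ty S.Atom)) (T : Ty S.Atom),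
      Typed (M.shift 1) γ T → ∀ i, Disc (γ i) := by
    intro M ih γ T h i
    obtain ⟨h, hd⟩ := h.unrename (fun _ _ h => Nat.succ_injective h)
    cases i with
    | zero => exact hd 0 fun i => Nat.succ_ne_zero i
    | succ i => exact ih h i
  induction Γ with
  | nil => rintro γ T ⟨-, h⟩; exact h
  | cons a Γ ih =>
      cases a with
      | none => intro γ T; exact key (ptup Γ) ih γ T
      | some A =>
          rintro γ T ⟨γ₁, γ₂, _, _, -, hp, h₁, ⟨-, ⟨X, hX, ⟨s⟩⟩, h₂⟩⟩ i
          refine (hp i).disc (key _ ih _ _ h₁ i) ?_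
          cases i with
          | zero => rw [hX]; exact disc_some.2 s.eq_bang
          | succ i => exact h₂ _ (Nat.succ_ne_zero i)

/-- A value typable only in duplicable contexts may enter a λ of any index. -/
theorem Red.let_lam_of_disc (n : ℕ) (A D : Ty S.Atom) {V : Term S} (M : Term S) (hV : IsValue V)
    (hd : ∀ γ T, Typed V γ T → ∀ i, Disc (γ i)) :
    .letIn D V (.lam n A M) ⇛ .lam n A (.letIn D (V.shift 1) (M.rename (swapRen 1 1))) := by
  refine of_axm (.let_lam n A D M hV) fun γ T h => ?_
  obtain ⟨γ₁, γ₂, hp, hV, ⟨B, rfl, hn, hM⟩⟩ := (typed_letP (p := .var D)).1 h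
  exact ⟨B, rfl, fun h0 i => (hp i).disc (hd _ _ hV i) (hn h0 (i + 1)),
    (typed_letP (p := .var D)).2 ⟨_, _, (hp.symm.ext_left (.var A)).symm,
      hV.rename (Ren.pad 1 _), hM.rename (Ren.swap (.var D) (.var A) _)⟩⟩

/-- Promotion changes only the index of the outer λ, so its body still uses the context variable at
the unpromoted type. Substituting the promoted tuple there casts it to that type, and `ptup_castTo`
turns it into the plain tuple. -/
theorem act_Lmap_PhiInv {Γ : Ctx S.Atom} (b : AllBang Γ)
    (f : Arrow S (.tensor ((yaq S).ctx Ty.atom Γ) B) (.lolli .one C)) :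
    act (Yaq.Lmap (Yaq.PhiInv f)) (ptup Γ) ⇛
      .lam 1 B (.app (act f (.pair 0 ((tup Γ).shift 1) (.var 0 B))) (.unit 0)) := by
  refine (Red.let_lam_of_disc 1 B _ _ (IsValue.ptup Γ) fun _ _ => Typed.disc_ptup).trans
    (Red.lam 1 B ?_)
  generalize hX : (yaq S).ctx Ty.atom Γ = X at f
  change Ty S.Atom at X
  refine .trans ?_ (Red.let_left .app (.var (.tensor X B)) _ f.tm (.unit 0))
  have h := Red.let_let_symm (.var (.tensor X B)) (.var (.bang X)) ((ptup Γ).shift 1)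
    (.pair 0 (.var 0 X) (.var 1 B)) (.app f.tm (.unit 0))
  refine .trans (.of_eq ?_) (h.trans (Red.letIn _ ((Red.let_left (.pair 0) (.var _)
    ((ptup Γ).shift 1) (.var 0 X) (.var 0 B)).trans
      (Red.pair 0 ((Red.let_cast (.bang X) X ((ptup Γ).shift 1)).trans (.of_eq ?_)) (.refl _)))
    (.refl _)))
  · simp only [Term.letP, Term.rename, Pat.arity, f.rename_eq (r := liftRenN 1 fun i => i + 1) rfl,
      f.rename_eq (r := liftRen (swapRen 1 1)) rfl]
    rfl
  · subst hX
    exact (Term.castTo_rename _ _ _).trans (congrArg (Term.shift 1) (ptup_castTo b))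

end

/-! ### The denotation of a term is the term -/

section
open DupOps
variable {S : Signature.{u, v}} {A B C : Ty S.Atom}

theorem act_varV {Γ : Ctx S.Atom} {i : ℕ} (p : Pick Γ i A) (s : Sub A B) :
    act (varV (idInterp S) p s) (tup Γ) ⇛ .var i B := by
  refine (act_comp _ _ _).trans ((act_congr _ (act_pick p)).trans
    ((IsCast.sub s).act _ |>.trans (.of_eq ?_)))
  exact congrArg (Term.var i) (yaq_ty B)

theorem act_constV {Γ : Ctx S.Atom} (c : S.Const) (b : AllBang Γ) (s : Sub (.bang (S.ty c)) B) :
    act (constV (idInterp S) c b s) (tup Γ) ⇛ .const c B := by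
  refine (act_comp _ _ _).trans ((act_congr _ (act_discardCtx b)).trans ?_)
  refine (act_comp _ _ _).trans ((act_congr _ ((Red.letP_var .unit (.unit 0)
    (.const c (.bang (S.ty c)))).trans (Red.letunit_unit _))).trans
      ((IsCast.sub s).act _ |>.trans (.of_eq ?_)))
  exact congrArg (Term.const c) (yaq_ty B)

theorem act_oneV {Γ : Ctx S.Atom} (n : ℕ) (b : AllBang Γ) :
    act (oneV (idInterp S) n b) (tup Γ) ⇛ .unit n := by
  refine (act_comp _ _ _).trans ((act_congr _ (act_discardCtx b)).trans ?_)
  refine (act_comp _ _ _).trans ((act_congr _ ((act_dOne _).trans (Red.letunit_unit _))).trans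
    ((IsCast.bangMap .one 1 n (.inr le_rfl)).act _ |>.trans (.of_eq ?_)))
  refine congrArg Term.unit ?_
  rw [yaq_ty, Ty.nb_bangs]
  rfl

theorem act_lam1V {Γ : Ctx S.Atom} {M : Term S}
    {f : Arrow S ((yaq S).ctx Ty.atom (some A :: Γ)) (.lolli .one ((yaq S).ty Ty.atom B))}
    (h : act f (tup (some A :: Γ)) ⇛ M.lamU) :
    act (lam1V (idInterp S) f) (tup Γ) ⇛ .lam 0 A M := by
  refine (act_PhiInv _ (IsValue.tup Γ)).trans ((Red.lam 0 _ ((app_congr_unit h).trans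
    (Red.app_lamU M))).trans (.of_eq ?_))
  exact congrArg (fun X => Term.lam 0 X M) (yaq_ty A)

theorem act_lam2V {Γ : Ctx S.Atom} {M : Term S} (n : ℕ) (b : AllBang Γ)
    (d : Deriv (some A :: Γ) M B)
    {f : Arrow S ((yaq S).ctx Ty.atom (some A :: Γ)) (.lolli .one ((yaq S).ty Ty.atom B))}
    (h : act f (tup (some A :: Γ)) ⇛ M.lamU) :
    act (lam2V (idInterp S) n b f) (tup Γ) ⇛ .lam (n + 1) A M := by
  refine (act_comp _ _ _).trans ((act_congr _ (act_promoteCtx b)).trans ?_)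
  refine (act_comp _ _ _).trans ((act_congr _ ((act_Lmap_PhiInv b _).trans
    (Red.lam 1 _ ((app_congr_unit h).trans (Red.app_lamU M))))).trans
      ((IsCast.bangMap (.lolli A B) 1 (n + 1) (.inr le_rfl)).act _ |>.trans (.of_eq ?_)))
  rw [yaq_ty, yaq_ty, Term.castTo, Ty.core_bangs, Ty.nb_bangs]
  -- The final cast changes only the index of the λ: the body is cast to its own type, which leaves
  -- it unchanged.
  exact congrArg (Term.lam (n + 1) A) (Term.castTo_self d.typed)

/-- The target does not depend on the derivation, which yields the independence claimed in the
theorem. Each case pushes the tuple through the factors of the denotation; the monad then supplies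
the thunk, whose body is recovered by forcing the thunks of the subterms. -/
theorem act_denC {Γ : Ctx S.Atom} {M : Term S} (d : Deriv Γ M A) :
    act (denC (idInterp S) d) (tup Γ) ⇛ M.lamU := by
  induction d with
  | ax1 p s =>
      exact (act_comp _ _ _).trans ((act_congr _ (act_varV p s)).trans (act_unit _ (.var _ _)))
  | ax2 c b s =>
      exact (act_comp _ _ _).trans ((act_congr _ (act_constV c b s)).trans
        (act_unit _ (.const _ _)))
  | oneI n b =>
      exact (act_comp _ _ _).trans ((act_congr _ (act_oneV n b)).trans (act_unit _ (.unit _)))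
  | lam1 d ih =>
      exact (act_comp _ _ _).trans ((act_congr _ (act_lam1V ih)).trans (act_unit _ (.lam _ _ _)))
  | lam2 n b d ih =>
      exact (act_comp _ _ _).trans ((act_congr _ (act_lam2V n b d ih)).trans
        (act_unit _ (.lam _ _ _)))
  | app sp d e ihd ihe =>
      refine (act_comp _ _ _).trans ((act_congr _ (act_split sp)).trans ?_)
      refine (act_comp _ _ _).trans ((act_congr _ ((act_tensor _ _ _ _).trans
        (Red.pair 0 ihd ihe))).trans ?_)
      refine (act_comp _ _ _).trans ((act_congr _ (act_Psi _ _ _ _)).trans ?_)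
      exact (act_star _ _).trans (Red.lamU (app_act_ev _ _ _ _))
  | tensorI n sp d e ihd ihe =>
      refine (act_comp _ _ _).trans ((act_congr _ (act_split sp)).trans ?_)
      refine (act_comp _ _ _).trans ((act_congr _ ((act_tensor _ _ _ _).trans
        (Red.pair 0 ihd ihe))).trans ?_)
      refine (act_comp _ _ _).trans ((act_congr _ (act_Psi _ _ _ _)).trans ?_)
      exact (act_Tmap _ _).trans (Red.lamU (act_dN _ _ _ _ n))
  | @oneE Γ Γ₁ Γ₂ M N A sp d e ihd ihe =>
      refine (act_comp _ _ _).trans ((act_congr _ ((act_feed sp _).trans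
        (Red.pair 0 (.refl _) ihd))).trans ?_)
      refine (act_comp _ _ _).trans ((act_congr _
        (act_strength _ _ M (IsValue.tup Γ₂))).trans ?_)
      refine (act_star _ _).trans (Red.lamU ?_)
      refine (app_congr_unit ((act_comp _ _ _).trans ((act_congr _
        (act_rightUnit _ M (IsValue.tup Γ₂))).trans ((act_letP _ .unit M _).trans
          (Red.letunit (.refl M) ihe))))).trans ?_
      -- The application to `*` introduced by `star` is moved inside the `let`, where it forces the
      -- thunk of `N`.
      exact (Red.left_let .app .unit M N.lamU (.unit 0)).trans
        (Red.letunit (.refl M) (Red.app_lamU N))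
  | @tensorE Γ Γ₁ Γ₂ n M N A₁ A₂ C sp d e ihd ihe =>
      refine (act_comp _ _ _).trans ((act_congr _ ((act_feed sp _).trans
        (Red.pair 0 (.refl _) ihd))).trans ?_)
      refine (act_comp _ _ _).trans ((act_congr _
        (act_strength _ _ M (IsValue.tup Γ₂))).trans ?_)
      refine (act_comp _ _ _).trans ((act_congr _ ((act_Tmap _ _).trans
        (Red.lamU (act_unpair n A₁ A₂ Γ₂ M)))).trans ?_)
      refine (act_star _ _).trans (Red.lamU ?_)
      refine (app_congr_unit ((act_letP _ (.pair n A₁ A₂) M _).trans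
        (Red.letpair n A₁ A₂ (.refl M) ihe))).trans ?_
      exact (Red.left_let .app (.pair n A₁ A₂) M N.lamU (.unit 0)).trans
        (Red.letpair n A₁ A₂ (.refl M) (Red.app_lamU N))

theorem act_denV {V : Term S} (hV : IsValue V) : ∀ {Γ : Ctx S.Atom} {A : Ty S.Atom}
    (d : Deriv Γ V A), act (denV (idInterp S) V hV d) (tup Γ) ⇛ V := by
  induction hV with
  | var i A => rintro Γ _ (⟨p, s⟩); exact act_varV p s
  | const c A => rintro Γ _ (_ | ⟨_, b, s⟩); exact act_constV c b s
  | unit n => intro Γ A d; cases d with | oneI _ b => exact act_oneV n b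
  | lam n A M =>
      intro Γ B d
      cases d with
      | lam1 d => exact act_lam1V (act_denC d)
      | lam2 n b d => exact act_lam2V n b d (act_denC d)
  | pair n hV hW ihV ihW =>
      intro Γ B d
      cases d with
      | tensorI _ sp d e =>
          refine (act_comp _ _ _).trans ((act_congr _ (act_split sp)).trans ?_)
          refine (act_comp _ _ _).trans ((act_congr _ ((act_tensor _ _ _ _).trans
            (Red.pair 0 (ihV d) (ihW e)))).trans ?_)
          exact act_dN _ _ _ _ n
  | @letIn A V W hV hW ihV ihW =>
      intro Γ B d
      cases d with
      | @app _ Γ₁ Γ₂ _ _ _ _ sp d e =>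
          cases d with
          | lam1 d =>
              refine (act_comp _ _ _).trans ((act_congr _ (act_split sp)).trans ?_)
              refine (act_comp _ _ _).trans ((act_congr _ ((act_tensor _ _ _ _).trans
                (Red.pair 0 (act_id _ _) (ihV e)))).trans ?_)
              -- The tuple for `W` ends with a variable, not with `V`; expanding `V` to `let x = V
              -- in x` and pulling this `let` out of the pair produces that tuple.
              have h : V ⇛ .letIn A V (.var 0 ((yaq S).ty Ty.atom A)) := by
                have := Red.let_var_symm V
                rw [e.typed.infer_eq] at this
                rwa [yaq_ty]
              refine (act_congr _ ((Red.pair 0 (.refl _) h).trans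
                (Red.right_let (.pair 0) (.var A) V _ (IsValue.tup Γ₁)))).trans ?_
              exact (act_letP _ (.var A) V _).trans (Red.letIn A (.refl V) (ihW d))
  | @letpair n A B V W hV hW ihV ihW =>
      intro Γ C d
      cases d with
      | tensorE _ sp d e =>
          refine (act_comp _ _ _).trans ((act_congr _ ((act_feed sp _).trans
            (Red.pair 0 (.refl _) (ihV d)))).trans ?_)
          refine (act_comp _ _ _).trans ((act_congr _ (act_unpair n A B _ V)).trans ?_)
          exact (act_letP _ (.pair n A B) V _).trans (Red.letpair n A B (.refl V) (ihW e))
  | @letunit V W hV hW ihV ihW =>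
      intro Γ C d
      cases d with
      | oneE sp d e =>
          refine (act_comp _ _ _).trans ((act_congr _ ((act_feed sp _).trans
            (Red.pair 0 (.refl _) (ihV d)))).trans ?_)
          refine (act_comp _ _ _).trans ((act_congr _
            (act_rightUnit _ V (IsValue.tup _))).trans ?_)
          exact (act_letP _ .unit V _).trans (Red.letunit (.refl V) (ihW e))

/-- The identity interpretation of a type equals the type only by an induction, so the typing of the
arrow has to be transported along `yaq_ty` before rewriting applies. -/
theorem Red.eqax {f : Arrow S ((yaq S).ty Ty.atom A) ((yaq S).ty Ty.atom B)} {M : Term S}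
    (h : f.tm ⇛ M) : Eqax [some A] f.tm M B := by
  have h' := f.valid
  generalize f.tm = V at h h'
  rw [yaq_ty, yaq_ty] at h'
  exact h h'

end

end LinLam

theorem mainTheorem2 (S : LinLam.Signature.{u, v}) (A B : LinLam.Ty S.Atom) :
    (∀ (M : LinLam.Term S) (π : LinLam.Deriv [some A] M B),
      LinLam.Eqax [some A] (LinLam.denotC π).tm M.lamU (.lolli .one B)) ∧
    (∀ (V : LinLam.Term S) (hV : LinLam.IsValue V) (π : LinLam.Deriv [some A] V B),
      LinLam.Eqax [some A] (LinLam.denotV hV π).tm V B) :=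
  -- The tuple of `x : A` is `⟨*, x⟩`, which is the term of `leftUnitInv`, so the denotation is by
  -- definition the action on this tuple.
  ⟨fun _ π => LinLam.Red.eqax (B := .lolli .one B) (f := LinLam.denotC π) (LinLam.act_denC π),
    fun _ hV π => LinLam.Red.eqax (f := LinLam.denotV hV π) (LinLam.act_denV hV π)⟩
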